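/- Let $d\ge 2$ and $\chi\ge 1$. Consider a ring of $2L$ qudits ($d$ levels each) at positions $x\in\{\tfrac12,1,\dots,L\}$ (mod $L$). Let $U$ be a dual-unitary gate, i.e. a unitary $U$ on $\mathbb C^d\otimes\mathbb C^d$ such that $\tilde U_{(j,l);(i,k)}=U_{(i,j);(k,l)}$ is also unitary. Let $$p=\frac{d^4-\mathrm{tr}\big[(\tilde U^{t_2}(\tilde U^{t_2})^\dagger)^2\big]}{d^2(d^2-1)},\qquad \lambda(p)=(1-p)^2+\frac{p^2}{d^2-1},$$ where $t_2$ is the partial transpose on the second qudit ($p$ is the entangling power of $U$). *Noisy circuit.* One time step applies first a gate to every pair of sites $(x,x+\tfrac12)$ with $x$ an integer, then a gate to every pair $(x,x+\tfrac12)$ with $x$ a half-odd integer. Every gate of the circuit is $(u_+\otimes u_-)\,U\,(v_+\otimes v_-)$, where all the matrices $u_\pm,v_\pm$, for all gates and all times, are independent and Haar distributed on the unitary group $U(d)$. *Initial state.* Let $Z^{a,b}$ $(a,b=1,\dots,d)$ be complex $\chi\times\chi$ matrices with $$\frac1d\sum_{a,b}Z^{a,b}\otimes (Z^{a,b})^*=|L\rangle\langle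 R|,\qquad |L\rangle=\sum_{i=1}^{\chi}|i,i\rangle,\quad |R\rangle=\sum_{i=1}^{\chi}\lambda_i|i,i\rangle,\quad \lambda_i>0,\quad \sum_i\lambda_i=1,$$ where $*$ is entrywise complex conjugation (MPS fixed point of the RG flow), and let $$|\Psi_0\rangle=d^{-L/2}\sum_{a_1,\dots,a_{2L}}\mathrm{tr}\big[Z^{a_1,a_2}Z^{a_3,a_4}\cdots Z^{a_{2L-1},a_{2L}}\big]\,|a_1,\dots,a_{2L}\rangle ,$$ where $a_s$ labels the state of the qudit at position $s/2$. *Entanglement velocity.* Let $A$ be a block of $2L_A$ contiguous qudits with a fixed first site, let $\rho_A(t)$ be the reduced density matrix on $A$ of the state after $t$ time steps, and let $\bar S_A(t)=\mathbb E\big[-\mathrm{tr}\,\rho_A(t)\log\rho_A(t)\big]$, where $\mathbb E$ is the average over the noise. **Statement.** If $$\lambda(p)\,\chi\left(\frac{d+1}{d-1}+\sqrt{\frac{d+1}{d-1}}\right)<\frac1d ,$$ then for every such initial state and every choice of the first site of $A$ the noise-averaged entanglement velocity is maximal: $$\bar v_{\rm E}=\limsup_{t\to\infty}\ \lim_{L_A\to\infty}\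 \lim_{L\to\infty}\frac{\bar S_A(t)}{4t\log d}=1,$$ and in particular the two inner limits exist. -/

import Mathlib

open scoped Kronecker
open Filter Topology MeasureTheory

noncomputable section

namespace DualUnitary

/-! ### Local gates, dual unitarity, entangling power -/

/-- Two-qudit gates: `U (i, j) (k, l)` is the matrix element `U_{(i,j);(k,l)}`. -/
abbrev Gate (d : ℕ) : Type := Matrix (Fin d × Fin d) (Fin d × Fin d) ℂ

/-- The reshuffled gate `Ũ_{(j,l);(i,k)} = U_{(i,j);(k,l)}` (exchange of space and time). -/
def dualGate {d : ℕ} (U : Gate d) : Gate d :=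
  Matrix.of fun r c => U (c.1, r.1) (c.2, r.2)

/-- A gate is dual unitary if both `U` and `Ũ` are unitary. -/
def IsDualUnitary {d : ℕ} (U : Gate d) : Prop :=
  U ∈ Matrix.unitaryGroup (Fin d × Fin d) ℂ ∧
    dualGate U ∈ Matrix.unitaryGroup (Fin d × Fin d) ℂ

/-- Partial transpose with respect to the second qudit. -/
def partialTranspose₂ {d : ℕ} (M : Gate d) : Gate d :=
  Matrix.of fun r c => M (r.1, c.2) (c.1, r.2)

/-- The entangling power
`p = (d⁴ - tr[(Ũ^{t₂} (Ũ^{t₂})†)²]) / (d² (d² - 1))`; the trace is a nonnegative real. -/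
def entanglingPower {d : ℕ} (U : Gate d) : ℝ :=
  ((d : ℝ) ^ 4 -
      (((partialTranspose₂ (dualGate U)) * (partialTranspose₂ (dualGate U)).conjTranspose) ^ 2
        ).trace.re) /
    ((d : ℝ) ^ 2 * ((d : ℝ) ^ 2 - 1))

/-- `λ(p) = (1 - p)² + p² / (d² - 1)`. -/
def lambdaOf (d : ℕ) (p : ℝ) : ℝ :=
  (1 - p) ^ 2 + p ^ 2 / ((d : ℝ) ^ 2 - 1)

/-! ### The Haar probability measure on `U(d)` and the noise -/

/-- The unitary group `U(d)`. -/
abbrev UGroup (d : ℕ) : Type := Matrix.unitaryGroup (Fin d) ℂ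

instance (d : ℕ) : MeasurableSpace (UGroup d) := borel _

instance (d : ℕ) : BorelSpace (UGroup d) := ⟨rfl⟩

instance (d : ℕ) : CompactSpace (UGroup d) := by
  have hc : IsCompact ((Matrix.unitaryGroup (Fin d) ℂ : Set (Matrix (Fin d) (Fin d) ℂ))) := by
    have hK : IsCompact (Set.pi Set.univ fun _ : Fin d =>
        Set.pi Set.univ fun _ : Fin d => Metric.closedBall (0 : ℂ) 1) :=
      isCompact_univ_pi fun _ => isCompact_univ_pi fun _ => isCompact_closedBall 0 1
    refine IsCompact.of_isClosed_subset hK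
      (isClosed_unitary (R := Matrix (Fin d) (Fin d) ℂ)) ?_
    intro M hM i _ j _
    simpa using entry_norm_bound_of_unitary hM i j
  exact isCompact_iff_compactSpace.mp hc

/-- The Haar measure on `U(d)`, normalised to total mass one. -/
def haarU (d : ℕ) : Measure (UGroup d) := Measure.haarMeasure ⊤

instance (d : ℕ) : IsProbabilityMeasure (haarU d) :=
  ⟨by simpa [haarU] using Measure.haarMeasure_self (G := UGroup d) (K₀ := ⊤)⟩

/-- Labels of the one-site noise unitaries in a circuit of `2L` qudits run for `t` time steps:
time step, half step (`0` for `U₁`, `1` for `U₂`), gate in that layer, and the position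
`0, 1, 2, 3` for `u₊, u₋, v₊, v₋` in `(u₊ ⊗ u₋) U (v₊ ⊗ v₋)`. -/
abbrev NoiseLabel (L t : ℕ) : Type := Fin t × Fin 2 × Fin L × Fin 4

/-- All noise unitaries are independent and Haar distributed. -/
def noiseMeasure (d L t : ℕ) : Measure (NoiseLabel L t → UGroup d) :=
  Measure.pi fun _ => haarU d

/-- The noisy gate `(u₊ ⊗ u₋) U (v₊ ⊗ v₋)`. -/
def noisyGate {d : ℕ} (U : Gate d) (u : Fin 4 → UGroup d) : Gate d :=
  ((u 0 : Matrix (Fin d) (Fin d) ℂ) ⊗ₖ (u 1 : Matrix (Fin d) (Fin d) ℂ)) * U *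
    ((u 2 : Matrix (Fin d) (Fin d) ℂ) ⊗ₖ (u 3 : Matrix (Fin d) (Fin d) ℂ))

/-! ### The brickwork circuit on a ring of `2L` qudits

The site with half-integer position `x ∈ {1/2, 1, …, L}` has index `2x - 1 ∈ {0, …, 2L - 1}`. -/

/-- Computational basis configurations of `2L` qudits. -/
abbrev Config (d L : ℕ) : Type := Fin (2 * L) → Fin d

/-- The site `k + 1/2` (index `2k`). -/
def evenSite {L : ℕ} (k : Fin L) : Fin (2 * L) := ⟨2 * k.val, by omega⟩

/-- The site `k + 1` (index `2k + 1`). -/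
def oddSite {L : ℕ} (k : Fin L) : Fin (2 * L) := ⟨2 * k.val + 1, by omega⟩

/-- The site `k + 3/2` (index `2k + 2`, modulo `2L`). -/
def nextEvenSite {L : ℕ} (k : Fin L) : Fin (2 * L) :=
  ⟨(2 * k.val + 2) % (2 * L), Nat.mod_lt _ (by have := k.isLt; omega)⟩

/-- The layer `U₁ = ⨂_k G k`, with `G k` acting on the sites `k + 1` and `k + 3/2`. -/
def layer₁ {d L : ℕ} (G : Fin L → Gate d) : Matrix (Config d L) (Config d L) ℂ :=
  Matrix.of fun a b =>
    ∏ k, G k (a (oddSite k), a (nextEvenSite k)) (b (oddSite k), b (nextEvenSite k))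

/-- The layer `U₂ = ⨂_k G k`, with `G k` acting on the sites `k + 1/2` and `k + 1`. -/
def layer₂ {d L : ℕ} (G : Fin L → Gate d) : Matrix (Config d L) (Config d L) ℂ :=
  Matrix.of fun a b =>
    ∏ k, G k (a (evenSite k), a (oddSite k)) (b (evenSite k), b (oddSite k))

/-- The noisy evolution operator `U₂ U₁` of one time step. -/
def stepOp {d L : ℕ} (U : Gate d) (u : Fin 2 × Fin L × Fin 4 → UGroup d) :
    Matrix (Config d L) (Config d L) ℂ :=
  layer₂ (fun k => noisyGate U fun j => u (1, k, j)) *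
    layer₁ (fun k => noisyGate U fun j => u (0, k, j))

/-- The state after `t` noisy time steps, starting from `ψ₀`. -/
def evolve {d L : ℕ} (U : Gate d) (ψ₀ : Config d L → ℂ) :
    (t : ℕ) → (NoiseLabel L t → UGroup d) → Config d L → ℂ
  | 0, _ => ψ₀
  | t + 1, u =>
      (stepOp U fun i => u (Fin.last t, i)).mulVec
        (evolve U ψ₀ t fun i => u (i.1.castSucc, i.2))

/-! ### Matrix product states that are fixed points of the RG flow -/

/-- The tensors `Z^{a,b}` of a two-site shift invariant MPS with bond dimension `χ`. -/
abbrev MPSTensor (d χ : ℕ) : Type := Fin d → Fin d → Matrix (Fin χ) (Fin χ) ℂ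

/-- The amplitudes `d^{-L/2} tr[Z^{a₁,a₂} Z^{a₃,a₄} ⋯ Z^{a_{2L-1},a_{2L}}]`. -/
def mpsState {d χ : ℕ} (Z : MPSTensor d χ) (L : ℕ) : Config d L → ℂ := fun a =>
  (((Real.sqrt ((d : ℝ) ^ L))⁻¹ : ℝ) : ℂ) *
    ((List.ofFn fun k : Fin L => Z (a (evenSite k)) (a (oddSite k))).prod).trace

/-- The RG fixed-point condition `(1/d) ∑_{a,b} Z^{a,b} ⊗ (Z^{a,b})^* = |L⟩⟨R|`, where
`|L⟩ = ∑ᵢ |i,i⟩`, `|R⟩ = ∑ᵢ wᵢ |i,i⟩`, `wᵢ > 0` and `∑ᵢ wᵢ = 1`. -/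
def IsRGFixedPoint {d χ : ℕ} (Z : MPSTensor d χ) : Prop :=
  ∃ w : Fin χ → ℝ, (∀ i, 0 < w i) ∧ ∑ i, w i = 1 ∧
    (1 / (d : ℂ)) • ∑ a, ∑ b, (Z a b) ⊗ₖ ((Z a b).map star) =
      Matrix.vecMulVec
        (fun i : Fin χ × Fin χ => if i.1 = i.2 then (1 : ℂ) else 0)
        (fun j : Fin χ × Fin χ => if j.1 = j.2 then ((w j.1 : ℝ) : ℂ) else 0)

/-! ### Entanglement entropy -/

/-- The configuration equal to `a` on the subsystem `A` and to `b` on its complement. -/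
def glue {d L : ℕ} (A : Finset (Fin (2 * L))) (a : {s // s ∈ A} → Fin d)
    (b : {s // s ∉ A} → Fin d) : Config d L :=
  fun s => if h : s ∈ A then a ⟨s, h⟩ else b ⟨s, h⟩

/-- The reduced density matrix `ρ_A = tr_{Ā} |ψ⟩⟨ψ|`. -/
def reducedDensity {d L : ℕ} (A : Finset (Fin (2 * L))) (ψ : Config d L → ℂ) :
    Matrix ({s // s ∈ A} → Fin d) ({s // s ∈ A} → Fin d) ℂ :=
  Matrix.of fun a a' => ∑ b : {s // s ∉ A} → Fin d, ψ (glue A a b) * star (ψ (glue A a' b))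

theorem reducedDensity_isHermitian {d L : ℕ} (A : Finset (Fin (2 * L))) (ψ : Config d L → ℂ) :
    (reducedDensity A ψ).IsHermitian := by
  ext a a'
  simp [reducedDensity, Matrix.conjTranspose_apply, mul_comm]

/-- The entanglement entropy `S_A = -tr[ρ_A log ρ_A]`, from the eigenvalues of `ρ_A`
(with `0 log 0 = 0`). -/
def entanglementEntropy {d L : ℕ} (A : Finset (Fin (2 * L))) (ψ : Config d L → ℂ) : ℝ :=
  ∑ i, Real.negMulLog ((reducedDensity_isHermitian A ψ).eigenvalues i)

/-- The block of `2 L_A` contiguous qudits whose first site has index `x₁`. -/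
def block (L x₁ LA : ℕ) : Finset (Fin (2 * L)) :=
  Finset.univ.filter fun s => x₁ ≤ s.val ∧ s.val < x₁ + 2 * LA

/-- `S_A(t)` for one realisation of the noise, starting from the MPS of `Z`. -/
def entropyAt {d χ : ℕ} (U : Gate d) (Z : MPSTensor d χ) (x₁ L LA t : ℕ)
    (u : NoiseLabel L t → UGroup d) : ℝ :=
  entanglementEntropy (block L x₁ LA) (evolve U (mpsState Z L) t u)

/-- The noise-averaged entropy `S̄_A(t)`. -/
def averagedEntropy {d χ : ℕ} (U : Gate d) (Z : MPSTensor d χ) (x₁ L LA t : ℕ) : ℝ :=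
  ∫ u, entropyAt U Z x₁ L LA t u ∂(noiseMeasure d L t)

/-- The statement that
`limsup_{t → ∞} lim_{L_A → ∞} lim_{L → ∞} S̄_A(t) / (4 t log d) = v`, including that the averages
and the two inner limits exist. -/
def HasAveragedEntanglementVelocity {d χ : ℕ} (U : Gate d) (Z : MPSTensor d χ) (x₁ : ℕ)
    (v : ℝ) : Prop :=
  (∀ L LA t, Integrable (entropyAt U Z x₁ L LA t) (noiseMeasure d L t)) ∧
  ∃ (f : ℕ → ℕ → ℝ) (g : ℕ → ℝ),
    (∀ t LA, Tendsto (fun L => averagedEntropy U Z x₁ L LA t / (4 * t * Real.log d)) atTop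
      (𝓝 (f t LA))) ∧
    (∀ t, Tendsto (f t) atTop (𝓝 (g t))) ∧
    IsBoundedUnder (· ≤ ·) atTop g ∧ IsBoundedUnder (· ≥ ·) atTop g ∧
    limsup g atTop = v

end DualUnitary

end

open scoped Kronecker
open Filter Topology MeasureTheory

noncomputable section

namespace DualUnitary

/-! ### Entropy of Hermitian matrices -/

section HermitianEntropy

variable {n m : Type*} [Fintype n] [DecidableEq n] [Fintype m] [DecidableEq m]

/-! The inner limits exist because the averaged entropy is eventually constant in $L$ and in $L_A$.
The transfer matrix of an RG fixed point is a rank-one projector, so inserting a cell into the ring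
does not change expectation values at some distance from it, and unitary layers spread the
disturbance by only one site per layer. Inserting the cell outside the block enlarges $L$; inserting
it inside and comparing the complements, which have the same entropy for a pure state, enlarges
$L_A$ (`averagedEntropy_succ_length`, `averagedEntropy_succ_block`).

Upper bound: the block has even length, so in each time step only one of the two layers has gates
across its ends. Each of these at most two gates multiplies the Schmidt rank by at most $d^2$, and
the initial rank is at most $\chi^5d^2$, whence $\bar S\le 4t\log d+O(1)$ (`averagedEntropy_le`).

Lower bound: entropy dominates an affine function of purity, so a bound $K$ on the averaged purity
gives $\bar S\ge-\log K$ (`le_averagedEntropy`). Averaging a noisy gate over the Haar measure turns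
purity into a linear evolution of patterns assigning to each site one of the two replica pairings, ◯
(`false`) or □ (`true`). Unitarity fixes equal pairs; dual unitarity and $p$ determine how a mixed
pair is rewritten (`integral_pairVec_vecMul_noisyGate`). The block is a domain of □ in a sea of ◯,
so only its two boundaries evolve, and independently as long as their light cones do not meet
(`iterate_twoEdgeStep`).

For one boundary write $\alpha,\gamma$ for the weights of creating an equal pair and of exchanging a
mixed one. The rewriting is solved by letters that travel on the light cone: with $A=◯-□/d$,
$B=□-◯/d$, $V=\alpha◯+\gamma□$, $V'=\alpha□+\gamma◯$ one has $◯□\to\frac1d□□+VA$, $A□\to VA$, $◯B\to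
BV'$, $◯V\to\frac1d◯◯+\gamma BV'$. A boundary thus moves left at cost $1/d$, may split into $VA$,
then moves right at cost $1/d$, and may finally open into a window between $B$ and $A$ that costs
$(|\alpha|+|\gamma|)^2$ per layer. The hypothesis on $p$ makes this last cost at most $1/d$ and
makes the signed weights a contraction in the supremum norm (`sq_weights_le`,
`sum_abs_gateWeight_le`). With quadratically many histories, $n$ layers give $O(n^2)d^{-n}$ per
boundary (`norm_iterate_edgeStep_le`). Two boundaries and about $2t$ layers give purity at most
$d^{-4t}$ up to a polynomial. The initial state enters this estimate only through the trivial bound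
$1$ on its purities. -/

theorem trace_pow_eq_sum_eigenvalues {A : Matrix n n ℂ} (hA : A.IsHermitian) (k : ℕ) :
    (A ^ k).trace = ((∑ i, hA.eigenvalues i ^ k : ℝ) : ℂ) := by
  conv_lhs => rw [hA.spectral_theorem, ← map_pow, Unitary.conjStarAlgAut_apply,
    Matrix.trace_mul_cycle, Unitary.coe_star_mul_self, one_mul, Matrix.diagonal_pow,
    Matrix.trace_diagonal]
  simp

/-- Polynomial spectral sums are read off from traces of powers, so neither the order nor the
continuity of individual eigenvalues ever matters. -/
theorem sum_eigenvalues_eval {A : Matrix n n ℂ} (hA : A.IsHermitian) (p : Polynomial ℝ) :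
    ∑ i, p.eval (hA.eigenvalues i) =
      ∑ k ∈ Finset.range (p.natDegree + 1), p.coeff k * ((A ^ k).trace).re := by
  simp_rw [trace_pow_eq_sum_eigenvalues hA, Complex.ofReal_re, Polynomial.eval_eq_sum_range,
    Finset.mul_sum]
  rw [Finset.sum_comm]

/-- The entropy of a Hermitian matrix is determined by the traces of its positive powers. -/
theorem sum_negMulLog_eq_of_trace_pow {A : Matrix n n ℂ} {B : Matrix m m ℂ}
    (hA : A.IsHermitian) (hB : B.IsHermitian)
    (h : ∀ k, (A ^ (k + 1)).trace = (B ^ (k + 1)).trace) :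
    ∑ i, Real.negMulLog (hA.eigenvalues i) = ∑ i, Real.negMulLog (hB.eigenvalues i) := by
  classical
  -- The node `0` forces the interpolating polynomial to have no constant term, so the zeroth
  -- powers, whose traces are the two possibly different dimensions, drop out.
  let s : Finset ℝ := insert 0 (Finset.univ.image hA.eigenvalues ∪ Finset.univ.image hB.eigenvalues)
  let p := Lagrange.interpolate s id Real.negMulLog
  have hp : ∀ x ∈ s, p.eval x = Real.negMulLog x := fun x hx =>
    Lagrange.eval_interpolate_at_node (v := id) _ Function.injective_id.injOn hx
  have h0 : p.coeff 0 = 0 := by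
    rw [Polynomial.coeff_zero_eq_eval_zero, hp 0 (by simp [s])]; simp
  have h1 : ∑ i, Real.negMulLog (hA.eigenvalues i) = ∑ i, p.eval (hA.eigenvalues i) :=
    Finset.sum_congr rfl fun i _ => (hp _ (by simp [s])).symm
  have h2 : ∑ i, Real.negMulLog (hB.eigenvalues i) = ∑ i, p.eval (hB.eigenvalues i) :=
    Finset.sum_congr rfl fun i _ => (hp _ (by simp [s])).symm
  rw [h1, h2, sum_eigenvalues_eval, sum_eigenvalues_eval, Finset.sum_range_succ',
    Finset.sum_range_succ' _ p.natDegree, h0]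
  simp [h]

/-- Compactness bounds all eigenvalues uniformly through the trace of the square; on that interval
Weierstrass replaces $-x\log x$ by a polynomial, whose spectral sum is continuous. -/
theorem continuous_sum_negMulLog {X : Type*} [TopologicalSpace X] [CompactSpace X]
    (A : X → Matrix n n ℂ) (hc : Continuous A) (hA : ∀ x, (A x).IsHermitian) :
    Continuous fun x => ∑ i, Real.negMulLog ((hA x).eigenvalues i) := by
  have hct : ∀ k : ℕ, Continuous fun x => ((A x) ^ k).trace.re := fun k =>
    Complex.continuous_re.comp ((hc.pow k).matrix_trace)
  obtain ⟨C, hC⟩ : ∃ C : ℝ, ∀ x, ((A x) ^ 2).trace.re ≤ C := by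
    obtain ⟨C, hC⟩ := (isCompact_range (hct 2)).bddAbove
    exact ⟨C, fun x => hC ⟨x, rfl⟩⟩
  set B := Real.sqrt C
  have hB : ∀ x i, (hA x).eigenvalues i ∈ Set.Icc (-B) B := by
    intro x i
    have h1 : (hA x).eigenvalues i ^ 2 ≤ C := by
      refine le_trans ?_ (hC x)
      rw [trace_pow_eq_sum_eigenvalues (hA x), Complex.ofReal_re]
      exact Finset.single_le_sum (f := fun i => (hA x).eigenvalues i ^ 2)
        (fun i _ => sq_nonneg _) (Finset.mem_univ i)
    exact abs_le.mp (Real.abs_le_sqrt h1)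
  rw [continuous_iff_continuousAt]
  intro x₀
  rw [Metric.continuousAt_iff']
  intro ε hε
  set N : ℝ := Fintype.card n + 1
  have hN : 0 < N := by positivity
  obtain ⟨p, hp⟩ := exists_polynomial_near_of_continuousOn (-B) B Real.negMulLog
    Real.continuous_negMulLog.continuousOn (ε / (3 * N)) (by positivity)
  have key : ∀ x, |∑ i, Real.negMulLog ((hA x).eigenvalues i) -
      ∑ i, p.eval ((hA x).eigenvalues i)| ≤ ε / 3 := by
    intro x
    rw [← Finset.sum_sub_distrib]
    refine (Finset.abs_sum_le_sum_abs _ _).trans ?_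
    refine (Finset.sum_le_card_nsmul _ _ (ε / (3 * N)) ?_).trans ?_
    · intro i _
      rw [abs_sub_comm]
      exact (hp _ (hB x i)).le
    · rw [nsmul_eq_mul, Finset.card_univ]
      have : ε / 3 = N * (ε / (3 * N)) := by field_simp
      rw [this]
      gcongr
      simp [N]
  have hcp : Continuous fun x => ∑ i, p.eval ((hA x).eigenvalues i) := by
    simp_rw [fun x => sum_eigenvalues_eval (hA x) p]
    exact continuous_finsetSum _ fun k _ => continuous_const.mul (hct k)
  have := Metric.continuousAt_iff'.mp (hcp.continuousAt (x := x₀)) (ε / 3) (by positivity)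
  filter_upwards [this] with x hx
  rw [Real.dist_eq] at hx ⊢
  have h1 := abs_le.mp (key x)
  have h2 := abs_le.mp (key x₀)
  have h3 := abs_lt.mp hx
  rw [abs_lt]
  constructor <;> linarith [h1.1, h1.2, h2.1, h2.2, h3.1, h3.2]

/-- Tangent line of the logarithm at $K$: $\log x\le\log K+x/K-1$, multiplied by $x$ and summed. The
bound is affine in the purity, so it survives averaging and takes the place of Jensen's inequality.
-/
theorem le_sum_negMulLog {A : Matrix n n ℂ} (hA : A.IsHermitian)
    (hpos : ∀ i, 0 ≤ hA.eigenvalues i) (htr : A.trace = 1) {K : ℝ} (hK : 0 < K) :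
    -Real.log K + 1 - ((A ^ 2).trace).re / K ≤ ∑ i, Real.negMulLog (hA.eigenvalues i) := by
  have h1 : ∑ i, hA.eigenvalues i = 1 := by
    have := trace_pow_eq_sum_eigenvalues hA 1
    simp only [pow_one, htr] at this
    exact_mod_cast this.symm
  have h2 : ((A ^ 2).trace).re = ∑ i, hA.eigenvalues i ^ 2 := by
    rw [trace_pow_eq_sum_eigenvalues hA, Complex.ofReal_re]
  have h3 : ∀ i, hA.eigenvalues i * (-Real.log K + 1) -
      hA.eigenvalues i ^ 2 / K ≤ Real.negMulLog (hA.eigenvalues i) := by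
    intro i
    have hi := hpos i
    set x := hA.eigenvalues i
    rcases hi.eq_or_lt with h0 | h0
    · simp [← h0]
    · have := Real.log_le_sub_one_of_pos (div_pos h0 hK)
      rw [Real.log_div h0.ne' hK.ne'] at this
      have h4 := mul_le_mul_of_nonneg_left this h0.le
      have h5 : x * (x / K - 1) = x ^ 2 / K - x := by ring
      rw [h5] at h4
      unfold Real.negMulLog
      nlinarith
  calc -Real.log K + 1 - ((A ^ 2).trace).re / K
      = ∑ i, (hA.eigenvalues i * (-Real.log K + 1) - hA.eigenvalues i ^ 2 / K) := by
        rw [Finset.sum_sub_distrib, ← Finset.sum_mul, h1, h2, Finset.sum_div, one_mul]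
    _ ≤ _ := Finset.sum_le_sum fun i _ => h3 i

/-- Apply $\log y\le y-1$ with $y=1/(xN)$ at each nonzero eigenvalue; the terms $1/N$ add up to rank
over $N$, at most one. -/
theorem sum_negMulLog_le_log {A : Matrix n n ℂ} (hA : A.IsHermitian)
    (hpos : ∀ i, 0 ≤ hA.eigenvalues i) (htr : A.trace = 1)
    {N : ℝ} (hN : 0 < N) (hr : (A.rank : ℝ) ≤ N) :
    ∑ i, Real.negMulLog (hA.eigenvalues i) ≤ Real.log N := by
  classical
  have h1 : ∑ i, hA.eigenvalues i = 1 := by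
    have := trace_pow_eq_sum_eigenvalues hA 1
    simp only [pow_one, htr] at this
    exact_mod_cast this.symm
  have h3 : ∀ i, Real.negMulLog (hA.eigenvalues i) ≤ hA.eigenvalues i * Real.log N +
        ((if hA.eigenvalues i ≠ 0 then 1 else 0) / N - hA.eigenvalues i) := by
    intro i
    have hi := hpos i
    set x := hA.eigenvalues i
    rcases hi.eq_or_lt with h0 | h0
    · simp [← h0]
    · have := Real.log_le_sub_one_of_pos (inv_pos.mpr (mul_pos h0 hN))
      rw [Real.log_inv, Real.log_mul h0.ne' hN.ne'] at this
      have h4 := mul_le_mul_of_nonneg_left this h0.le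
      have h5 : x * ((x * N)⁻¹ - 1) = 1 / N - x := by field_simp
      rw [h5] at h4
      rw [if_pos h0.ne']
      unfold Real.negMulLog
      nlinarith
  have h4 : ∑ i, (if hA.eigenvalues i ≠ 0 then (1 : ℝ) else 0) = A.rank := by
    rw [hA.rank_eq_card_non_zero_eigs, Fintype.card_subtype, Finset.sum_boole]
  refine (Finset.sum_le_sum fun i _ => h3 i).trans ?_
  rw [Finset.sum_add_distrib, Finset.sum_sub_distrib, ← Finset.sum_mul, ← Finset.sum_div, h1, h4]
  have : (A.rank : ℝ) / N ≤ 1 := (div_le_one hN).mpr hr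
  linarith

end HermitianEntropy

/-! ### The entanglement entropy of a pure state -/

/-- The amplitudes of `ψ` as a matrix with rows on `A` and columns on its complement. -/
def amplitudeMatrix {d L : ℕ} (A : Finset (Fin (2 * L))) (ψ : Config d L → ℂ) :
    Matrix ({s // s ∈ A} → Fin d) ({s // s ∉ A} → Fin d) ℂ :=
  Matrix.of fun a b => ψ (glue A a b)

theorem reducedDensity_eq_mul {d L : ℕ} (A : Finset (Fin (2 * L))) (ψ : Config d L → ℂ) :
    reducedDensity A ψ = amplitudeMatrix A ψ * (amplitudeMatrix A ψ).conjTranspose := by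
  ext a a'
  simp [reducedDensity, amplitudeMatrix, Matrix.mul_apply]

open scoped ComplexOrder in
theorem eigenvalues_reducedDensity_nonneg {d L : ℕ} (A : Finset (Fin (2 * L)))
    (ψ : Config d L → ℂ) (i : {s // s ∈ A} → Fin d) :
    0 ≤ (reducedDensity_isHermitian A ψ).eigenvalues i := by
  have h : (reducedDensity A ψ).PosSemidef := by
    rw [reducedDensity_eq_mul]
    exact Matrix.posSemidef_self_mul_conjTranspose _
  exact h.eigenvalues_nonneg i

/-- Configurations split into their restrictions to `A` and to its complement. -/
def glueEquiv (d : ℕ) {L : ℕ} (A : Finset (Fin (2 * L))) :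
    (({s // s ∈ A} → Fin d) × ({s // s ∉ A} → Fin d)) ≃ Config d L where
  toFun x := glue A x.1 x.2
  invFun c := (fun s => c s, fun s => c s)
  left_inv x := by
    refine Prod.ext ?_ ?_ <;> funext s <;> simp [glue, s.2]
  right_inv c := by
    funext s
    simp [glue]

theorem sum_config_eq {d L : ℕ} (A : Finset (Fin (2 * L))) {E : Type*} [AddCommMonoid E]
    (f : Config d L → E) : ∑ c, f c = ∑ a, ∑ b, f (glue A a b) := by
  rw [← (glueEquiv d A).sum_comp f, Fintype.sum_prod_type]
  rfl

theorem trace_reducedDensity {d L : ℕ} (A : Finset (Fin (2 * L))) (ψ : Config d L → ℂ) :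
    (reducedDensity A ψ).trace = ∑ c, ψ c * star (ψ c) := by
  rw [sum_config_eq A]
  rfl

theorem continuous_entanglementEntropy {X : Type*} [TopologicalSpace X] [CompactSpace X]
    {d L : ℕ} (A : Finset (Fin (2 * L))) (ψ : X → Config d L → ℂ) (hψ : Continuous ψ) :
    Continuous fun x => entanglementEntropy A (ψ x) := by
  refine continuous_sum_negMulLog (fun x => reducedDensity A (ψ x)) ?_ _
  have h : ∀ c, Continuous fun x => ψ x c := fun c => (continuous_apply c).comp hψ
  refine continuous_matrix fun a a' => ?_
  exact continuous_finsetSum _ fun b _ => (h _).mul (h _).star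

/-- The exponent is positive because the zeroth powers are identities of possibly different sizes.
-/
theorem trace_mul_pow_comm {n m : Type*} [Fintype n] [DecidableEq n] [Fintype m] [DecidableEq m]
    (A : Matrix n m ℂ) (B : Matrix m n ℂ) (k : ℕ) :
    ((A * B) ^ (k + 1)).trace = ((B * A) ^ (k + 1)).trace := by
  have h : ∀ k : ℕ, (A * B) ^ k * A = A * (B * A) ^ k := by
    intro k
    induction k with
    | zero => simp
    | succ k ih => rw [pow_succ', Matrix.mul_assoc, ih, pow_succ']; simp only [Matrix.mul_assoc]
  rw [pow_succ, ← Matrix.mul_assoc, h, Matrix.mul_assoc, Matrix.trace_mul_comm, pow_succ,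
    Matrix.mul_assoc]

theorem trace_submatrix_equiv_pow {n m : Type*} [Fintype n] [DecidableEq n] [Fintype m]
    [DecidableEq m] (A : Matrix n n ℂ) (e : m ≃ n) (k : ℕ) :
    ((A.submatrix e e) ^ k).trace = (A ^ k).trace := by
  have h : (A.submatrix e e) ^ k = (A ^ k).submatrix e e := by
    induction k with
    | zero => simp
    | succ k ih => rw [pow_succ, pow_succ, ih, Matrix.submatrix_mul_equiv]
  rw [h, Matrix.trace, Matrix.trace]
  exact e.sum_comp fun i => (A ^ k).diag i

theorem glue_compl {d L : ℕ} (A : Finset (Fin (2 * L))) (a : {s // s ∈ Aᶜ} → Fin d)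
    (b : {s // s ∉ Aᶜ} → Fin d) :
    glue Aᶜ a b = glue A (fun s => b ⟨s, by simp [s.2]⟩) (fun s => a ⟨s, by simp [s.2]⟩) := by
  funext s
  by_cases h : s ∈ A <;> simp [glue, h]

/-- For a pure state, a region and its complement have the same entanglement entropy. -/
theorem entanglementEntropy_compl {d L : ℕ} (A : Finset (Fin (2 * L))) (ψ : Config d L → ℂ) :
    entanglementEntropy Aᶜ ψ = entanglementEntropy A ψ := by
  refine sum_negMulLog_eq_of_trace_pow _ _ fun k => ?_
  let e₁ : ({s // s ∈ Aᶜ} → Fin d) ≃ ({s // s ∉ A} → Fin d) :=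
    (Equiv.subtypeEquivRight fun s => by simp).arrowCongr (Equiv.refl _)
  let e₂ : ({s // s ∉ Aᶜ} → Fin d) ≃ ({s // s ∈ A} → Fin d) :=
    (Equiv.subtypeEquivRight fun s => by simp).arrowCongr (Equiv.refl _)
  set M := amplitudeMatrix A ψ with hM
  have h1 : amplitudeMatrix Aᶜ ψ = M.transpose.submatrix e₁ e₂ := by
    ext a b
    simp only [hM, amplitudeMatrix, Matrix.of_apply, Matrix.submatrix_apply,
      Matrix.transpose_apply, glue_compl]
    rfl
  have h2 : reducedDensity Aᶜ ψ = ((M.conjTranspose * M).transpose).submatrix e₁ e₁ := by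
    rw [reducedDensity_eq_mul, h1, Matrix.conjTranspose_submatrix, Matrix.submatrix_mul_equiv,
      Matrix.transpose_mul]
    rfl
  rw [h2, trace_submatrix_equiv_pow, ← Matrix.transpose_pow, Matrix.trace_transpose,
    trace_mul_pow_comm, reducedDensity_eq_mul]

set_option linter.unusedSectionVars false

/-! ### Operators that are products over pairs of sites -/

section Pairing

variable {K S α : Type*}

/-- The sites are partitioned into the pairs `(l k, r k)`. -/
def IsPairing (l r : K → S) : Prop := Function.Bijective (Sum.elim l r)

/-- Functions on the sites as functions on the pairs. -/
def pairEquiv {l r : K → S} (h : IsPairing l r) : (S → α) ≃ (K → α × α) :=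
  ((Equiv.ofBijective _ h).arrowCongr (Equiv.refl α)).symm.trans
    ((Equiv.sumArrowEquivProdArrow K K α).trans (Equiv.arrowProdEquivProdArrow K _ _).symm)

theorem pairEquiv_apply {l r : K → S} (h : IsPairing l r) (a : S → α) (k : K) :
    pairEquiv h a k = (a (l k), a (r k)) := rfl

theorem pairEquiv_symm_left {l r : K → S} (h : IsPairing l r) (x : K → α × α) (k : K) :
    (pairEquiv h).symm x (l k) = (x k).1 := by
  have := pairEquiv_apply h ((pairEquiv h).symm x) k
  rw [Equiv.apply_symm_apply] at this
  rw [this]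

theorem pairEquiv_symm_right {l r : K → S} (h : IsPairing l r) (x : K → α × α) (k : K) :
    (pairEquiv h).symm x (r k) = (x k).2 := by
  have := pairEquiv_apply h ((pairEquiv h).symm x) k
  rw [Equiv.apply_symm_apply] at this
  rw [this]

theorem IsPairing.left_injective {l r : K → S} (h : IsPairing l r) : Function.Injective l :=
  fun a b hab => Sum.inl_injective (h.1 (a₁ := Sum.inl a) (a₂ := Sum.inl b) hab)

theorem IsPairing.right_injective {l r : K → S} (h : IsPairing l r) : Function.Injective r :=
  fun a b hab => Sum.inr_injective (h.1 (a₁ := Sum.inr a) (a₂ := Sum.inr b) hab)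

theorem IsPairing.left_ne_right {l r : K → S} (h : IsPairing l r) (a b : K) : l a ≠ r b :=
  fun hab => Sum.inl_ne_inr (h.1 (a₁ := Sum.inl a) (a₂ := Sum.inr b) hab)

theorem IsPairing.forall {l r : K → S} (h : IsPairing l r) {p : S → Prop} :
    (∀ s, p s) ↔ ∀ k, p (l k) ∧ p (r k) := by
  refine ⟨fun hp k => ⟨hp _, hp _⟩, fun hp s => ?_⟩
  obtain ⟨k | k, rfl⟩ := h.2 s
  exacts [(hp k).1, (hp k).2]

theorem IsPairing.funext_iff {l r : K → S} (h : IsPairing l r) {a b : S → α} :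
    a = b ↔ ∀ k, a (l k) = b (l k) ∧ a (r k) = b (r k) := by
  rw [_root_.funext_iff, h.forall]

theorem IsPairing.prod_eq [Fintype K] [Fintype S] {l r : K → S} (h : IsPairing l r)
    {M : Type*} [CommMonoid M] (f : S → M) : ∏ s, f s = ∏ k, f (l k) * f (r k) := by
  rw [Finset.prod_mul_distrib, ← (Equiv.ofBijective _ h).prod_comp, Fintype.prod_sum_type]
  rfl

theorem IsPairing.sum_prod [Fintype K] [DecidableEq K] [Fintype S] [DecidableEq S] [Fintype α]
    {l r : K → S} (h : IsPairing l r) {R : Type*} [CommSemiring R] (f : K → α × α → R) :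
    ∑ a : S → α, ∏ k, f k (a (l k), a (r k)) = ∏ k, ∑ x, f k x := by
  rw [Finset.prod_univ_sum, Fintype.piFinset_univ, ← (pairEquiv h).symm.sum_comp]
  simp only [pairEquiv_symm_left, pairEquiv_symm_right]

variable [Fintype K] {d : ℕ}

/-- The operator `⨂_k G k`, with `G k` acting on the sites `l k` and `r k`. -/
def pairMat (l r : K → S) (G : K → Gate d) : Matrix (S → Fin d) (S → Fin d) ℂ :=
  Matrix.of fun a b => ∏ k, G k (a (l k), a (r k)) (b (l k), b (r k))

theorem pairMat_conjTranspose (l r : K → S) (G : K → Gate d) :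
    (pairMat l r G).conjTranspose = pairMat l r fun k => (G k).conjTranspose := by
  ext a b
  simp [pairMat, Matrix.conjTranspose_apply]

variable [DecidableEq K] [Fintype S] [DecidableEq S]

theorem pairMat_mul {l r : K → S} (h : IsPairing l r) (G H : K → Gate d) :
    pairMat l r G * pairMat l r H = pairMat l r fun k => G k * H k := by
  ext a c
  simp only [pairMat, Matrix.mul_apply, Matrix.of_apply, ← Finset.prod_mul_distrib]
  exact h.sum_prod fun k x => G k (a (l k), a (r k)) x * H k x (c (l k), c (r k))

theorem pairMat_one {l r : K → S} (h : IsPairing l r) :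
    pairMat l r (fun _ => (1 : Gate d)) = 1 := by
  ext a b
  simp only [pairMat, Matrix.of_apply, Matrix.one_apply, Fintype.prod_boole, Prod.mk.injEq,
    h.funext_iff (a := a)]

/-- Linearity in a single gate. It serves twice: to reduce two-site operators to product operators,
and to count Schmidt terms of a gate across a cut. -/
theorem pairMat_update_sum (l r : K → S) (G : K → Gate d) (k : K) {I : Type*} (s : Finset I)
    (c : I → ℂ) (B : I → Gate d) :
    pairMat l r (Function.update G k (∑ i ∈ s, c i • B i)) =
      ∑ i ∈ s, c i • pairMat l r (Function.update G k (B i)) := by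
  ext a b
  have key : ∀ Y : Gate d, pairMat l r (Function.update G k Y) a b =
      Y (a (l k), a (r k)) (b (l k), b (r k)) *
        ∏ x ∈ Finset.univ.erase k, G x (a (l x), a (r x)) (b (l x), b (r x)) := by
    intro Y
    rw [pairMat, Matrix.of_apply, ← Finset.mul_prod_erase _ _ (Finset.mem_univ k),
      Function.update_self]
    congr 1
    refine Finset.prod_congr rfl fun x hx => ?_
    rw [Function.update_of_ne (Finset.ne_of_mem_erase hx)]
  rw [key, Matrix.sum_apply, Matrix.sum_apply, Finset.sum_mul]
  refine Finset.sum_congr rfl fun i _ => ?_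
  rw [Matrix.smul_apply, Matrix.smul_apply, key, smul_eq_mul, smul_eq_mul, mul_assoc]

/-- The product operator `⨂_s O s`. -/
def siteMat (O : S → Matrix (Fin d) (Fin d) ℂ) : Matrix (S → Fin d) (S → Fin d) ℂ :=
  Matrix.of fun a b => ∏ s, O s (a s) (b s)

theorem pairMat_kronecker {l r : K → S} (h : IsPairing l r)
    (O : S → Matrix (Fin d) (Fin d) ℂ) :
    pairMat l r (fun k => O (l k) ⊗ₖ O (r k)) = siteMat O := by
  ext a b
  simp [pairMat, siteMat, h.prod_eq, Matrix.kroneckerMap_apply]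

/-- The quadratic form `⟨ψ|M|ψ⟩`. -/
def expectation {I : Type*} [Fintype I] (ψ : I → ℂ) (M : Matrix I I ℂ) : ℂ :=
  star ψ ⬝ᵥ M.mulVec ψ

theorem expectation_mulVec {I : Type*} [Fintype I] (ψ : I → ℂ) (Λ M : Matrix I I ℂ) :
    expectation (Λ.mulVec ψ) M = expectation ψ (Λ.conjTranspose * M * Λ) := by
  simp only [expectation, Matrix.star_mulVec, ← Matrix.mulVec_mulVec, Matrix.dotProduct_mulVec]

theorem expectation_sum_smul {I J : Type*} [Fintype I] (ψ : I → ℂ) (s : Finset J) (c : J → ℂ)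
    (M : J → Matrix I I ℂ) :
    expectation ψ (∑ i ∈ s, c i • M i) = ∑ i ∈ s, c i * expectation ψ (M i) := by
  simp [expectation, Matrix.sum_mulVec, dotProduct_sum, Matrix.smul_mulVec, dotProduct_smul]

theorem expectation_pairMat_mulVec {l r : K → S} (h : IsPairing l r) (ψ : (S → Fin d) → ℂ)
    (G P : K → Gate d) :
    expectation ((pairMat l r G).mulVec ψ) (pairMat l r P) =
      expectation ψ (pairMat l r fun k => (G k).conjTranspose * P k * G k) := by
  rw [expectation_mulVec, pairMat_conjTranspose, pairMat_mul h, pairMat_mul h]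

theorem gate_eq_sum (Y : Gate d) :
    Y = ∑ e : (Fin d × Fin d) × (Fin d × Fin d),
      Y e.1 e.2 • (Matrix.single e.1.1 e.2.1 (1 : ℂ) ⊗ₖ Matrix.single e.1.2 e.2.2 (1 : ℂ)) := by
  ext x y
  rw [Matrix.sum_apply, Finset.sum_eq_single (x, y)]
  · simp [Matrix.kroneckerMap_apply]
  · rintro ⟨u, v⟩ _ hne
    simp only [Matrix.smul_apply, Matrix.kroneckerMap_apply, Matrix.single_apply, smul_eq_mul]
    by_cases h1 : u = x
    · have h2 : v ≠ y := fun h => hne (by rw [h1, h])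
      have : ¬ (v.1 = y.1 ∧ v.2 = y.2) := fun h => h2 (Prod.ext h.1 h.2)
      by_cases h3 : v.1 = y.1
      · simp [show ¬ v.2 = y.2 from fun h => this ⟨h3, h⟩]
      · simp [h3]
    · have : ¬ (u.1 = x.1 ∧ u.2 = x.2) := fun h => h1 (Prod.ext h.1 h.2)
      by_cases h3 : u.1 = x.1
      · simp [show ¬ u.2 = x.2 from fun h => this ⟨h3, h⟩]
      · simp [h3]
  · simp

end Pairing

/-! ### States that agree on a region -/

section Agree

variable {K S K' S' : Type*} {d : ℕ} [Fintype S] [DecidableEq S] [Fintype S'] [DecidableEq S']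

/-- The states `ψ'` and `ψ` have the same expectation values of product operators
supported on `D`, when `D` is embedded by `ι`. -/
def AgreeOn (ι : S → S') (D : Set S) (ψ' : (S' → Fin d) → ℂ) (ψ : (S → Fin d) → ℂ) : Prop :=
  ∀ O : S' → Matrix (Fin d) (Fin d) ℂ, (∀ s' ∉ ι '' D, O s' = 1) →
    expectation ψ' (siteMat O) = expectation ψ (siteMat (O ∘ ι))

theorem AgreeOn.mono {ι : S → S'} {D D' : Set S} {ψ' : (S' → Fin d) → ℂ} {ψ : (S → Fin d) → ℂ}
    (h : AgreeOn ι D ψ' ψ) (hD : D' ⊆ D) : AgreeOn ι D' ψ' ψ :=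
  fun O hO => h O fun s' hs' => hO s' fun hs => hs' (Set.image_mono hD hs)

variable [Fintype K] [DecidableEq K] [Fintype K'] [DecidableEq K']

/-- Agreement is only postulated for product operators, but conjugation by a layer yields two-site
operators. These are expanded in matrix units one gate at a time. -/
theorem AgreeOn.pairMat {ι : S → S'} (hι : Function.Injective ι) {D : Set S}
    {ψ' : (S' → Fin d) → ℂ} {ψ : (S → Fin d) → ℂ} (h : AgreeOn ι D ψ' ψ)
    {l r : K → S} (hlr : IsPairing l r) {l' r' : K' → S'} (hlr' : IsPairing l' r')
    {j : K → K'} (hj : Function.Injective j) (K₀ : Finset K)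
    (hl : ∀ k ∈ K₀, l' (j k) = ι (l k)) (hr : ∀ k ∈ K₀, r' (j k) = ι (r k))
    (hD : ∀ k ∈ K₀, l k ∈ D ∧ r k ∈ D)
    (P : K' → Gate d) (hP : ∀ k' ∉ K₀.image j, P k' = 1) :
    expectation ψ' (DualUnitary.pairMat l' r' P) =
      expectation ψ (DualUnitary.pairMat l r (P ∘ j)) := by
  -- Induction on the set `T` of gates that are not yet tensor products.
  suffices H : ∀ T ⊆ K₀, ∀ P : K' → Gate d, (∀ k' ∉ K₀.image j, P k' = 1) →
      (∀ k' ∉ T.image j, ∃ B₁ B₂ : Matrix (Fin d) (Fin d) ℂ, P k' = B₁ ⊗ₖ B₂) →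
      expectation ψ' (DualUnitary.pairMat l' r' P) =
        expectation ψ (DualUnitary.pairMat l r (P ∘ j)) from
    H K₀ subset_rfl P hP fun k' hk' => ⟨1, 1, by rw [hP k' hk', Matrix.one_kronecker_one]⟩
  intro T
  induction T using Finset.induction_on with
  | empty =>
    intro _ P hP hB
    -- Tensor factors are not unique (scalars can be moved between them), so outside `K₀` the choice
    -- of the factors `1, 1` must be imposed to keep the support in the region.
    have hB' : ∀ k', ∃ B : Matrix (Fin d) (Fin d) ℂ × Matrix (Fin d) (Fin d) ℂ,
        P k' = B.1 ⊗ₖ B.2 ∧ (k' ∉ K₀.image j → B = (1, 1)) := by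
      intro k'
      by_cases hk : k' ∈ K₀.image j
      · obtain ⟨B₁, B₂, hb⟩ := hB k' (by simp)
        exact ⟨(B₁, B₂), hb, fun h => absurd hk h⟩
      · exact ⟨(1, 1), by rw [hP k' hk, Matrix.one_kronecker_one], fun _ => rfl⟩
    choose B hB1 hB2 using hB'
    let O : S' → Matrix (Fin d) (Fin d) ℂ := (pairEquiv hlr').symm B
    have hOl : ∀ k', O (l' k') = (B k').1 := pairEquiv_symm_left hlr' B
    have hOr : ∀ k', O (r' k') = (B k').2 := pairEquiv_symm_right hlr' B
    have hO1 : ∀ s', (∀ k ∈ K₀, s' ≠ ι (l k) ∧ s' ≠ ι (r k)) → O s' = 1 := by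
      rw [hlr'.forall]
      intro k'
      refine ⟨fun hs => ?_, fun hs => ?_⟩
      · rw [hOl, hB2 k']
        intro hc
        obtain ⟨k, hk, rfl⟩ := Finset.mem_image.mp hc
        exact (hs k hk).1 (hl k hk)
      · rw [hOr, hB2 k']
        intro hc
        obtain ⟨k, hk, rfl⟩ := Finset.mem_image.mp hc
        exact (hs k hk).2 (hr k hk)
    have e1 : P = fun k' => O (l' k') ⊗ₖ O (r' k') := by
      funext k'
      rw [hOl, hOr, hB1]
    have e2 : P ∘ j = fun k => (O ∘ ι) (l k) ⊗ₖ (O ∘ ι) (r k) := by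
      funext k
      by_cases hk : k ∈ K₀
      · simp only [Function.comp_apply, ← hl k hk, ← hr k hk, hOl, hOr, hB1]
      · have hjk : j k ∉ K₀.image j := by
          intro h
          obtain ⟨k₁, hk₁, he⟩ := Finset.mem_image.mp h
          exact hk (hj he ▸ hk₁)
        have h1 : O (ι (l k)) = 1 := hO1 _ fun k₁ hk₁ =>
          ⟨fun he => hk (by rw [hlr.left_injective (hι he)]; exact hk₁),
            fun he => hlr.left_ne_right _ _ (hι he)⟩
        have h2 : O (ι (r k)) = 1 := hO1 _ fun k₁ hk₁ =>
          ⟨fun he => hlr.left_ne_right _ _ (hι he).symm,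
            fun he => hk (by rw [hlr.right_injective (hι he)]; exact hk₁)⟩
        simp only [Function.comp_apply, h1, h2, hP _ hjk, Matrix.one_kronecker_one]
    rw [e2, e1, pairMat_kronecker hlr', pairMat_kronecker hlr]
    refine h O fun s' hs' => hO1 s' fun k hk => ⟨?_, ?_⟩
    · rintro rfl
      exact hs' ⟨_, (hD k hk).1, rfl⟩
    · rintro rfl
      exact hs' ⟨_, (hD k hk).2, rfl⟩
  | insert k₀ T hk₀ ih =>
    intro hT P hP hB
    have hk₀K : k₀ ∈ K₀ := hT (Finset.mem_insert_self _ _)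
    have e : P = Function.update P (j k₀) (P (j k₀)) := (Function.update_eq_self _ _).symm
    rw [e, Function.update_comp_eq_of_injective _ hj, gate_eq_sum (P (j k₀)),
      pairMat_update_sum, pairMat_update_sum, expectation_sum_smul, expectation_sum_smul]
    refine Finset.sum_congr rfl fun x _ => ?_
    rw [← Function.update_comp_eq_of_injective _ hj]
    congr 1
    refine ih ((Finset.subset_insert _ _).trans hT) _ (fun k' hk' => ?_) fun k' hk' => ?_
    · rw [Function.update_of_ne, hP k' hk']
      rintro rfl
      exact hk' (Finset.mem_image_of_mem _ hk₀K)
    · by_cases hkk : k' = j k₀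
      · subst hkk
        exact ⟨_, _, Function.update_self ..⟩
      · rw [Function.update_of_ne hkk]
        refine hB k' ?_
        rw [Finset.image_insert, Finset.mem_insert, not_or]
        exact ⟨hkk, hk'⟩

/-- Layers of unitary gates preserve agreement on regions that are unions of gates. -/
theorem AgreeOn.layer {ι : S → S'} (hι : Function.Injective ι) {D : Set S}
    {ψ' : (S' → Fin d) → ℂ} {ψ : (S → Fin d) → ℂ} (h : AgreeOn ι D ψ' ψ)
    {l r : K → S} (hlr : IsPairing l r) {l' r' : K' → S'} (hlr' : IsPairing l' r')
    {j : K → K'} (hj : Function.Injective j)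
    (hl : ∀ k, l k ∈ D → l' (j k) = ι (l k)) (hr : ∀ k, r k ∈ D → r' (j k) = ι (r k))
    (hD : ∀ k, l k ∈ D ↔ r k ∈ D)
    {G : K → Gate d} {G' : K' → Gate d}
    (hG' : ∀ k, G' k ∈ Matrix.unitaryGroup _ ℂ) (hGG' : ∀ k, G' (j k) = G k) :
    AgreeOn ι D ((DualUnitary.pairMat l' r' G').mulVec ψ')
      ((DualUnitary.pairMat l r G).mulVec ψ) := by
  classical
  intro O hO
  -- A gate that meets only identities cancels against its adjoint; hence unitary gates outside the
  -- region may differ between the two rings.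
  have hconj : ∀ V ∈ Matrix.unitaryGroup (Fin d × Fin d) ℂ, V.conjTranspose * 1 * V = 1 := by
    intro V hV
    rw [mul_one]
    exact Matrix.mem_unitaryGroup_iff'.mp hV
  have hOι : ∀ s ∉ D, O (ι s) = 1 := by
    intro s hs
    refine hO _ ?_
    rintro ⟨t, ht, he⟩
    exact hs (hι he ▸ ht)
  rw [← pairMat_kronecker hlr', ← pairMat_kronecker hlr, expectation_pairMat_mulVec hlr',
    expectation_pairMat_mulVec hlr]
  let K₀ : Finset K := Finset.univ.filter fun k => l k ∈ D
  have hK₀ : ∀ k, k ∈ K₀ ↔ l k ∈ D := by simp [K₀]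
  rw [h.pairMat hι hlr hlr' hj K₀ (fun k hk => hl k ((hK₀ k).mp hk))
    (fun k hk => hr k ((hD k).mp ((hK₀ k).mp hk)))
    (fun k hk => ⟨(hK₀ k).mp hk, (hD k).mp ((hK₀ k).mp hk)⟩)]
  · congr 2
    funext k
    simp only [Function.comp_apply, hGG']
    by_cases hk : l k ∈ D
    · rw [hl k hk, hr k ((hD k).mp hk)]
    · have h1 : ∀ s' ∉ ι '' D, O s' = 1 := hO
      have hk' : j k ∉ K₀.image j := by
        intro hc
        obtain ⟨k₁, hk₁, he⟩ := Finset.mem_image.mp hc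
        exact hk ((hK₀ k).mp (hj he ▸ hk₁))
      have hnot : l' (j k) ∉ ι '' D ∧ r' (j k) ∉ ι '' D := by
        constructor
        · rintro ⟨s, hs, he⟩
          obtain ⟨k₁ | k₁, rfl⟩ := hlr.2 s
          · simp only [Sum.elim_inl] at hs he
            rw [← hl k₁ hs] at he
            exact hk (hj (hlr'.left_injective he) ▸ hs)
          · simp only [Sum.elim_inr] at hs he
            rw [← hr k₁ hs] at he
            exact hlr'.left_ne_right _ _ he.symm
        · rintro ⟨s, hs, he⟩
          obtain ⟨k₁ | k₁, rfl⟩ := hlr.2 s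
          · simp only [Sum.elim_inl] at hs he
            rw [← hl k₁ hs] at he
            exact hlr'.left_ne_right _ _ he
          · simp only [Sum.elim_inr] at hs he
            rw [← hr k₁ hs] at he
            exact hk ((hD k).mpr (hj (hlr'.right_injective he) ▸ hs))
      rw [hO _ hnot.1, hO _ hnot.2, hOι _ hk, hOι _ (fun hc => hk ((hD k).mpr hc))]
  · intro k' hk'
    have hnot : l' k' ∉ ι '' D ∧ r' k' ∉ ι '' D := by
      constructor
      · rintro ⟨s, hs, he⟩
        obtain ⟨k₁ | k₁, rfl⟩ := hlr.2 s
        · simp only [Sum.elim_inl] at hs he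
          rw [← hl k₁ hs] at he
          exact hk' (hlr'.left_injective he ▸
            Finset.mem_image_of_mem _ ((hK₀ k₁).mpr hs))
        · simp only [Sum.elim_inr] at hs he
          rw [← hr k₁ hs] at he
          exact hlr'.left_ne_right _ _ he.symm
      · rintro ⟨s, hs, he⟩
        obtain ⟨k₁ | k₁, rfl⟩ := hlr.2 s
        · simp only [Sum.elim_inl] at hs he
          rw [← hl k₁ hs] at he
          exact hlr'.left_ne_right _ _ he
        · simp only [Sum.elim_inr] at hs he
          rw [← hr k₁ hs] at he
          exact hk' (hlr'.right_injective he ▸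
            Finset.mem_image_of_mem _ ((hK₀ k₁).mpr ((hD k₁).mpr hs)))
    rw [hO _ hnot.1, hO _ hnot.2, Matrix.one_kronecker_one, hconj _ (hG' k')]

end Agree

/-! ### Inserting a cell into the ring -/

theorem isPairing_even_odd (L : ℕ) : IsPairing (evenSite (L := L)) oddSite := by
  constructor
  · rintro (a | a) (b | b) h <;> simp only [Sum.elim_inl, Sum.elim_inr, evenSite, oddSite,
      Fin.mk.injEq] at h
    · exact congrArg _ (Fin.ext (by omega))
    · omega
    · omega
    · exact congrArg _ (Fin.ext (by omega))
  · intro s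
    have hs := s.isLt
    rcases Nat.even_or_odd' s.val with ⟨c, hc | hc⟩
    · exact ⟨Sum.inl ⟨c, by omega⟩, Fin.ext (by simp [evenSite, hc])⟩
    · exact ⟨Sum.inr ⟨c, by omega⟩, Fin.ext (by simp [oddSite, hc])⟩

theorem nextEvenSite_val {L : ℕ} (k : Fin L) :
    (nextEvenSite k).val = if k.val + 1 = L then 0 else 2 * k.val + 2 := by
  have := k.isLt
  unfold nextEvenSite
  split_ifs with h
  · have : 2 * k.val + 2 = 2 * L := by omega
    simp [this]
  · exact Nat.mod_eq_of_lt (by omega)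

theorem isPairing_odd_nextEven (L : ℕ) : IsPairing (oddSite (L := L)) nextEvenSite := by
  constructor
  · rintro (a | a) (b | b) h <;> simp only [Sum.elim_inl, Sum.elim_inr, oddSite,
      Fin.ext_iff, nextEvenSite_val] at h
    · exact congrArg _ (Fin.ext (by omega))
    · split_ifs at h
      omega
    · split_ifs at h
      omega
    · have := a.isLt
      have := b.isLt
      refine congrArg _ (Fin.ext ?_)
      split_ifs at h <;> omega
  · intro s
    have hs := s.isLt
    rcases Nat.even_or_odd' s.val with ⟨c, hc | hc⟩
    · rcases Nat.eq_zero_or_pos c with h0 | h0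
      · refine ⟨Sum.inr ⟨L - 1, by omega⟩, Fin.ext ?_⟩
        rw [Sum.elim_inr, nextEvenSite_val, if_pos (by simp; omega)]
        omega
      · refine ⟨Sum.inr ⟨c - 1, by omega⟩, Fin.ext ?_⟩
        rw [Sum.elim_inr, nextEvenSite_val, if_neg (by simp; omega)]
        simp only
        omega
    · exact ⟨Sum.inl ⟨c, by omega⟩, Fin.ext (by simp [oddSite, hc])⟩

/-- The relabelling of the cells when a new cell is inserted before cell `m`. -/
def insertCell {L : ℕ} (m : ℕ) (k : Fin L) : Fin (L + 1) :=
  ⟨if k.val < m then k.val else k.val + 1, by split_ifs <;> omega⟩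

/-- The relabelling of the sites when a new cell is inserted before cell `m`. -/
def insertSite {L : ℕ} (m : ℕ) (s : Fin (2 * L)) : Fin (2 * (L + 1)) :=
  ⟨if s.val < 2 * m then s.val else s.val + 2, by split_ifs <;> omega⟩

theorem insertCell_injective {L : ℕ} (m : ℕ) : Function.Injective (insertCell (L := L) m) := by
  intro a b h
  simp only [insertCell, Fin.mk.injEq] at h
  exact Fin.ext (by split_ifs at h <;> omega)

theorem insertSite_injective {L : ℕ} (m : ℕ) : Function.Injective (insertSite (L := L) m) := by
  intro a b h
  simp only [insertSite, Fin.mk.injEq] at h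
  exact Fin.ext (by split_ifs at h <;> omega)

theorem insertCell_val {L : ℕ} (m : ℕ) (k : Fin L) :
    ((insertCell m k).val = k.val ∧ k.val < m) ∨ ((insertCell m k).val = k.val + 1 ∧ m ≤ k.val) := by
  simp only [insertCell]
  split_ifs <;> omega

theorem insertSite_val {L : ℕ} (m : ℕ) (s : Fin (2 * L)) :
    ((insertSite m s).val = s.val ∧ s.val < 2 * m) ∨
      ((insertSite m s).val = s.val + 2 ∧ 2 * m ≤ s.val) := by
  simp only [insertSite]
  split_ifs <;> omega

theorem evenSite_val {L : ℕ} (k : Fin L) : (evenSite k).val = 2 * k.val := rfl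

theorem oddSite_val {L : ℕ} (k : Fin L) : (oddSite k).val = 2 * k.val + 1 := rfl

/-- The sites at distance at least `r` from the place of insertion. -/
def farRegion (L m r : ℕ) : Set (Fin (2 * L)) :=
  {s | s.val + r < 2 * m ∨ 2 * m + r ≤ s.val}

theorem farRegion_anti {L m r r' : ℕ} (h : r ≤ r') : farRegion L m r' ⊆ farRegion L m r := by
  rintro s (hs | hs)
  · exact Or.inl (by omega)
  · exact Or.inr (by omega)

theorem noisyGate_mem_unitaryGroup {d : ℕ} {U : Gate d}
    (hU : U ∈ Matrix.unitaryGroup (Fin d × Fin d) ℂ) (u : Fin 4 → UGroup d) :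
    noisyGate U u ∈ Matrix.unitaryGroup (Fin d × Fin d) ℂ :=
  mul_mem (mul_mem (Matrix.kronecker_mem_unitary (u 0).2 (u 1).2) hU)
    (Matrix.kronecker_mem_unitary (u 2).2 (u 3).2)

theorem agreeOn_layer₂ {d L m r : ℕ} (hr : Even r) {ψ' : Config d (L + 1) → ℂ}
    {ψ : Config d L → ℂ} (h : AgreeOn (insertSite m) (farRegion L m r) ψ' ψ)
    {G : Fin L → Gate d} {G' : Fin (L + 1) → Gate d}
    (hG' : ∀ k, G' k ∈ Matrix.unitaryGroup _ ℂ) (hGG' : ∀ k, G' (insertCell m k) = G k) :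
    AgreeOn (insertSite m) (farRegion L m r) ((layer₂ G').mulVec ψ') ((layer₂ G).mulVec ψ) := by
  obtain ⟨c, hc⟩ := hr
  refine h.layer (insertSite_injective m) (isPairing_even_odd L) (isPairing_even_odd (L + 1))
    (insertCell_injective m) ?_ ?_ ?_ hG' hGG'
  · intro k _
    have h1 := insertCell_val m k
    have h2 := insertSite_val m (evenSite k)
    have h3 := evenSite_val k
    have h4 := evenSite_val (insertCell m k)
    exact Fin.ext (by omega)
  · intro k _
    have h1 := insertCell_val m k
    have h2 := insertSite_val m (oddSite k)
    have h3 := oddSite_val k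
    have h4 := oddSite_val (insertCell m k)
    exact Fin.ext (by omega)
  · intro k
    simp only [farRegion, Set.mem_ofPred_eq, evenSite, oddSite]
    omega

/-- Odd distance from the insertion makes the far region a union of gates of this layer, as even
distance does for the other one. The two inequalities put both ends of the wrap-around gate, the
sites `0` and `2 * L - 1`, in the region. -/
theorem agreeOn_layer₁ {d L m r : ℕ} (hr : Odd r) (hm : r < 2 * m) (hmL : 2 * m + r < 2 * L)
    {ψ' : Config d (L + 1) → ℂ}
    {ψ : Config d L → ℂ} (h : AgreeOn (insertSite m) (farRegion L m r) ψ' ψ)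
    {G : Fin L → Gate d} {G' : Fin (L + 1) → Gate d}
    (hG' : ∀ k, G' k ∈ Matrix.unitaryGroup _ ℂ) (hGG' : ∀ k, G' (insertCell m k) = G k) :
    AgreeOn (insertSite m) (farRegion L m r) ((layer₁ G').mulVec ψ') ((layer₁ G).mulVec ψ) := by
  obtain ⟨c, hc⟩ := hr
  refine h.layer (insertSite_injective m) (isPairing_odd_nextEven L)
    (isPairing_odd_nextEven (L + 1)) (insertCell_injective m) ?_ ?_ ?_ hG' hGG'
  · intro k hk
    have h1 := insertCell_val m k
    have h2 := insertSite_val m (oddSite k)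
    have h3 := oddSite_val k
    have h4 := oddSite_val (insertCell m k)
    exact Fin.ext (by omega)
  · intro k hk
    have := k.isLt
    have h1 := insertCell_val m k
    have h2 := insertSite_val m (nextEvenSite k)
    have h3 := nextEvenSite_val k
    have h4 := nextEvenSite_val (insertCell m k)
    simp only [farRegion, Set.mem_ofPred_eq] at hk
    apply Fin.ext
    split_ifs at h3 h4 <;> omega
  · intro k
    have := k.isLt
    simp only [farRegion, Set.mem_ofPred_eq, oddSite, nextEvenSite_val]
    split_ifs <;> omega

/-- The noise labels of a ring as labels of the ring with an inserted cell. -/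
def insertLabel {L : ℕ} (m t : ℕ) (i : NoiseLabel L t) : NoiseLabel (L + 1) t :=
  (i.1, i.2.1, insertCell m i.2.2.1, i.2.2.2)

/-- Light cone: each layer costs one site on either side of the insertion, on top of the two sites
already lost for the initial state. -/
theorem agreeOn_evolve {d L m : ℕ} {U : Gate d}
    (hU : U ∈ Matrix.unitaryGroup (Fin d × Fin d) ℂ) {ψ' : Config d (L + 1) → ℂ}
    {ψ : Config d L → ℂ} (h : AgreeOn (insertSite m) (farRegion L m 2) ψ' ψ) (t : ℕ)
    (hm : t + 1 < m) (hmL : m + t + 1 < L) (u : NoiseLabel (L + 1) t → UGroup d) :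
    AgreeOn (insertSite m) (farRegion L m (2 * t + 2)) (evolve U ψ' t u)
      (evolve U ψ t (u ∘ insertLabel m t)) := by
  induction t with
  | zero => exact h
  | succ t ih =>
    have h1 := ih (by omega) (by omega) fun i => u (i.1.castSucc, i.2)
    have h2 := agreeOn_layer₁ (r := 2 * t + 3) ⟨t + 1, by omega⟩ (by omega) (by omega)
      (h1.mono (farRegion_anti (by omega)))
      (G := fun k => noisyGate U fun j => u (Fin.last t, 0, insertCell m k, j))
      (G' := fun k => noisyGate U fun j => u (Fin.last t, 0, k, j))
      (fun k => noisyGate_mem_unitaryGroup hU _) fun k => rfl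
    have h3 := agreeOn_layer₂ (r := 2 * t + 4) ⟨t + 2, by omega⟩
      (h2.mono (farRegion_anti (by omega)))
      (G := fun k => noisyGate U fun j => u (Fin.last t, 1, insertCell m k, j))
      (G' := fun k => noisyGate U fun j => u (Fin.last t, 1, k, j))
      (fun k => noisyGate_mem_unitaryGroup hU _) fun k => rfl
    simp only [Matrix.mulVec_mulVec] at h3
    exact h3

/-! ### Transfer matrices of matrix product states -/

theorem sum_prod_ofFn {X R : Type*} [Fintype X] [Semiring R] {L : ℕ} (f : Fin L → X → R) :
    ∑ x : Fin L → X, (List.ofFn fun k => f k (x k)).prod =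
      (List.ofFn fun k => ∑ x, f k x).prod := by
  induction L with
  | zero => simp
  | succ L ih =>
    rw [← (Fin.consEquiv fun _ : Fin (L + 1) => X).sum_comp, Fintype.sum_prod_type]
    simp only [List.ofFn_succ, List.prod_cons, Fin.consEquiv_apply, Fin.cons_zero, Fin.cons_succ,
      ← Finset.mul_sum, ih fun k => f k.succ, Finset.sum_mul]

theorem prod_ofFn_smul {R : Type*} [Semiring R] [Algebra ℂ R] {L : ℕ} (c : Fin L → ℂ)
    (f : Fin L → R) :
    (List.ofFn fun k => c k • f k).prod = (∏ k, c k) • (List.ofFn f).prod := by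
  induction L with
  | zero => simp
  | succ L ih =>
    simp only [List.ofFn_succ, List.prod_cons, Fin.prod_univ_succ, ih fun k => c k.succ,
      smul_mul_smul_comm]

theorem prod_ofFn_kronecker {n m : Type*} [Fintype n] [DecidableEq n] [Fintype m] [DecidableEq m]
    {L : ℕ} (f : Fin L → Matrix n n ℂ) (g : Fin L → Matrix m m ℂ) :
    (List.ofFn fun k => f k ⊗ₖ g k).prod = (List.ofFn f).prod ⊗ₖ (List.ofFn g).prod := by
  induction L with
  | zero => simp
  | succ L ih =>
    simp only [List.ofFn_succ, List.prod_cons, ih fun k => f k.succ, Matrix.mul_kronecker_mul]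

theorem star_trace_prod_ofFn {n : Type*} [Fintype n] [DecidableEq n] {L : ℕ}
    (f : Fin L → Matrix n n ℂ) :
    star (List.ofFn f).prod.trace = (List.ofFn fun k => (f k).map star).prod.trace := by
  have h : ((List.ofFn f).prod).map star = (List.ofFn fun k => (f k).map star).prod := by
    have := map_list_prod (starRingEnd ℂ).mapMatrix (List.ofFn f)
    rw [List.map_ofFn] at this
    exact this
  rw [← h]
  simp [Matrix.trace]

/-- The inserted cell and its left neighbour carry the same idempotent `e`, and the adjacent factors
`e * e` collapse to one. -/
theorem prod_ofFn_insertCell {R : Type*} [Monoid R] {L m : ℕ} (hm : 0 < m) (hmL : m ≤ L)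
    (e : R) (he : e * e = e) (f : Fin L → R) (f' : Fin (L + 1) → R)
    (h : ∀ k, f' (insertCell m k) = f k) (hf : f ⟨m - 1, by omega⟩ = e)
    (hf' : f' ⟨m, by omega⟩ = e) : (List.ofFn f').prod = (List.ofFn f).prod := by
  obtain ⟨p, rfl⟩ : ∃ p, m = p + 1 := ⟨m - 1, by omega⟩
  obtain ⟨q, rfl⟩ : ∃ q, L = p + 1 + q := ⟨L - (p + 1), by omega⟩
  let F : ℕ → R := fun k => if hk : k < p + 1 + q then f ⟨k, hk⟩ else 1
  let F' : ℕ → R := fun k => if hk : k < p + 1 + q + 1 then f' ⟨k, hk⟩ else 1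
  have e1 : List.ofFn f = (List.range (p + 1 + q)).map F := by
    refine List.ext_getElem (by simp) fun i h1 h2 => ?_
    have hi : i < p + 1 + q := by simpa using h1
    rw [List.getElem_ofFn, List.getElem_map, List.getElem_range]
    simp only [F, dif_pos hi]
  have e2 : List.ofFn f' = (List.range (p + 1 + 1 + q)).map F' := by
    refine List.ext_getElem (by simp only [List.length_ofFn, List.length_map, List.length_range]; omega)
      fun i h1 h2 => ?_
    have hi : i < p + 1 + q + 1 := by simpa only [List.length_ofFn] using h1
    rw [List.getElem_ofFn, List.getElem_map, List.getElem_range]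
    simp only [F', dif_pos hi]
  have a1 : F p = e := (dif_pos (by omega)).trans hf
  have a2 : F' (p + 1) = e := (dif_pos (by omega)).trans hf'
  have a3 : ∀ i < p + 1, F' i = F i := by
    intro i hi
    have h0 := h ⟨i, by omega⟩
    have e : insertCell (p + 1) (⟨i, by omega⟩ : Fin (p + 1 + q)) = ⟨i, by omega⟩ :=
      Fin.ext (if_pos hi)
    rw [e] at h0
    simp only [F, F']
    rw [dif_pos (by omega), dif_pos (by omega), h0]
  have a4 : ∀ i < q, F' (p + 1 + 1 + i) = F (p + 1 + i) := by
    intro i hi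
    have h0 := h ⟨p + 1 + i, by omega⟩
    have e : insertCell (p + 1) (⟨p + 1 + i, by omega⟩ : Fin (p + 1 + q)) =
        ⟨p + 1 + 1 + i, by omega⟩ :=
      Fin.ext ((if_neg (by simp only; omega)).trans (by simp only; omega))
    rw [e] at h0
    simp only [F, F']
    rw [dif_pos (by omega), dif_pos (by omega), h0]
  have b1 : ((List.range (p + 1)).map F').prod = ((List.range (p + 1)).map F).prod := by
    congr 1
    exact List.map_congr_left fun i hi => a3 i (List.mem_range.mp hi)
  have b2 : (List.map (F' ∘ fun x => p + 1 + 1 + x) (List.range q)).prod =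
      (List.map (F ∘ fun x => p + 1 + x) (List.range q)).prod := by
    congr 1
    exact List.map_congr_left fun i hi => a4 i (List.mem_range.mp hi)
  have c1 : ((List.range (p + 1 + 1)).map F').prod = ((List.range (p + 1)).map F).prod := by
    rw [List.range_succ, List.map_append, List.prod_append, b1, List.range_succ, List.map_append,
      List.prod_append]
    simp only [List.map_cons, List.map_nil, List.prod_singleton, a1, a2]
    rw [mul_assoc, he]
  have r1 : List.range (p + 1 + 1 + q) = List.range (p + 1 + 1) ++
      (List.range q).map (p + 1 + 1 + ·) := List.range_add
  have r2 : List.range (p + 1 + q) = List.range (p + 1) ++ (List.range q).map (p + 1 + ·) :=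
    List.range_add
  rw [e1, e2, r1, r2, List.map_append, List.map_append,
    List.prod_append, List.prod_append, List.map_map, List.map_map, b2, c1]

/-- The transfer matrix of one cell with the product operator `B₁ ⊗ B₂` inserted. -/
def transferMatrix {d χ : ℕ} (Z : MPSTensor d χ) (B₁ B₂ : Matrix (Fin d) (Fin d) ℂ) :
    Matrix (Fin χ × Fin χ) (Fin χ × Fin χ) ℂ :=
  ∑ x : (Fin d × Fin d) × (Fin d × Fin d),
    ((d : ℂ)⁻¹ * (B₁ x.1.1 x.2.1 * B₂ x.1.2 x.2.2)) •
      (Z x.2.1 x.2.2 ⊗ₖ (Z x.1.1 x.1.2).map star)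

/-- The trace from the ket times the conjugate trace from the bra is the trace of a Kronecker
product; the sum over configurations then factorises cell by cell. -/
theorem expectation_mpsState {d χ L : ℕ} (Z : MPSTensor d χ)
    (O : Fin (2 * L) → Matrix (Fin d) (Fin d) ℂ) :
    expectation (mpsState Z L) (siteMat O) =
      (List.ofFn fun k : Fin L => transferMatrix Z (O (evenSite k)) (O (oddSite k))).prod.trace := by
  have hc : ((((Real.sqrt ((d : ℝ) ^ L))⁻¹ : ℝ) : ℂ)) * (((Real.sqrt ((d : ℝ) ^ L))⁻¹ : ℝ) : ℂ) =
      ∏ _k : Fin L, (d : ℂ)⁻¹ := by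
    rw [← Complex.ofReal_mul, ← mul_inv, Real.mul_self_sqrt (by positivity)]
    simp
  simp only [transferMatrix]
  rw [← sum_prod_ofFn, Matrix.trace_sum]
  rw [← (Equiv.arrowProdEquivProdArrow (Fin L) (fun _ => Fin d × Fin d)
    (fun _ => Fin d × Fin d)).symm.sum_comp, Fintype.sum_prod_type,
    ← (pairEquiv (isPairing_even_odd L)).sum_comp]
  simp only [expectation, dotProduct, Matrix.mulVec, Finset.mul_sum]
  refine Finset.sum_congr rfl fun a _ => ?_
  rw [← (pairEquiv (isPairing_even_odd L)).sum_comp]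
  refine Finset.sum_congr rfl fun b _ => ?_
  simp only [Equiv.arrowProdEquivProdArrow, Equiv.coe_fn_symm_mk, pairEquiv_apply]
  rw [prod_ofFn_smul, prod_ofFn_kronecker, Matrix.trace_smul, Matrix.trace_kronecker,
    ← star_trace_prod_ofFn, Finset.prod_mul_distrib, ← hc, siteMat, Matrix.of_apply,
    (isPairing_even_odd L).prod_eq]
  simp only [mpsState, Pi.star_apply, star_mul', smul_eq_mul, Complex.star_def, Complex.conj_ofReal]
  ring

theorem transferMatrix_one {d χ : ℕ} (Z : MPSTensor d χ) :
    transferMatrix Z 1 1 = (1 / (d : ℂ)) • ∑ a, ∑ b, (Z a b) ⊗ₖ ((Z a b).map star) := by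
  rw [transferMatrix, Fintype.sum_prod_type, ← Fintype.sum_prod_type'
    (f := fun a b => Z a b ⊗ₖ (Z a b).map star), Finset.smul_sum]
  refine Finset.sum_congr rfl fun x _ => ?_
  rw [Finset.sum_eq_single x]
  · simp
  · intro y _ hy
    have : ¬ (x.1 = y.1 ∧ x.2 = y.2) := fun h => hy (Prod.ext h.1 h.2).symm
    by_cases h1 : x.1 = y.1
    · simp [Matrix.one_apply, show ¬ x.2 = y.2 from fun h => this ⟨h1, h⟩]
    · simp [Matrix.one_apply, h1]
  · simp

/-- $\langle R|L\rangle=\sum_iw_i=1$ makes $|L\rangle\langle R|$ a rank-one projector. -/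
theorem IsRGFixedPoint.transferMatrix {d χ : ℕ} {Z : MPSTensor d χ} (hZ : IsRGFixedPoint Z) :
    transferMatrix Z 1 1 * transferMatrix Z 1 1 = transferMatrix Z 1 1 ∧
      (DualUnitary.transferMatrix Z 1 1).trace = 1 := by
  obtain ⟨w, -, hw, h⟩ := hZ
  have hs : (fun j : Fin χ × Fin χ => if j.1 = j.2 then ((w j.1 : ℝ) : ℂ) else 0) ⬝ᵥ
      (fun i : Fin χ × Fin χ => if i.1 = i.2 then (1 : ℂ) else 0) = 1 := by
    simp only [dotProduct, Fintype.sum_prod_type]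
    simp [← Complex.ofReal_sum, hw]
  rw [transferMatrix_one, h]
  refine ⟨?_, ?_⟩
  · rw [Matrix.vecMulVec_mul_vecMulVec, hs, one_smul]
  · rw [Matrix.trace_vecMulVec, dotProduct_comm, hs]

/-- Distance two frees the whole cell to the left of the insertion from operators, which supplies
the neighbouring idempotent. -/
theorem agreeOn_mpsState {d χ L m : ℕ} {Z : MPSTensor d χ} (hZ : IsRGFixedPoint Z) (hm : 0 < m)
    (hmL : m ≤ L) :
    AgreeOn (insertSite m) (farRegion L m 2) (mpsState Z (L + 1)) (mpsState Z L) := by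
  intro O hO
  have hfar : ∀ s' : Fin (2 * (L + 1)), 2 * m ≤ s'.val + 2 → s'.val < 2 * m + 2 → O s' = 1 := by
    intro s' h1 h2
    refine hO s' ?_
    rintro ⟨s, hs, rfl⟩
    have := insertSite_val m s
    simp only [farRegion, Set.mem_ofPred_eq] at hs
    omega
  rw [expectation_mpsState, expectation_mpsState]
  congr 1
  have hs1 : ∀ k : Fin L, insertSite m (evenSite k) = evenSite (insertCell m k) := by
    intro k
    have h1 := insertCell_val m k
    have h2 := insertSite_val m (evenSite k)
    have h3 := evenSite_val k
    have h4 := evenSite_val (insertCell m k)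
    exact Fin.ext (by omega)
  have hs2 : ∀ k : Fin L, insertSite m (oddSite k) = oddSite (insertCell m k) := by
    intro k
    have h1 := insertCell_val m k
    have h2 := insertSite_val m (oddSite k)
    have h3 := oddSite_val k
    have h4 := oddSite_val (insertCell m k)
    exact Fin.ext (by omega)
  refine prod_ofFn_insertCell hm hmL _ hZ.transferMatrix.1 _ _ (fun k => ?_) ?_ ?_
  · simp only [Function.comp_apply, hs1, hs2]
  · simp only [Function.comp_apply, hs1, hs2]
    have h1 := insertCell_val m (⟨m - 1, by omega⟩ : Fin L)
    simp only at h1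
    rw [hfar _ (by rw [evenSite_val]; omega) (by rw [evenSite_val]; omega),
      hfar _ (by rw [oddSite_val]; omega) (by rw [oddSite_val]; omega)]
  · rw [hfar _ (by rw [evenSite_val]; simp only; omega) (by rw [evenSite_val]; simp only; omega),
      hfar _ (by rw [oddSite_val]; simp only; omega) (by rw [oddSite_val]; simp only; omega)]

/-! ### Entropies of states that agree on a region -/

/-- Entries of the reduced density matrix are expectations of product operators, namely transposed
matrix units on `A`. So states that agree on a region have the same entropy there. -/
theorem reducedDensity_eq_expectation {d L : ℕ} (A : Finset (Fin (2 * L))) (ψ : Config d L → ℂ)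
    (a a' : {s // s ∈ A} → Fin d) :
    reducedDensity A ψ a a' =
      expectation ψ (siteMat fun s =>
        if h : s ∈ A then Matrix.single (a' ⟨s, h⟩) (a ⟨s, h⟩) 1 else 1) := by
  set O : Fin (2 * L) → Matrix (Fin d) (Fin d) ℂ := fun s =>
    if h : s ∈ A then Matrix.single (a' ⟨s, h⟩) (a ⟨s, h⟩) 1 else 1 with hO
  have hO1 : ∀ s : {s // s ∈ A}, O s = Matrix.single (a' s) (a s) 1 := fun s => dif_pos s.2
  have hO2 : ∀ s : {s // s ∉ A}, O s = 1 := fun s => dif_neg s.2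
  have key : ∀ x x' : {s // s ∈ A} → Fin d, ∀ y y' : {s // s ∉ A} → Fin d,
      (siteMat O) (glue A x y) (glue A x' y') =
      if x = a' ∧ x' = a ∧ y = y' then 1 else 0 := by
    intro x x' y y'
    have h1 : ∏ s : {s // s ∈ A}, O s (glue A x y s) (glue A x' y' s) =
        if x = a' ∧ x' = a then 1 else 0 := by
      have : ∀ s : {s // s ∈ A}, O s (glue A x y s) (glue A x' y' s) =
          if x s = a' s ∧ x' s = a s then 1 else 0 := by
        intro s
        rw [hO1]
        simp only [s.2, dif_pos, glue, Matrix.single_apply]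
        exact if_congr (and_congr eq_comm eq_comm) rfl rfl
      simp only [this, Fintype.prod_boole, funext_iff, forall_and]
    have h2 : ∏ s : {s // s ∉ A}, O s (glue A x y s) (glue A x' y' s) =
        if y = y' then 1 else 0 := by
      have : ∀ s : {s // s ∉ A}, O s (glue A x y s) (glue A x' y' s) =
          if y s = y' s then 1 else 0 := by
        intro s
        rw [hO2]
        simp only [s.2, not_false_eq_true, dif_neg, glue, Matrix.one_apply]
      simp only [this, Fintype.prod_boole, funext_iff]
    have h3 := Fintype.prod_subtype_mul_prod_subtype (fun s => s ∈ A)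
      fun s => O s (glue A x y s) (glue A x' y' s)
    rw [siteMat, Matrix.of_apply, ← h3, h2,
      show (Subtype.fintype fun s => s ∈ A) = Finset.Subtype.fintype A from Subsingleton.elim _ _,
      h1]
    simp only [ite_mul, one_mul, zero_mul, ← ite_and, and_assoc]
  simp only [expectation, dotProduct, Matrix.mulVec, Pi.star_apply]
  rw [sum_config_eq A]
  simp only [sum_config_eq A, key]
  rw [Finset.sum_eq_single a' (fun x _ hx => by simp [hx]) (by simp)]
  simp only [true_and, ite_and]
  rw [reducedDensity, Matrix.of_apply]
  refine Finset.sum_congr rfl fun y _ => ?_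
  rw [Finset.sum_eq_single a (fun x _ hx => by simp [hx]) (by simp)]
  simp [mul_comm]

theorem AgreeOn.entanglementEntropy_eq {d L L' : ℕ} {ι : Fin (2 * L) → Fin (2 * L')}
    (hι : Function.Injective ι) {D : Set (Fin (2 * L))} {ψ' : Config d L' → ℂ}
    {ψ : Config d L → ℂ} (h : AgreeOn ι D ψ' ψ) (A : Finset (Fin (2 * L)))
    (A' : Finset (Fin (2 * L'))) (hA : ∀ s ∈ A, s ∈ D) (hA' : ∀ s', s' ∈ A' ↔ ∃ s ∈ A, ι s = s') :
    entanglementEntropy A' ψ' = entanglementEntropy A ψ := by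
  have hmem : ∀ s, ι s ∈ A' ↔ s ∈ A := fun s =>
    ⟨fun hs => by
      obtain ⟨t, ht, he⟩ := (hA' _).mp hs
      exact hι he ▸ ht, fun hs => (hA' _).mpr ⟨s, hs, rfl⟩⟩
  let e₀ : {s // s ∈ A} ≃ {s' // s' ∈ A'} :=
    Equiv.ofBijective (fun s => ⟨ι s, (hmem s).mpr s.2⟩)
      ⟨fun s t hst => Subtype.ext (hι (congrArg Subtype.val hst)), fun s' => by
        obtain ⟨s, hs, he⟩ := (hA' _).mp s'.2
        exact ⟨⟨s, hs⟩, Subtype.ext he⟩⟩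
  let e : ({s' // s' ∈ A'} → Fin d) ≃ ({s // s ∈ A} → Fin d) :=
    (e₀.arrowCongr (Equiv.refl (Fin d))).symm
  have he : ∀ a s, e a s = a (e₀ s) := fun a s => rfl
  have hρ : reducedDensity A' ψ' = (reducedDensity A ψ).submatrix e e := by
    ext a a'
    rw [Matrix.submatrix_apply, reducedDensity_eq_expectation, reducedDensity_eq_expectation,
      h _ fun s' hs' => ?_]
    · congr 2
      funext s
      by_cases hs : s ∈ A
      · simp only [Function.comp_apply, hs, (hmem s).mpr hs, dif_pos, he]
        rfl
      · simp only [Function.comp_apply, hs, (hmem s).not.mpr hs, dif_neg, not_false_eq_true]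
    · rw [dif_neg]
      intro hc
      obtain ⟨s, hs, rfl⟩ := (hA' _).mp hc
      exact hs' ⟨s, hA s hs, rfl⟩
  refine sum_negMulLog_eq_of_trace_pow _ _ fun k => ?_
  rw [hρ, trace_submatrix_equiv_pow]

/-! ### Stability of the averaged entropy -/

/-- Forgetting independent coordinates: the noise on the original cells, seen inside the larger
ring, still has its own law. -/
theorem measurePreserving_comp_injective {ι κ X : Type*} [Fintype ι] [Fintype κ]
    [MeasurableSpace X] (μ : Measure X) [IsProbabilityMeasure μ] {e : κ → ι}
    (he : Function.Injective e) :
    MeasurePreserving (fun u : ι → X => u ∘ e) (Measure.pi fun _ => μ) (Measure.pi fun _ => μ) := by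
  have hmeas : Measurable (fun u : ι → X => u ∘ e) :=
    measurable_pi_lambda _ fun k => measurable_pi_apply (e k)
  refine ⟨hmeas, ?_⟩
  have h1 : ProbabilityTheory.iIndepFun (fun (i : ι) (u : ι → X) => u i)
      (Measure.pi fun _ => μ) :=
    ProbabilityTheory.iIndepFun_pi (X := fun _ => id) fun _ => aemeasurable_id
  have h2 := h1.precomp he
  rw [ProbabilityTheory.iIndepFun_iff_map_fun_eq_pi_map
    fun k => (measurable_pi_apply (e k)).aemeasurable] at h2
  refine h2.trans ?_
  congr 1
  funext k
  exact (measurePreserving_eval (fun _ : ι => μ) (e k)).map_eq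

theorem insertLabel_injective {L : ℕ} (m t : ℕ) :
    Function.Injective (insertLabel (L := L) m t) := by
  rintro ⟨a, b, c, e⟩ ⟨a', b', c', e'⟩ h
  simp only [insertLabel, Prod.mk.injEq] at h
  obtain ⟨h1, h2, h3, h4⟩ := h
  rw [h1, h2, insertCell_injective m h3, h4]

instance (d : ℕ) : SecondCountableTopology (UGroup d) :=
  haveI : SecondCountableTopology (Matrix (Fin d) (Fin d) ℂ) :=
    inferInstanceAs (SecondCountableTopology (Fin d → Fin d → ℂ))
  TopologicalSpace.Subtype.secondCountableTopology _

theorem continuous_noisyGate {d : ℕ} (U : Gate d) :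
    Continuous fun u : Fin 4 → UGroup d => noisyGate U u := by
  have h : ∀ i : Fin 4, Continuous fun u : Fin 4 → UGroup d =>
      (u i : Matrix (Fin d) (Fin d) ℂ) := fun i =>
    continuous_subtype_val.comp (continuous_apply i)
  have hk : ∀ i j : Fin 4, Continuous fun u : Fin 4 → UGroup d =>
      (u i : Matrix (Fin d) (Fin d) ℂ) ⊗ₖ (u j : Matrix (Fin d) (Fin d) ℂ) := fun i j =>
    continuous_matrix fun a b => ((h i).matrix_elem _ _).mul ((h j).matrix_elem _ _)
  exact ((hk 0 1).matrix_mul continuous_const).matrix_mul (hk 2 3)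

theorem continuous_pairMat {X K S : Type*} [TopologicalSpace X] [Fintype K] {d : ℕ} (l r : K → S)
    {G : X → K → Gate d} (h : ∀ k, Continuous fun x => G x k) :
    Continuous fun x => pairMat l r (G x) := by
  refine continuous_matrix fun a b => ?_
  exact continuous_finsetProd _ fun k _ => (h k).matrix_elem _ _

theorem continuous_layerOp {d L : ℕ} (U : Gate d) (l r : Fin L → Fin (2 * L)) :
    Continuous fun w : Fin L × Fin 4 → UGroup d =>
      pairMat l r fun k => noisyGate U fun j => w (k, j) := by
  have h : ∀ k, Continuous fun (w : Fin L × Fin 4 → UGroup d) (j : Fin 4) => w (k, j) :=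
    fun k => continuous_pi fun j => continuous_apply (k, j)
  apply continuous_pairMat
  intro k
  have h' := (continuous_noisyGate U).comp (h k)
  exact h'

theorem continuous_evolve {d L : ℕ} (U : Gate d) (ψ₀ : Config d L → ℂ) (t : ℕ) :
    Continuous fun u : NoiseLabel L t → UGroup d => evolve U ψ₀ t u := by
  induction t with
  | zero => exact continuous_const
  | succ t ih =>
    have h1 : Continuous fun u : NoiseLabel L (t + 1) → UGroup d =>
        evolve U ψ₀ t fun i => u (i.1.castSucc, i.2) :=
      ih.comp (continuous_pi fun i => continuous_apply _)
    have h3 : ∀ (h : Fin 2) (l r : Fin L → Fin (2 * L)),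
        Continuous fun u : NoiseLabel L (t + 1) → UGroup d =>
          pairMat l r fun k => noisyGate U fun j => u (Fin.last t, h, k, j) := by
      intro h l r
      have hf : Continuous fun (u : NoiseLabel L (t + 1) → UGroup d) (i : Fin L × Fin 4) =>
          u (Fin.last t, h, i) := continuous_pi fun i => continuous_apply _
      have h' := (continuous_layerOp U l r).comp hf
      exact h'
    have h4 := ((h3 1 evenSite oddSite).matrix_mul (h3 0 oddSite nextEvenSite)).matrix_mulVec h1
    exact h4

theorem continuous_entropyAt {d χ : ℕ} (U : Gate d) (Z : MPSTensor d χ) (x₁ L LA t : ℕ) :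
    Continuous (entropyAt U Z x₁ L LA t) :=
  continuous_entanglementEntropy _ _ (continuous_evolve U _ t)

instance (d L t : ℕ) : IsProbabilityMeasure (noiseMeasure d L t) :=
  inferInstanceAs (IsProbabilityMeasure (Measure.pi fun _ => haarU d))

theorem integrable_of_continuous {X E : Type*} [TopologicalSpace X] [CompactSpace X]
    [MeasurableSpace X] [OpensMeasurableSpace X] [NormedAddCommGroup E]
    [SecondCountableTopologyEither X E] (μ : Measure X) [IsFiniteMeasure μ] {f : X → E}
    (hf : Continuous f) : Integrable f μ := by
  obtain ⟨C, hC⟩ := (isCompact_range hf.norm).bddAbove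
  exact Integrable.of_bound hf.aestronglyMeasurable C
    (Eventually.of_forall fun x => hC ⟨x, rfl⟩)

theorem integrable_entropyAt {d χ : ℕ} (U : Gate d) (Z : MPSTensor d χ) (x₁ L LA t : ℕ) :
    Integrable (entropyAt U Z x₁ L LA t) (noiseMeasure d L t) :=
  integrable_of_continuous _ (continuous_entropyAt U Z x₁ L LA t)

theorem mem_block {L x₁ LA : ℕ} {s : Fin (2 * L)} :
    s ∈ block L x₁ LA ↔ x₁ ≤ s.val ∧ s.val < x₁ + 2 * LA := by
  simp [block]

/-- Couples the two rings by using the same noise on the old cells, so equality of averages follows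
from equality for each realisation. -/
theorem averagedEntropy_insertCell {d χ : ℕ} {U : Gate d}
    (hU : U ∈ Matrix.unitaryGroup (Fin d × Fin d) ℂ) {Z : MPSTensor d χ} (hZ : IsRGFixedPoint Z)
    {x₁ L LA LA' t m : ℕ} (hm : t + 1 < m) (hmL : m + t + 1 < L)
    (h : ∀ u : NoiseLabel (L + 1) t → UGroup d,
      AgreeOn (insertSite m) (farRegion L m (2 * t + 2)) (evolve U (mpsState Z (L + 1)) t u)
        (evolve U (mpsState Z L) t (u ∘ insertLabel m t)) →
      entropyAt U Z x₁ (L + 1) LA' t u = entropyAt U Z x₁ L LA t (u ∘ insertLabel m t)) :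
    averagedEntropy U Z x₁ (L + 1) LA' t = averagedEntropy U Z x₁ L LA t := by
  have hmp := measurePreserving_comp_injective (haarU d) (insertLabel_injective (L := L) m t)
  unfold averagedEntropy noiseMeasure
  rw [← hmp.map_eq, integral_map hmp.measurable.aemeasurable
    (continuous_entropyAt U Z x₁ L LA t).aestronglyMeasurable]
  refine integral_congr_ae (Eventually.of_forall fun u => h u ?_)
  exact agreeOn_evolve hU (agreeOn_mpsState hZ (by omega) (by omega)) t hm hmL u

/-- The new cell is placed to the right of the block, beyond the reach of the light cone. -/
theorem averagedEntropy_succ_length {d χ : ℕ} {U : Gate d}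
    (hU : U ∈ Matrix.unitaryGroup (Fin d × Fin d) ℂ) {Z : MPSTensor d χ} (hZ : IsRGFixedPoint Z)
    {x₁ L LA t : ℕ} (hL : x₁ + LA + 2 * t + 4 ≤ L) :
    averagedEntropy U Z x₁ (L + 1) LA t = averagedEntropy U Z x₁ L LA t := by
  refine averagedEntropy_insertCell hU hZ (m := x₁ + LA + t + 2) (by omega) (by omega)
    fun u hu => ?_
  refine hu.entanglementEntropy_eq (insertSite_injective _) _ _ (fun s hs => ?_) fun s' => ?_
  · rw [mem_block] at hs
    exact Or.inl (by omega)
  · rw [mem_block]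
    constructor
    · intro hs
      refine ⟨⟨s'.val, by omega⟩, mem_block.mpr hs, Fin.ext ?_⟩
      have := insertSite_val (x₁ + LA + t + 2) (⟨s'.val, by omega⟩ : Fin (2 * L))
      simp only at this
      omega
    · rintro ⟨s, hs, rfl⟩
      rw [mem_block] at hs
      have := insertSite_val (x₁ + LA + t + 2) s
      omega

/-- The new cell is placed inside the block, far from both of its ends. The complement does not
notice it, and purity of the global state transfers the equality of entropies to the block. -/
theorem averagedEntropy_succ_block {d χ : ℕ} {U : Gate d}
    (hU : U ∈ Matrix.unitaryGroup (Fin d × Fin d) ℂ) {Z : MPSTensor d χ} (hZ : IsRGFixedPoint Z)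
    {x₁ L LA t : ℕ} (hLA : x₁ + 2 * t + 3 ≤ LA) (hL : x₁ + LA + 1 ≤ L) :
    averagedEntropy U Z x₁ (L + 1) (LA + 1) t = averagedEntropy U Z x₁ L LA t := by
  refine averagedEntropy_insertCell hU hZ (m := x₁ + t + 2) (by omega) (by omega)
    fun u hu => ?_
  unfold entropyAt
  rw [← entanglementEntropy_compl, ← entanglementEntropy_compl (block L x₁ LA)]
  refine hu.entanglementEntropy_eq (insertSite_injective _) _ _ (fun s hs => ?_) fun s' => ?_
  · rw [Finset.mem_compl, mem_block] at hs
    by_cases h : s.val < x₁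
    · exact Or.inl (by omega)
    · exact Or.inr (by omega)
  · rw [Finset.mem_compl, mem_block]
    constructor
    · intro hs
      have hs' := s'.isLt
      by_cases h : s'.val < x₁
      · refine ⟨⟨s'.val, by omega⟩, ?_, Fin.ext ?_⟩
        · rw [Finset.mem_compl, mem_block]
          simp only
          omega
        · have := insertSite_val (x₁ + t + 2) (⟨s'.val, by omega⟩ : Fin (2 * L))
          simp only at this
          omega
      · refine ⟨⟨s'.val - 2, by omega⟩, ?_, Fin.ext ?_⟩
        · rw [Finset.mem_compl, mem_block]
          simp only
          omega
        · have := insertSite_val (x₁ + t + 2) (⟨s'.val - 2, by omega⟩ : Fin (2 * L))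
          simp only at this
          omega
    · rintro ⟨s, hs, rfl⟩
      rw [Finset.mem_compl, mem_block] at hs
      have := insertSite_val (x₁ + t + 2) s
      omega

/-- The averaged entropy does not depend on the sizes of the ring and of the block,
once they are large. -/
theorem exists_averagedEntropy_limit {d χ : ℕ} {U : Gate d}
    (hU : U ∈ Matrix.unitaryGroup (Fin d × Fin d) ℂ) {Z : MPSTensor d χ} (hZ : IsRGFixedPoint Z)
    (x₁ : ℕ) : ∃ (F : ℕ → ℕ → ℝ) (F₀ : ℕ → ℝ),
      (∀ t LA L, x₁ + LA + 2 * t + 4 ≤ L → averagedEntropy U Z x₁ L LA t = F t LA) ∧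
      (∀ t LA, x₁ + 2 * t + 3 ≤ LA → F t LA = F₀ t) := by
  have h1 : ∀ t LA L, x₁ + LA + 2 * t + 4 ≤ L → averagedEntropy U Z x₁ L LA t =
      averagedEntropy U Z x₁ (x₁ + LA + 2 * t + 4) LA t := by
    intro t LA L hL
    induction L, hL using Nat.le_induction with
    | base => rfl
    | succ L hL ih => rw [averagedEntropy_succ_length hU hZ hL, ih]
  refine ⟨fun t LA => averagedEntropy U Z x₁ (x₁ + LA + 2 * t + 4) LA t,
    fun t => averagedEntropy U Z x₁ (x₁ + (x₁ + 2 * t + 3) + 2 * t + 4) (x₁ + 2 * t + 3) t,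
    h1, fun t LA hLA => ?_⟩
  induction LA, hLA using Nat.le_induction with
  | base => rfl
  | succ LA hLA ih =>
    refine Eq.trans ?_ ih
    have := averagedEntropy_succ_block hU hZ (L := x₁ + LA + 2 * t + 4) hLA (by omega)
    refine Eq.trans ?_ this
    exact congrArg (fun L => averagedEntropy U Z x₁ L (LA + 1) t) (by omega)

/-! ### Normalisation of the initial and of the evolved state. -/

theorem sum_mpsState_mul_star {d χ L : ℕ} {Z : MPSTensor d χ} (hZ : IsRGFixedPoint Z)
    (hL : 0 < L) : ∑ c, mpsState Z L c * star (mpsState Z L c) = 1 := by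
  have h1 := expectation_mpsState Z (fun _ : Fin (2 * L) => (1 : Matrix (Fin d) (Fin d) ℂ))
  have h2 : siteMat (fun _ : Fin (2 * L) => (1 : Matrix (Fin d) (Fin d) ℂ)) = 1 := by
    ext a b
    simp [siteMat, Matrix.one_apply, Fintype.prod_boole, funext_iff]
  have h3 : ∀ n : ℕ, 0 < n → transferMatrix Z 1 1 ^ n = transferMatrix Z 1 1 := by
    intro n hn
    induction n, hn using Nat.le_induction with
    | base => simp
    | succ n hn ih => rw [pow_succ, ih, hZ.transferMatrix.1]
  rw [h2, List.ofFn_const, List.prod_replicate, h3 L hL, hZ.transferMatrix.2] at h1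
  rw [← h1]
  simp [expectation, dotProduct, mul_comm]

theorem expectation_one {I : Type*} [Fintype I] [DecidableEq I] (ψ : I → ℂ) :
    expectation ψ 1 = ∑ c, ψ c * star (ψ c) := by
  simp [expectation, dotProduct, mul_comm]

theorem sum_pairMat_mulVec_mul_star {K S : Type*} [Fintype K] [DecidableEq K] [Fintype S]
    [DecidableEq S] {d : ℕ} {l r : K → S} (h : IsPairing l r) {G : K → Gate d}
    (hG : ∀ k, G k ∈ Matrix.unitaryGroup (Fin d × Fin d) ℂ) (ψ : (S → Fin d) → ℂ) :
    ∑ c, (pairMat l r G).mulVec ψ c * star ((pairMat l r G).mulVec ψ c) =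
      ∑ c, ψ c * star (ψ c) := by
  have h1 := expectation_pairMat_mulVec h ψ G fun _ => 1
  have h2 : (fun k => (G k).conjTranspose * 1 * G k) = fun _ => 1 := by
    funext k
    rw [mul_one]
    exact Matrix.mem_unitaryGroup_iff'.mp (hG k)
  rw [h2, pairMat_one h, expectation_one, expectation_one] at h1
  exact h1

theorem sum_evolve_mul_star {d L : ℕ} {U : Gate d}
    (hU : U ∈ Matrix.unitaryGroup (Fin d × Fin d) ℂ) (ψ₀ : Config d L → ℂ) (t : ℕ)
    (u : NoiseLabel L t → UGroup d) :
    ∑ c, evolve U ψ₀ t u c * star (evolve U ψ₀ t u c) = ∑ c, ψ₀ c * star (ψ₀ c) := by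
  induction t with
  | zero => rfl
  | succ t ih =>
    rw [evolve, stepOp, ← Matrix.mulVec_mulVec]
    exact (sum_pairMat_mulVec_mul_star (isPairing_even_odd L)
      (fun k => noisyGate_mem_unitaryGroup hU _) _).trans
      ((sum_pairMat_mulVec_mul_star (isPairing_odd_nextEven L)
        (fun k => noisyGate_mem_unitaryGroup hU _) _).trans (ih _))

/-! ### Second moments of the Haar measure -/

/-- The two pairings of four replicas `(x, y, z, w)` (the second and the fourth conjugated):
`false` pairs `x` with `y` and `z` with `w`, `true` pairs `x` with `w` and `z` with `y`. -/
def pairing {X : Type*} [DecidableEq X] (σ : Bool) (x y z w : X) : ℂ :=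
  if σ then (if x = w then 1 else 0) * (if z = y then 1 else 0)
  else (if x = y then 1 else 0) * (if z = w then 1 else 0)

/-- Invariance of a four-index tensor under `g ⊗ g^* ⊗ g ⊗ g^*` for all unitary `g`. -/
def TwirlInvariant {d : ℕ} (M : Fin d → Fin d → Fin d → Fin d → ℂ) : Prop :=
  ∀ g ∈ Matrix.unitaryGroup (Fin d) ℂ, ∀ x y z w, M x y z w =
    ∑ x', ∑ y', ∑ z', ∑ w', g x x' * star (g y y') * (g z z' * star (g w w')) * M x' y' z' w'

section Twirl

variable {d : ℕ} {M : Fin d → Fin d → Fin d → Fin d → ℂ}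

/-- Test the invariance with a diagonal unitary whose only nontrivial phase is $i$, at index `s`.
Unless the indices match in pairs, some `s` multiplies the entry by a scalar other than one. -/
theorem TwirlInvariant.phase (hM : TwirlInvariant M) {x y z w : Fin d}
    (h : ¬ ((x = y ∧ z = w) ∨ (x = w ∧ z = y))) : M x y z w = 0 := by
  have key : ∀ s : Fin d, ∀ c : ℂ,
      (if x = s then Complex.I else 1) * star (if y = s then Complex.I else 1) *
        ((if z = s then Complex.I else 1) * star (if w = s then Complex.I else 1)) = c →
      c ≠ 1 → M x y z w = 0 := by
    intro s c hc hc1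
    let θ : Fin d → ℂ := fun i => if i = s then Complex.I else 1
    have hg : Matrix.diagonal θ ∈ Matrix.unitaryGroup (Fin d) ℂ := by
      rw [Matrix.mem_unitaryGroup_iff', Matrix.star_eq_conjTranspose,
        Matrix.diagonal_conjTranspose, Matrix.diagonal_mul_diagonal, ← Matrix.diagonal_one]
      congr 1
      funext i
      simp only [θ, Pi.star_apply]
      split_ifs <;> simp
    have h1 := hM _ hg x y z w
    rw [Finset.sum_eq_single x (fun i _ hi => by simp [Matrix.diagonal_apply_ne _ hi.symm])
        (by simp),
      Finset.sum_eq_single y (fun i _ hi => by simp [Matrix.diagonal_apply_ne _ hi.symm])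
        (by simp),
      Finset.sum_eq_single z (fun i _ hi => by simp [Matrix.diagonal_apply_ne _ hi.symm])
        (by simp),
      Finset.sum_eq_single w (fun i _ hi => by simp [Matrix.diagonal_apply_ne _ hi.symm])
        (by simp)] at h1
    simp only [Matrix.diagonal_apply_eq, θ] at h1
    rw [hc] at h1
    have h2 : (c - 1) * M x y z w = 0 := by linear_combination -h1
    exact (mul_eq_zero.mp h2).resolve_left (sub_ne_zero.mpr hc1)
  have hI : Complex.I ≠ 1 := fun h => by simpa using congrArg Complex.im h
  by_cases h1 : x = y
  · subst h1
    have hzw : z ≠ w := fun hzw => h (Or.inl ⟨rfl, hzw⟩)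
    refine key z Complex.I ?_ hI
    rw [if_pos rfl, if_neg hzw.symm]
    split_ifs <;> simp
  · by_cases h2 : x = w
    · subst h2
      have hzy : z ≠ y := fun hzy => h (Or.inr ⟨rfl, hzy⟩)
      refine key z Complex.I ?_ hI
      rw [if_pos rfl, if_neg hzy.symm]
      split_ifs <;> simp
    · by_cases h3 : z = x
      · refine key x (-1) ?_ (by norm_num)
        rw [if_pos rfl, if_neg (Ne.symm h1), if_neg (Ne.symm h2), if_pos h3]
        simp
      · refine key x Complex.I ?_ hI
        rw [if_pos rfl, if_neg (Ne.symm h1), if_neg (Ne.symm h2), if_neg h3]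
        simp

theorem TwirlInvariant.perm (hM : TwirlInvariant M) (π : Equiv.Perm (Fin d)) (x y z w : Fin d) :
    M x y z w = M (π x) (π y) (π z) (π w) := by
  let g : Matrix (Fin d) (Fin d) ℂ := Matrix.of fun i j => if j = π i then 1 else 0
  have hg : g ∈ Matrix.unitaryGroup (Fin d) ℂ := by
    rw [Matrix.mem_unitaryGroup_iff]
    ext i j
    simp [g, Matrix.mul_apply, Matrix.one_apply, Matrix.star_apply, apply_ite, eq_comm (a := j)]
  have h1 := hM g hg x y z w
  simpa [g, apply_ite, Finset.sum_ite_eq', ite_mul, mul_ite] using h1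

theorem exists_perm_of_ne {x z x₀ x₁ : Fin d} (h : x ≠ z) (h₀ : x₀ ≠ x₁) :
    ∃ π : Equiv.Perm (Fin d), π x = x₀ ∧ π z = x₁ := by
  have hne : x₀ ≠ Equiv.swap x x₀ z := by
    intro he
    have : Equiv.swap x x₀ x = Equiv.swap x x₀ z := by rw [Equiv.swap_apply_left, ← he]
    exact h ((Equiv.swap x x₀).injective this)
  refine ⟨(Equiv.swap x x₀).trans (Equiv.swap (Equiv.swap x x₀ z) x₁), ?_, ?_⟩
  · rw [Equiv.trans_apply, Equiv.swap_apply_left, Equiv.swap_apply_of_ne_of_ne hne h₀]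
  · rw [Equiv.trans_apply, Equiv.swap_apply_left]

/-- Monomial unitaries cannot separate the fully diagonal invariant from the two pairings; a unitary
with two nonzero entries in a row does. The witness is the Householder reflection along $(3/5,4/5)$,
with row $(7/25,-24/25)$. -/
theorem exists_unitary_row {x₀ x₁ : Fin d} (h : x₀ ≠ x₁) :
    ∃ g ∈ Matrix.unitaryGroup (Fin d) ℂ,
      ∑ x, (g x₀ x * star (g x₀ x)) * (g x₀ x * star (g x₀ x)) ≠ 1 := by
  let v : Fin d → ℂ := Pi.single x₀ (3 / 5) + Pi.single x₁ (4 / 5)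
  have hv0 : v x₀ = 3 / 5 := by simp [v, h]
  have hv1 : v x₁ = 4 / 5 := by simp [v, h.symm]
  have hv2 : ∀ x, x ≠ x₀ → x ≠ x₁ → v x = 0 := fun x h0 h1 => by simp [v, h0, h1]
  have hstar : star v = v := by
    funext x
    by_cases h0 : x = x₀
    · subst h0; simp [hv0]
    · by_cases h1 : x = x₁
      · subst h1; simp [hv1]
      · simp [hv2 x h0 h1]
  have hvv : v ⬝ᵥ v = 1 := by
    simp only [v, dotProduct_add, dotProduct_single, Pi.add_apply, Pi.single_eq_same,
      Pi.single_eq_of_ne h, Pi.single_eq_of_ne h.symm]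
    norm_num
  have hP : Matrix.vecMulVec v v * Matrix.vecMulVec v v = Matrix.vecMulVec v v := by
    rw [Matrix.vecMulVec_mul_vecMulVec, hvv, one_smul]
  have hPs : star (Matrix.vecMulVec v v) = Matrix.vecMulVec v v := by
    rw [Matrix.star_eq_conjTranspose, Matrix.conjTranspose_vecMulVec, hstar]
  refine ⟨1 - (2 : ℂ) • Matrix.vecMulVec v v, ?_, ?_⟩
  · rw [Matrix.mem_unitaryGroup_iff, star_sub, star_one, star_smul, hPs]
    have h2 : star (2 : ℂ) = 2 := by simp
    rw [h2, sub_mul, mul_sub, mul_sub, smul_mul_smul_comm, hP, one_mul, one_mul, mul_one]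
    module
  · have hg : ∀ x, (1 - (2 : ℂ) • Matrix.vecMulVec v v) x₀ x =
        (if x = x₀ then 1 else 0) - 6 / 5 * v x := by
      intro x
      simp only [Matrix.sub_apply, Matrix.one_apply, Matrix.smul_apply, Matrix.vecMulVec_apply,
        hv0, smul_eq_mul, eq_comm (a := x₀)]
      ring
    have hsum : ∀ f : Fin d → ℂ, (∀ x, x ≠ x₀ → x ≠ x₁ → f x = 0) → ∑ x, f x = f x₀ + f x₁ := by
      intro f hf
      exact Fintype.sum_eq_add x₀ x₁ h fun x hx => hf x hx.1 hx.2
    rw [hsum]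
    · rw [hg, hg, if_pos rfl, if_neg h.symm, hv0, hv1]
      norm_num
    · intro x h0 h1
      rw [hg, if_neg h0, hv2 x h0 h1]
      simp

/-- Invariant tensors are combinations of the two pairings. -/
theorem TwirlInvariant.eq_pairing (hd : 2 ≤ d) (hM : TwirlInvariant M) :
    ∃ A B : ℂ, ∀ x y z w, M x y z w = A * pairing false x y z w + B * pairing true x y z w := by
  obtain ⟨x₀, x₁, h01⟩ : ∃ x₀ x₁ : Fin d, x₀ ≠ x₁ :=
    ⟨⟨0, by omega⟩, ⟨1, by omega⟩, by simp [Fin.ext_iff]⟩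
  set c := M x₀ x₀ x₀ x₀ - M x₀ x₀ x₁ x₁ - M x₀ x₁ x₁ x₀ with hc
  -- Phases and permutations alone leave a third invariant, supported where all four indices
  -- coincide, with coefficient `c`.
  have hform : ∀ x y z w, M x y z w = M x₀ x₀ x₁ x₁ * pairing false x y z w +
      M x₀ x₁ x₁ x₀ * pairing true x y z w +
      c * (if x = y ∧ x = z ∧ x = w then 1 else 0) := by
    intro x y z w
    by_cases h : (x = y ∧ z = w) ∨ (x = w ∧ z = y)
    · by_cases hxz : x = z
      · have hall : x = y ∧ x = w := by
          rcases h with ⟨h1, h2⟩ | ⟨h1, h2⟩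
          · exact ⟨h1, hxz.trans h2⟩
          · exact ⟨hxz.trans h2, h1⟩
        obtain ⟨rfl, rfl⟩ := hall
        subst hxz
        rw [hM.perm (Equiv.swap x x₀), Equiv.swap_apply_left]
        simp [pairing, hc]
      · obtain ⟨π, hπx, hπz⟩ := exists_perm_of_ne hxz h01
        rcases h with ⟨rfl, rfl⟩ | ⟨rfl, rfl⟩
        · rw [hM.perm π, hπx, hπz]
          simp [pairing, hxz]
        · rw [hM.perm π, hπx, hπz]
          simp [pairing, hxz]
    · rw [hM.phase h]
      have h1 : ¬ (x = y ∧ z = w) := fun h' => h (Or.inl h')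
      have h2 : ¬ (x = w ∧ z = y) := fun h' => h (Or.inr h')
      have h3 : ¬ (x = y ∧ x = z ∧ x = w) := fun ⟨a, b, e⟩ => h1 ⟨a, b.symm.trans e⟩
      have e1 : (if x = y then (1 : ℂ) else 0) * (if z = w then 1 else 0) = 0 := by
        by_cases h' : x = y
        · rw [if_neg (fun hh => h1 ⟨h', hh⟩), mul_zero]
        · rw [if_neg h', zero_mul]
      have e2 : (if x = w then (1 : ℂ) else 0) * (if z = y then 1 else 0) = 0 := by
        by_cases h' : x = w
        · rw [if_neg (fun hh => h2 ⟨h', hh⟩), mul_zero]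
        · rw [if_neg h', zero_mul]
      simp only [pairing, if_true, Bool.false_eq_true, if_false, if_neg h3, e1, e2, mul_zero, add_zero]
  -- Invariance under `g` at the diagonal entry reads `c * (1 - ∑ |g x₀ x| ^ 4) = 0`, so the third
  -- invariant vanishes.
  obtain ⟨g, hg, hrow⟩ := exists_unitary_row h01
  have hnorm : ∑ x, g x₀ x * star (g x₀ x) = 1 := by
    have := congrFun (congrFun (Matrix.mem_unitaryGroup_iff.mp hg) x₀) x₀
    simpa [Matrix.mul_apply, Matrix.star_apply] using this
  have hinv := hM g hg x₀ x₀ x₀ x₀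
  have hF : ∑ x', ∑ y', ∑ z', ∑ w', g x₀ x' * star (g x₀ y') * (g x₀ z' * star (g x₀ w')) *
      M x' y' z' w' = M x₀ x₀ x₁ x₁ + M x₀ x₁ x₁ x₀ +
        c * ∑ x, (g x₀ x * star (g x₀ x)) * (g x₀ x * star (g x₀ x)) := by
    have s1 : ∑ x', ∑ y', ∑ z', ∑ w', g x₀ x' * star (g x₀ y') * (g x₀ z' * star (g x₀ w')) *
        pairing false x' y' z' w' = 1 := by
      calc _ = (∑ x, g x₀ x * star (g x₀ x)) * ∑ x, g x₀ x * star (g x₀ x) := by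
            rw [Finset.sum_mul_sum]
            simp [pairing, mul_ite]
        _ = 1 := by rw [hnorm, one_mul]
    have s2 : ∑ x', ∑ y', ∑ z', ∑ w', g x₀ x' * star (g x₀ y') * (g x₀ z' * star (g x₀ w')) *
        pairing true x' y' z' w' = 1 := by
      calc _ = (∑ x, g x₀ x * star (g x₀ x)) * ∑ x, g x₀ x * star (g x₀ x) := by
            rw [Finset.sum_mul_sum]
            refine Finset.sum_congr rfl fun x _ => Finset.sum_congr rfl fun y _ => ?_
            simp [pairing, mul_ite]
            ring
        _ = 1 := by rw [hnorm, one_mul]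
    have s3 : ∑ x', ∑ y', ∑ z', ∑ w', g x₀ x' * star (g x₀ y') * (g x₀ z' * star (g x₀ w')) *
        (if x' = y' ∧ x' = z' ∧ x' = w' then 1 else 0) =
        ∑ x, (g x₀ x * star (g x₀ x)) * (g x₀ x * star (g x₀ x)) := by
      simp [ite_and, mul_ite]
    have hexp : ∀ x' y' z' w', g x₀ x' * star (g x₀ y') * (g x₀ z' * star (g x₀ w')) *
        M x' y' z' w' =
        M x₀ x₀ x₁ x₁ * (g x₀ x' * star (g x₀ y') * (g x₀ z' * star (g x₀ w')) *
          pairing false x' y' z' w') +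
        M x₀ x₁ x₁ x₀ * (g x₀ x' * star (g x₀ y') * (g x₀ z' * star (g x₀ w')) *
          pairing true x' y' z' w') +
        c * (g x₀ x' * star (g x₀ y') * (g x₀ z' * star (g x₀ w')) *
          (if x' = y' ∧ x' = z' ∧ x' = w' then 1 else 0)) := by
      intro x' y' z' w'
      rw [hform x' y' z' w']
      ring
    simp only [hexp, Finset.sum_add_distrib, ← Finset.mul_sum, s1, s2, s3, mul_one]
  rw [hF] at hinv
  have hc0 : c = 0 := by
    have : c * (1 - ∑ x, (g x₀ x * star (g x₀ x)) * (g x₀ x * star (g x₀ x))) = 0 := by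
      linear_combination hinv + hc
    exact (mul_eq_zero.mp this).resolve_right (sub_ne_zero.mpr hrow.symm)
  exact ⟨_, _, fun x y z w => by rw [hform x y z w, hc0, zero_mul, add_zero]⟩

end Twirl

instance (d : ℕ) : (haarU d).IsMulLeftInvariant :=
  inferInstanceAs (Measure.haarMeasure ⊤).IsMulLeftInvariant

/-- The monomial `u_{xa} u*_{yb} u_{zc} u*_{we}`. -/
def haarMonomial {d : ℕ} (x y z w a b c e : Fin d) (u : UGroup d) : ℂ :=
  u.1 x a * star (u.1 y b) * (u.1 z c * star (u.1 w e))

theorem continuous_haarMonomial {d : ℕ} (x y z w a b c e : Fin d) :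
    Continuous (haarMonomial x y z w a b c e) := by
  have h : ∀ i j : Fin d, Continuous fun u : UGroup d => u.1 i j := fun i j =>
    continuous_subtype_val.matrix_elem i j
  exact ((h x a).mul (h y b).star).mul ((h z c).mul (h w e).star)

/-- The Weingarten coefficients of second order. -/
def weingarten (d : ℕ) (σ τ : Bool) : ℂ :=
  if σ = τ then 1 / ((d : ℂ) ^ 2 - 1) else -1 / ((d : ℂ) * ((d : ℂ) ^ 2 - 1))

/-- Left invariance of the Haar measure, with the translated monomial expanded along the row
indices. -/
theorem twirlInvariant_integral {d : ℕ} (a b c e : Fin d) :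
    TwirlInvariant fun x y z w => ∫ u, haarMonomial x y z w a b c e u ∂(haarU d) := by
  intro g hg x y z w
  have hint : ∀ x y z w, Integrable (haarMonomial x y z w a b c e) (haarU d) := fun x y z w =>
    integrable_of_continuous _ (continuous_haarMonomial ..)
  beta_reduce
  rw [← integral_mul_left_eq_self (haarMonomial x y z w a b c e) (⟨g, hg⟩ : UGroup d)]
  have h1 : ∀ u : UGroup d, haarMonomial x y z w a b c e (⟨g, hg⟩ * u) =
      ∑ x', ∑ y', ∑ z', ∑ w', g x x' * star (g y y') * (g z z' * star (g w w')) *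
        haarMonomial x' y' z' w' a b c e u := by
    intro u
    simp only [haarMonomial, Submonoid.coe_mul, Matrix.mul_apply, star_sum, star_mul']
    simp only [Finset.sum_mul_sum]
    refine Finset.sum_congr rfl fun x' _ => ?_
    rw [Finset.sum_comm]
    refine Finset.sum_congr rfl fun y' _ => ?_
    refine Finset.sum_congr rfl fun z' _ => ?_
    refine Finset.sum_congr rfl fun w' _ => ?_
    ring
  simp only [h1]
  rw [integral_finsetSum _ fun _ _ => integrable_finsetSum _ fun _ _ =>
    integrable_finsetSum _ fun _ _ => integrable_finsetSum _ fun _ _ => (hint ..).const_mul _]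
  refine Finset.sum_congr rfl fun x' _ => ?_
  rw [integral_finsetSum _ fun _ _ => integrable_finsetSum _ fun _ _ =>
    integrable_finsetSum _ fun _ _ => (hint ..).const_mul _]
  refine Finset.sum_congr rfl fun y' _ => ?_
  rw [integral_finsetSum _ fun _ _ => integrable_finsetSum _ fun _ _ => (hint ..).const_mul _]
  refine Finset.sum_congr rfl fun z' _ => ?_
  rw [integral_finsetSum _ fun _ _ => (hint ..).const_mul _]
  exact Finset.sum_congr rfl fun w' _ => integral_const_mul _ _

/-- The row dependence is a combination of the two pairings. Contracting rows with each pairing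
turns the monomial into a pairing of columns by unitarity, which gives a linear system with Gram
matrix $\begin{pmatrix}d^2&d\\d&d^2\end{pmatrix}$; the Weingarten coefficients are its inverse. -/
theorem integral_haarMonomial {d : ℕ} (hd : 2 ≤ d) (x y z w a b c e : Fin d) :
    ∫ u, haarMonomial x y z w a b c e u ∂(haarU d) =
      ∑ σ, ∑ τ, weingarten d σ τ * pairing σ x y z w * pairing τ a b c e := by
  obtain ⟨A, B, hAB⟩ := (twirlInvariant_integral a b c e).eq_pairing hd
  have hint : ∀ x y z w, Integrable (haarMonomial x y z w a b c e) (haarU d) := fun x y z w =>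
    integrable_of_continuous _ (continuous_haarMonomial ..)
  have horth : ∀ (u : UGroup d) (i j : Fin d),
      ∑ x, u.1 x i * star (u.1 x j) = if i = j then 1 else 0 := by
    intro u i j
    have := congrFun (congrFun (Matrix.mem_unitaryGroup_iff'.mp u.2) j) i
    simp only [Matrix.mul_apply, Matrix.star_apply, Matrix.one_apply] at this
    rw [if_congr (eq_comm (a := i)) rfl rfl, ← this]
    exact Finset.sum_congr rfl fun x _ => mul_comm _ _
  have h1 : ∑ x, ∑ z, ∫ u, haarMonomial x x z z a b c e u ∂(haarU d) = pairing false a b c e := by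
    simp_rw [← integral_finsetSum _ fun z _ => hint _ _ z z]
    rw [← integral_finsetSum _ fun x _ => integrable_finsetSum _ fun z _ => hint x x z z]
    have : ∀ u : UGroup d, ∑ x, ∑ z, haarMonomial x x z z a b c e u = pairing false a b c e := by
      intro u
      simp only [haarMonomial, ← Finset.sum_mul_sum, horth, pairing, Bool.false_eq_true, if_false]
    simp [this]
  have h2 : ∑ x, ∑ z, ∫ u, haarMonomial x z z x a b c e u ∂(haarU d) = pairing true a b c e := by
    simp_rw [← integral_finsetSum _ fun z _ => hint _ z z _]
    rw [← integral_finsetSum _ fun x _ => integrable_finsetSum _ fun z _ => hint x z z x]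
    have : ∀ u : UGroup d, ∑ x, ∑ z, haarMonomial x z z x a b c e u = pairing true a b c e := by
      intro u
      have h : ∀ x z, haarMonomial x z z x a b c e u =
          (u.1 x a * star (u.1 x e)) * (u.1 z c * star (u.1 z b)) := fun x z => by
        simp only [haarMonomial]; ring
      simp only [h, ← Finset.sum_mul_sum, horth, pairing, if_true]
    simp [this]
  simp only [hAB] at h1 h2 ⊢
  have e1 : A * (d : ℂ) ^ 2 + B * d = pairing false a b c e := by
    rw [← h1]
    simp [pairing, Finset.sum_add_distrib]
    ring
  have e2 : A * (d : ℂ) + B * d ^ 2 = pairing true a b c e := by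
    rw [← h2]
    simp [pairing, Finset.sum_add_distrib]
    ring
  have hd0 : (d : ℂ) ≠ 0 := by
    have : d ≠ 0 := by omega
    exact_mod_cast this
  have hd1 : (d : ℂ) ^ 2 - 1 ≠ 0 := by
    rw [sub_ne_zero]
    have : d ^ 2 ≠ 1 := by nlinarith
    exact_mod_cast this
  simp only [Fintype.sum_bool, weingarten, ← e1, ← e2]
  simp only [if_true, Bool.true_eq_false, Bool.false_eq_true, if_false]
  field_simp
  ring

/-! ### The averaged two-copy gate -/

/-- Indices of four replicas. -/
abbrev Four (X : Type*) : Type _ := (X × X) × (X × X)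

/-- The four-replica operator `G ⊗ G^* ⊗ G ⊗ G^*`. -/
def replicate {X : Type*} (G : Matrix X X ℂ) : Matrix (Four X) (Four X) ℂ :=
  (G ⊗ₖ G.map star) ⊗ₖ (G ⊗ₖ G.map star)

theorem replicate_apply {X : Type*} (G : Matrix X X ℂ) (q q' : Four X) :
    replicate G q q' = G q.1.1 q'.1.1 * star (G q.1.2 q'.1.2) *
      (G q.2.1 q'.2.1 * star (G q.2.2 q'.2.2)) := rfl

theorem replicate_mul {X : Type*} [Fintype X] (G H : Matrix X X ℂ) :
    replicate (G * H) = replicate G * replicate H := by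
  have h : (G * H).map star = G.map star * H.map star := by
    ext i j
    simp [Matrix.mul_apply]
  rw [replicate, h, Matrix.mul_kronecker_mul, Matrix.mul_kronecker_mul]
  rfl

/-- The pairings of four replicas of two qudits as a vector. -/
def pairVec {d : ℕ} (σ : Bool × Bool) (q : Four (Fin d × Fin d)) : ℂ :=
  pairing σ.1 q.1.1.1 q.1.2.1 q.2.1.1 q.2.2.1 * pairing σ.2 q.1.1.2 q.1.2.2 q.2.1.2 q.2.2.2

/-- The replica paired with `x` on the qudits labelled `false`, with `z` on the others. -/
def mix {d : ℕ} (σ : Bool × Bool) (x z : Fin d × Fin d) : Fin d × Fin d :=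
  (if σ.1 then z.1 else x.1, if σ.2 then z.2 else x.2)

theorem ite_prod_eq {d : ℕ} (x y : Fin d × Fin d) : (if x = y then (1 : ℂ) else 0) =
    (if x.1 = y.1 then 1 else 0) * (if x.2 = y.2 then 1 else 0) := by
  simp only [Prod.ext_iff, ite_and, ite_mul, one_mul, zero_mul]

theorem pairVec_eq {d : ℕ} (σ : Bool × Bool) (x y z w : Fin d × Fin d) :
    pairVec σ ((x, y), (z, w)) =
      (if mix σ x z = y then 1 else 0) * (if mix σ z x = w then 1 else 0) := by
  obtain ⟨s, t⟩ := σ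
  rw [ite_prod_eq, ite_prod_eq]
  cases s <;> cases t <;>
    simp only [pairVec, pairing, mix, if_true, if_false, Bool.false_eq_true] <;> ring

/-- A pairing makes the conjugated replicas functions of the two unconjugated ones. -/
theorem sum_pairVec_mul {d : ℕ} (σ : Bool × Bool) (f : Four (Fin d × Fin d) → ℂ) :
    ∑ q, pairVec σ q * f q = ∑ x, ∑ z, f ((x, mix σ x z), (z, mix σ z x)) := by
  simp only [Fintype.sum_prod_type (α₁ := (Fin d × Fin d) × (Fin d × Fin d)), Fintype.sum_prod_type (α₁ := Fin d × Fin d) (α₂ := Fin d × Fin d), pairVec_eq]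
  refine Finset.sum_congr rfl fun x _ => ?_
  rw [Finset.sum_comm]
  refine Finset.sum_congr rfl fun z _ => ?_
  simp [ite_mul]

theorem unitary_col_orthonormal {X : Type*} [Fintype X] [DecidableEq X] {G : Matrix X X ℂ}
    (hG : G ∈ Matrix.unitaryGroup X ℂ) (i j : X) :
    ∑ x, G x i * star (G x j) = if i = j then 1 else 0 := by
  have := congrFun (congrFun (Matrix.mem_unitaryGroup_iff'.mp hG) j) i
  simp only [Matrix.mul_apply, Matrix.star_apply, Matrix.one_apply] at this
  rw [if_congr (eq_comm (a := i)) rfl rfl, ← this]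
  exact Finset.sum_congr rfl fun x _ => mul_comm _ _

theorem unitary_row_orthonormal {X : Type*} [Fintype X] [DecidableEq X] {G : Matrix X X ℂ}
    (hG : G ∈ Matrix.unitaryGroup X ℂ) (i j : X) :
    ∑ x, G i x * star (G j x) = if i = j then 1 else 0 := by
  have := congrFun (congrFun (Matrix.mem_unitaryGroup_iff.mp hG) i) j
  simpa only [Matrix.mul_apply, Matrix.star_apply, Matrix.one_apply] using this

theorem sum_paired {X : Type*} [Fintype X] [DecidableEq X] {f : X → X → ℂ}
    (hf : ∀ i j, ∑ x, f x i * star (f x j) = if i = j then 1 else 0) (s : Bool) (a b c e : X) :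
    ∑ x, ∑ z, f x a * star (f (if s then z else x) b) *
      (f z c * star (f (if s then x else z) e)) = pairing s a b c e := by
  cases s
  · simp only [pairing, Bool.false_eq_true, if_false]
    rw [← hf a b, ← hf c e, Finset.sum_mul_sum]
  · simp only [pairing, if_true]
    rw [← hf a e, ← hf c b, Finset.sum_mul_sum]
    exact Finset.sum_congr rfl fun x _ => Finset.sum_congr rfl fun z _ => by ring

/-- Local unitaries are absorbed by the pairings, so the noise $u_\pm$ to the left of the gate has
no effect on purities; only $v_\pm$ has to be averaged. -/
theorem pairVec_vecMul_kronecker {d : ℕ} {u v : Matrix (Fin d) (Fin d) ℂ}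
    (hu : u ∈ Matrix.unitaryGroup (Fin d) ℂ) (hv : v ∈ Matrix.unitaryGroup (Fin d) ℂ)
    (σ : Bool × Bool) : Matrix.vecMul (pairVec σ) (replicate (u ⊗ₖ v)) = pairVec σ := by
  funext q
  have h := sum_pairVec_mul σ fun q' => replicate (u ⊗ₖ v) q' q
  rw [Matrix.vecMul, dotProduct, h]
  rw [pairVec, ← sum_paired (unitary_col_orthonormal hu), ← sum_paired (unitary_col_orthonormal hv),
    Finset.sum_mul_sum]
  simp only [Fintype.sum_prod_type]
  refine Finset.sum_congr rfl fun x _ => Finset.sum_congr rfl fun y _ => ?_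
  rw [Finset.sum_mul_sum]
  refine Finset.sum_congr rfl fun z _ => Finset.sum_congr rfl fun w _ => ?_
  simp only [replicate_apply, Matrix.kroneckerMap_apply, mix, star_mul']
  ring

theorem pairVec_same_vecMul {d : ℕ} {U : Gate d} (hU : U ∈ Matrix.unitaryGroup (Fin d × Fin d) ℂ)
    (s : Bool) : Matrix.vecMul (pairVec (s, s)) (replicate U) = pairVec (s, s) := by
  funext ⟨⟨a, b⟩, ⟨c, e⟩⟩
  have h := sum_pairVec_mul (s, s) fun q' => replicate U q' ((a, b), (c, e))
  have h2 := sum_paired (unitary_col_orthonormal hU) s a b c e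
  rw [Matrix.vecMul, dotProduct, h, pairVec_eq]
  cases s <;> simp [mix, replicate_apply, pairing] at h2 ⊢
  · exact h2
  · rw [h2]
    split_ifs <;> simp_all

theorem replicate_same_mulVec {d : ℕ} {U : Gate d} (hU : U ∈ Matrix.unitaryGroup (Fin d × Fin d) ℂ)
    (s : Bool) : Matrix.mulVec (replicate U) (pairVec (s, s)) = pairVec (s, s) := by
  funext ⟨⟨a, b⟩, ⟨c, e⟩⟩
  have h := sum_pairVec_mul (s, s) fun q' => replicate U ((a, b), (c, e)) q'
  have h2 := sum_paired (f := fun x i => U i x) (unitary_row_orthonormal hU) s a b c e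
  rw [Matrix.mulVec, dotProduct_comm, dotProduct, h, pairVec_eq]
  cases s <;> simp [mix, replicate_apply, pairing] at h2 ⊢
  · exact h2
  · rw [h2]
    split_ifs <;> simp_all

/-- The matrix element of the replicated gate between two pairings. -/
def pairKernel {d : ℕ} (U : Gate d) (σ ρ : Bool × Bool) : ℂ :=
  ∑ q, Matrix.vecMul (pairVec σ) (replicate U) q * pairVec ρ q

theorem pairKernel_eq {d : ℕ} (U : Gate d) (σ ρ : Bool × Bool) :
    pairKernel U σ ρ = ∑ x, ∑ z, ∑ x', ∑ z', U x x' * star (U (mix σ x z) (mix ρ x' z')) *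
      (U z z' * star (U (mix σ z x) (mix ρ z' x'))) := by
  have h : ∀ q, Matrix.vecMul (pairVec σ) (replicate U) q = ∑ x, ∑ z,
      replicate U ((x, mix σ x z), (z, mix σ z x)) q := fun q =>
    sum_pairVec_mul σ fun q' => replicate U q' q
  rw [pairKernel]
  simp_rw [h, mul_comm _ (pairVec ρ _)]
  rw [sum_pairVec_mul ρ fun q => ∑ x, ∑ z, replicate U ((x, mix σ x z), (z, mix σ z x)) q]
  simp_rw [replicate_apply]
  calc _ = ∑ p' : (Fin d × Fin d) × (Fin d × Fin d), ∑ p : (Fin d × Fin d) × (Fin d × Fin d),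
        U p.1 p'.1 * star (U (mix σ p.1 p.2) (mix ρ p'.1 p'.2)) *
      (U p.2 p'.2 * star (U (mix σ p.2 p.1) (mix ρ p'.2 p'.1))) := by
        simp only [Fintype.sum_prod_type (α₁ := Fin d × Fin d) (α₂ := Fin d × Fin d)]
    _ = _ := by
      rw [Finset.sum_comm]
      simp only [Fintype.sum_prod_type (α₁ := Fin d × Fin d) (α₂ := Fin d × Fin d)]

/-- Complementing all pairings only exchanges the two conjugated replicas. -/
theorem pairKernel_not {d : ℕ} (U : Gate d) (σ ρ : Bool × Bool) :
    pairKernel U (!σ.1, !σ.2) (!ρ.1, !ρ.2) = pairKernel U σ ρ := by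
  have h : ∀ (σ : Bool × Bool) (x z : Fin d × Fin d), mix (!σ.1, !σ.2) x z = mix σ z x := by
    rintro ⟨s, t⟩ x z
    cases s <;> cases t <;> rfl
  simp only [pairKernel_eq, h]
  refine Finset.sum_congr rfl fun x _ => Finset.sum_congr rfl fun z _ =>
    Finset.sum_congr rfl fun x' _ => Finset.sum_congr rfl fun z' _ => ?_
  ring

/-- The overlap of two pairings of one qudit. -/
def overlap (d : ℕ) (s t : Bool) : ℂ := if s = t then (d : ℂ) ^ 2 else d

theorem sum_pairVec_mul_pairVec {d : ℕ} (σ ρ : Bool × Bool) :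
    ∑ q : Four (Fin d × Fin d), pairVec σ q * pairVec ρ q =
      overlap d σ.1 ρ.1 * overlap d σ.2 ρ.2 := by
  rw [sum_pairVec_mul]
  have h1 : ∀ s t : Bool, ∑ x : Fin d, ∑ z : Fin d, pairing t x (if s then z else x) z
      (if s then x else z) = overlap d s t := by
    intro s t
    cases s <;> cases t <;> simp [pairing, overlap] <;> ring
  rw [← h1, ← h1, Finset.sum_mul_sum]
  simp only [Fintype.sum_prod_type]
  refine Finset.sum_congr rfl fun x _ => Finset.sum_congr rfl fun y _ => ?_
  rw [Finset.sum_mul_sum]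
  rfl

theorem pairKernel_same_left {d : ℕ} {U : Gate d} (hU : U ∈ Matrix.unitaryGroup (Fin d × Fin d) ℂ)
    (s : Bool) (ρ : Bool × Bool) :
    pairKernel U (s, s) ρ = overlap d s ρ.1 * overlap d s ρ.2 := by
  rw [pairKernel, pairVec_same_vecMul hU, sum_pairVec_mul_pairVec]

theorem pairKernel_same_right {d : ℕ} {U : Gate d} (hU : U ∈ Matrix.unitaryGroup (Fin d × Fin d) ℂ)
    (σ : Bool × Bool) (s : Bool) :
    pairKernel U σ (s, s) = overlap d σ.1 s * overlap d σ.2 s := by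
  have h : pairKernel U σ (s, s) = Matrix.vecMul (pairVec σ) (replicate U) ⬝ᵥ pairVec (s, s) := rfl
  rw [h, ← Matrix.dotProduct_mulVec, replicate_same_mulVec hU, dotProduct, sum_pairVec_mul_pairVec]

theorem trace_gram_sq {X : Type*} [Fintype X] [DecidableEq X] (W : Matrix X X ℂ) :
    ((W * W.conjTranspose) ^ 2).trace =
      ∑ r, ∑ s, ∑ c, ∑ e, W r c * star (W s c) * (W s e * star (W r e)) := by
  rw [pow_two]
  simp only [Matrix.trace, Matrix.diag, Matrix.mul_apply, Matrix.conjTranspose_apply,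
    Finset.sum_mul_sum]

theorem sum_four_prod {F : Type*} [Fintype F] (f : F → F → F → F → F → F → F → F → ℂ) :
    ∑ x : F × F, ∑ z : F × F, ∑ x' : F × F, ∑ z' : F × F,
      f x.1 x.2 z.1 z.2 x'.1 x'.2 z'.1 z'.2 =
    ∑ q : (F × F × F × F) × (F × F × F × F),
      f q.1.1 q.1.2.1 q.1.2.2.1 q.1.2.2.2 q.2.1 q.2.2.1 q.2.2.2.1 q.2.2.2.2 := by
  simp only [Fintype.sum_prod_type]

/-- Here dual unitarity enters. With opposite pairings on the two qudits the contraction runs in the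
space direction, and the kernel is $\mathrm{tr}[(\tilde U\tilde U^\dagger)^2]=d^2$. -/
theorem pairKernel_mixed_same {d : ℕ} {U : Gate d}
    (hU : dualGate U ∈ Matrix.unitaryGroup (Fin d × Fin d) ℂ) :
    pairKernel U (false, true) (false, true) = (d : ℂ) ^ 2 := by
  have h1 : ((dualGate U * (dualGate U).conjTranspose) ^ 2).trace = (d : ℂ) ^ 2 := by
    have : dualGate U * (dualGate U).conjTranspose = 1 := Matrix.mem_unitaryGroup_iff.mp hU
    rw [this, one_pow, Matrix.trace_one]
    simp [pow_two]
  rw [← h1, trace_gram_sq, pairKernel_eq]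
  simp only [mix, if_true, if_false, Bool.false_eq_true, dualGate, Matrix.of_apply]
  rw [sum_four_prod fun a b c e a' b' c' e' => U (a, b) (a', b') * star (U (a, e) (a', e')) *
    (U (c, e) (c', e') * star (U (c, b) (c', b')))]
  rw [sum_four_prod fun r₁ r₂ s₁ s₂ c₁ c₂ e₁ e₂ => U (c₁, r₁) (c₂, r₂) * star (U (c₁, s₁) (c₂, s₂)) *
    (U (e₁, s₁) (e₂, s₂) * star (U (e₁, r₁) (e₂, r₂)))]
  -- The regrouping from rows and columns of `U` to those of the reshuffled gate.
  let e : ((Fin d × Fin d × Fin d × Fin d) × (Fin d × Fin d × Fin d × Fin d)) ≃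
      ((Fin d × Fin d × Fin d × Fin d) × (Fin d × Fin d × Fin d × Fin d)) :=
    { toFun := fun q => ((q.1.2.1, q.2.2.1, q.1.2.2.2, q.2.2.2.2), (q.1.1, q.2.1, q.1.2.2.1, q.2.2.2.1))
      invFun := fun q => ((q.2.1, q.1.1, q.2.2.2.1, q.1.2.2.1), (q.2.2.1, q.1.2.1, q.2.2.2.2, q.1.2.2.2))
      left_inv := fun _ => rfl
      right_inv := fun _ => rfl }
  exact Fintype.sum_equiv e _ _ fun q => rfl

/-- Together with its complement, the only kernel entry not fixed by unitarity and dual unitarity;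
the entangling power parametrises it. -/
theorem pairKernel_mixed_swap {d : ℕ} (U : Gate d) :
    pairKernel U (false, true) (true, false) =
      ((partialTranspose₂ (dualGate U) * (partialTranspose₂ (dualGate U)).conjTranspose) ^ 2
        ).trace := by
  rw [trace_gram_sq, pairKernel_eq]
  simp only [mix, if_true, if_false, Bool.false_eq_true, dualGate, partialTranspose₂,
    Matrix.of_apply]
  rw [sum_four_prod fun a b c e a' b' c' e' => U (a, b) (a', b') * star (U (a, e) (c', b')) *
    (U (c, e) (c', e') * star (U (c, b) (a', e')))]
  rw [sum_four_prod fun r₁ r₂ s₁ s₂ c₁ c₂ e₁ e₂ => U (c₁, r₁) (r₂, c₂) * star (U (c₁, s₁) (s₂, c₂)) *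
    (U (e₁, s₁) (s₂, e₂) * star (U (e₁, r₁) (r₂, e₂)))]
  let e : ((Fin d × Fin d × Fin d × Fin d) × (Fin d × Fin d × Fin d × Fin d)) ≃
      ((Fin d × Fin d × Fin d × Fin d) × (Fin d × Fin d × Fin d × Fin d)) :=
    { toFun := fun q => ((q.1.2.1, q.2.1, q.1.2.2.2, q.2.2.2.1), (q.1.1, q.2.2.1, q.1.2.2.1, q.2.2.2.2))
      invFun := fun q => ((q.2.1, q.1.1, q.2.2.2.1, q.1.2.2.1), (q.1.2.1, q.2.2.1, q.1.2.2.2, q.2.2.2.2))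
      left_inv := fun _ => rfl
      right_inv := fun _ => rfl }
  exact Fintype.sum_equiv e _ _ fun q => rfl

theorem pairKernel_mixed_swap_eq {d : ℕ} (hd : 2 ≤ d) (U : Gate d) :
    pairKernel U (false, true) (true, false) =
      (d : ℂ) ^ 4 - (entanglingPower U : ℂ) * ((d : ℂ) ^ 2 * ((d : ℂ) ^ 2 - 1)) := by
  rw [pairKernel_mixed_swap]
  set P := partialTranspose₂ (dualGate U)
  have hre : ((((P * P.conjTranspose) ^ 2).trace.re : ℝ) : ℂ) = ((P * P.conjTranspose) ^ 2).trace := by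
    have hH : ((P * P.conjTranspose) ^ 2).IsHermitian :=
      (Matrix.isHermitian_mul_conjTranspose_self P).pow 2
    rw [← Complex.conj_eq_iff_re, starRingEnd_apply, ← Matrix.trace_conjTranspose, hH.eq]
  have hd2 : (d : ℝ) ^ 2 * ((d : ℝ) ^ 2 - 1) ≠ 0 := by
    have : (2 : ℝ) ≤ d := by exact_mod_cast hd
    have h1 : (d : ℝ) ^ 2 - 1 > 0 := by nlinarith
    positivity
  have h : entanglingPower U * ((d : ℝ) ^ 2 * ((d : ℝ) ^ 2 - 1)) =
      (d : ℝ) ^ 4 - ((P * P.conjTranspose) ^ 2).trace.re := div_mul_cancel₀ _ hd2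
  have h' := congrArg (Complex.ofReal) h
  push_cast at h'
  rw [h', hre]
  ring

/-- Averaged weights of a gate acting on pairings. -/
def gateWeight (d : ℕ) (p : ℝ) (σ τ : Bool × Bool) : ℝ :=
  if σ.1 = σ.2 then (if τ = σ then 1 else 0)
  else if τ.1 = τ.2 then d * p / ((d : ℝ) ^ 2 - 1)
  else if τ = σ then -p / ((d : ℝ) ^ 2 - 1)
  else 1 - p - p / ((d : ℝ) ^ 2 - 1)

/-- All sixteen kernel entries are now known, so contracting with two Weingarten matrices is a
finite computation. -/
theorem sum_weingarten_pairKernel {d : ℕ} (hd : 2 ≤ d) {U : Gate d} (hU : IsDualUnitary U)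
    (σ τ : Bool × Bool) :
    ∑ ρ₁, ∑ ρ₂, weingarten d ρ₁ τ.1 * weingarten d ρ₂ τ.2 * pairKernel U σ (ρ₁, ρ₂) =
      (gateWeight d (entanglingPower U) σ τ : ℂ) := by
  have hd0 : (d : ℂ) ≠ 0 := by
    have : d ≠ 0 := by omega
    exact_mod_cast this
  have hd1 : (d : ℂ) ^ 2 - 1 ≠ 0 := by
    rw [sub_ne_zero]
    have : d ^ 2 ≠ 1 := by nlinarith
    exact_mod_cast this
  have n1 := pairKernel_not U (false, true) (false, true)
  have n2 := pairKernel_not U (false, true) (true, false)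
  simp only [Bool.not_true, Bool.not_false] at n1 n2
  rw [pairKernel_mixed_same hU.2] at n1
  rw [pairKernel_mixed_swap_eq hd] at n2
  obtain ⟨s, t⟩ := σ
  obtain ⟨s', t'⟩ := τ
  cases s <;> cases t <;> cases s' <;> cases t' <;>
    simp only [Fintype.sum_bool, pairKernel_same_left hU.1, pairKernel_same_right hU.1, n1, n2,
      pairKernel_mixed_same hU.2, pairKernel_mixed_swap_eq hd, weingarten, overlap, gateWeight,
      if_true, if_false, Bool.false_eq_true, Bool.true_eq_false, Prod.mk.injEq, and_true, and_false,
      and_self] <;>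
    push_cast <;> field_simp <;> ring

theorem replicate_kronecker_apply {d : ℕ} (v w : UGroup d) (q q' : Four (Fin d × Fin d)) :
    replicate ((v : Matrix (Fin d) (Fin d) ℂ) ⊗ₖ (w : Matrix (Fin d) (Fin d) ℂ)) q q' =
      haarMonomial q.1.1.1 q.1.2.1 q.2.1.1 q.2.2.1 q'.1.1.1 q'.1.2.1 q'.2.1.1 q'.2.2.1 v *
      haarMonomial q.1.1.2 q.1.2.2 q.2.1.2 q.2.2.2 q'.1.1.2 q'.1.2.2 q'.2.1.2 q'.2.2.2 w := by
  simp only [replicate_apply, Matrix.kroneckerMap_apply, haarMonomial, star_mul']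
  ring

theorem pairVec_vecMul_noisyGate {d : ℕ} (U : Gate d) (σ : Bool × Bool) (u : Fin 4 → UGroup d)
    (q' : Four (Fin d × Fin d)) :
    Matrix.vecMul (pairVec σ) (replicate (noisyGate U u)) q' =
      ∑ q, Matrix.vecMul (pairVec σ) (replicate U) q *
        (haarMonomial q.1.1.1 q.1.2.1 q.2.1.1 q.2.2.1 q'.1.1.1 q'.1.2.1 q'.2.1.1 q'.2.2.1 (u 2) *
        haarMonomial q.1.1.2 q.1.2.2 q.2.1.2 q.2.2.2 q'.1.1.2 q'.1.2.2 q'.2.1.2 q'.2.2.2 (u 3)) := by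
  rw [noisyGate, replicate_mul, replicate_mul, ← Matrix.vecMul_vecMul, ← Matrix.vecMul_vecMul,
    pairVec_vecMul_kronecker (u 0).2 (u 1).2]
  simp only [← replicate_kronecker_apply]
  rfl

theorem integral_mul_two_three {d : ℕ} (f g : UGroup d → ℂ) :
    ∫ u : Fin 4 → UGroup d, f (u 2) * g (u 3) ∂(Measure.pi fun _ => haarU d) =
      (∫ u, f u ∂(haarU d)) * ∫ u, g u ∂(haarU d) := by
  have h := integral_fintype_prod_eq_prod (𝕜 := ℂ) (ι := Fin 4) (E := fun _ => UGroup d)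
    (f := ![fun _ => 1, fun _ => 1, f, g]) (μ := fun _ => haarU d)
  simpa [Fin.prod_univ_four] using h

/-- An averaged gate maps the span of the pairings to itself. This closure reduces the averaged
purity to a dynamics of patterns. -/
theorem integral_pairVec_vecMul_noisyGate {d : ℕ} (hd : 2 ≤ d) {U : Gate d}
    (hU : IsDualUnitary U) (σ : Bool × Bool) (q' : Four (Fin d × Fin d)) :
    ∫ u : Fin 4 → UGroup d, Matrix.vecMul (pairVec σ) (replicate (noisyGate U u)) q'
        ∂(Measure.pi fun _ => haarU d) =
      ∑ τ, (gateWeight d (entanglingPower U) σ τ : ℂ) * pairVec τ q' := by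
  simp_rw [pairVec_vecMul_noisyGate]
  have hcont : ∀ (x y z w a b c e : Fin d) (i : Fin 4), Continuous fun u : Fin 4 → UGroup d =>
      haarMonomial x y z w a b c e (u i) := by
    intro x y z w a b c e i
    have h' := (continuous_haarMonomial x y z w a b c e).comp
      (continuous_apply (A := fun _ : Fin 4 => UGroup d) i)
    exact h'
  have hint : ∀ q : Four (Fin d × Fin d), Integrable (fun u : Fin 4 → UGroup d =>
      Matrix.vecMul (pairVec σ) (replicate U) q *
        (haarMonomial q.1.1.1 q.1.2.1 q.2.1.1 q.2.2.1 q'.1.1.1 q'.1.2.1 q'.2.1.1 q'.2.2.1 (u 2) *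
        haarMonomial q.1.1.2 q.1.2.2 q.2.1.2 q.2.2.2 q'.1.1.2 q'.1.2.2 q'.2.1.2 q'.2.2.2 (u 3)))
      (Measure.pi fun _ => haarU d) := fun q =>
    (integrable_of_continuous _ ((hcont ..).mul (hcont ..))).const_mul _
  rw [integral_finsetSum _ fun q _ => hint q]
  simp_rw [integral_const_mul, integral_mul_two_three, integral_haarMonomial hd,
    ← sum_weingarten_pairKernel hd hU, pairKernel]
  simp only [Fintype.sum_prod_type (α₁ := Bool), Fintype.sum_bool, pairVec, Finset.mul_sum,
    Finset.sum_mul, ← Finset.sum_add_distrib]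
  refine Finset.sum_congr rfl fun q _ => ?_
  ring

/-! ### Generalised purities and their averaged evolution -/

section Purity

variable {K S : Type*} {d : ℕ}

/-- The configuration equal to `z` where `σ` holds and to `x` elsewhere. -/
def blend (σ : S → Bool) (x z : S → Fin d) : S → Fin d := fun s => if σ s then z s else x s

/-- The purity of the subsystem on which `σ` holds. -/
def purity [Fintype S] [DecidableEq S] (σ : S → Bool) (ψ : (S → Fin d) → ℂ) : ℂ :=
  ∑ x, ∑ z, ψ x * star (ψ (blend σ x z)) * (ψ z * star (ψ (blend σ z x)))

/-- Four copies of a state. -/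
def fourCopies {X : Type*} (ψ : X → ℂ) (q : Four X) : ℂ :=
  ψ q.1.1 * star (ψ q.1.2) * (ψ q.2.1 * star (ψ q.2.2))

theorem fourCopies_mulVec {X : Type*} [Fintype X] (M : Matrix X X ℂ) (ψ : X → ℂ) :
    fourCopies (M.mulVec ψ) = (replicate M).mulVec (fourCopies ψ) := by
  funext q
  simp only [fourCopies, Matrix.mulVec, dotProduct, star_sum, Finset.sum_mul_sum, replicate_apply,
    Fintype.sum_prod_type, star_mul']
  refine Finset.sum_congr rfl fun x _ => ?_
  rw [Finset.sum_comm]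
  refine Finset.sum_congr rfl fun y _ => Finset.sum_congr rfl fun z _ =>
    Finset.sum_congr rfl fun w _ => ?_
  ring

/-- A pattern of pairings of four replicas as a vector. -/
def patternVec [Fintype S] (σ : S → Bool) (q : Four (S → Fin d)) : ℂ :=
  ∏ s, pairing (σ s) (q.1.1 s) (q.1.2 s) (q.2.1 s) (q.2.2 s)

theorem patternVec_eq [Fintype S] [DecidableEq S] (σ : S → Bool) (x y z w : S → Fin d) :
    patternVec σ ((x, y), (z, w)) =
      (if blend σ x z = y then 1 else 0) * (if blend σ z x = w then 1 else 0) := by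
  have h : ∀ f g : S → Fin d, (if f = g then (1 : ℂ) else 0) = ∏ s, if f s = g s then 1 else 0 := by
    intro f g
    rw [Finset.prod_ite_zero]
    simp [funext_iff]
  rw [h, h, ← Finset.prod_mul_distrib]
  refine Finset.prod_congr rfl fun s _ => ?_
  simp only [blend, pairing]
  by_cases hs : σ s
  · simp only [if_pos hs]
    ring
  · simp only [if_neg hs]

theorem purity_eq_sum [Fintype S] [DecidableEq S] (σ : S → Bool) (ψ : (S → Fin d) → ℂ) :
    purity σ ψ = ∑ q, patternVec σ q * fourCopies ψ q := by
  simp only [Fintype.sum_prod_type (α₁ := (S → Fin d) × (S → Fin d)),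
    Fintype.sum_prod_type (α₁ := S → Fin d) (α₂ := S → Fin d), patternVec_eq]
  refine Finset.sum_congr rfl fun x _ => ?_
  rw [Finset.sum_comm]
  refine Finset.sum_congr rfl fun z _ => ?_
  simp [ite_mul, fourCopies]

/-- The four replicas of the two qudits of the pair `k`. -/
def fourAt (l r : K → S) (q : Four (S → Fin d)) (k : K) : Four (Fin d × Fin d) :=
  (((q.1.1 (l k), q.1.1 (r k)), (q.1.2 (l k), q.1.2 (r k))),
    ((q.2.1 (l k), q.2.1 (r k)), (q.2.2 (l k), q.2.2 (r k))))

theorem sum_prod_fourAt [Fintype K] [DecidableEq K] [Fintype S] [DecidableEq S] {l r : K → S}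
    (h : IsPairing l r) (f : K → Four (Fin d × Fin d) → ℂ) :
    ∑ q, ∏ k, f k (fourAt l r q k) = ∏ k, ∑ p, f k p := by
  let e : Four (S → Fin d) ≃ (K → Four (Fin d × Fin d)) :=
    { toFun := fourAt l r
      invFun := fun y => (((pairEquiv h).symm fun k => (y k).1.1, (pairEquiv h).symm fun k => (y k).1.2),
        ((pairEquiv h).symm fun k => (y k).2.1, (pairEquiv h).symm fun k => (y k).2.2))
      left_inv := fun q => by
        have h1 : ∀ a : S → Fin d, (pairEquiv h).symm (fun k => (a (l k), a (r k))) = a :=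
          fun a => (pairEquiv h).symm_apply_apply a
        simp only [fourAt, h1]
      right_inv := fun y => by
        funext k
        simp only [fourAt, pairEquiv_symm_left, pairEquiv_symm_right] }
  rw [Finset.prod_univ_sum, Fintype.piFinset_univ, ← e.sum_comp]
  rfl

theorem patternVec_eq_prod [Fintype K] [Fintype S] {l r : K → S} (h : IsPairing l r)
    (σ : S → Bool) (q : Four (S → Fin d)) :
    patternVec σ q = ∏ k, pairVec (σ (l k), σ (r k)) (fourAt l r q k) := by
  rw [patternVec, h.prod_eq]
  exact Finset.prod_congr rfl fun k _ => rfl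

theorem replicate_pairMat [Fintype K] (l r : K → S) (G : K → Gate d) (q q' : Four (S → Fin d)) :
    replicate (pairMat l r G) q q' = ∏ k, replicate (G k) (fourAt l r q k) (fourAt l r q' k) := by
  simp only [replicate_apply, pairMat, Matrix.of_apply, star_prod, ← Finset.prod_mul_distrib]
  rfl

theorem patternVec_vecMul_pairMat [Fintype K] [DecidableEq K] [Fintype S] [DecidableEq S]
    {l r : K → S} (h : IsPairing l r) (σ : S → Bool) (G : K → Gate d) (q' : Four (S → Fin d)) :
    Matrix.vecMul (patternVec σ) (replicate (pairMat l r G)) q' =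
      ∏ k, Matrix.vecMul (pairVec (σ (l k), σ (r k))) (replicate (G k)) (fourAt l r q' k) := by
  simp only [Matrix.vecMul, dotProduct, patternVec_eq_prod h, replicate_pairMat,
    ← Finset.prod_mul_distrib]
  exact sum_prod_fourAt h fun k p => pairVec (σ (l k), σ (r k)) p *
    replicate (G k) p (fourAt l r q' k)

/-- The action of a layer of averaged gates on functions of patterns. -/
def layerWeight [Fintype K] [Fintype S] [DecidableEq S] (W : Bool × Bool → Bool × Bool → ℝ)
    (l r : K → S) (F : (S → Bool) → ℂ) (σ : S → Bool) : ℂ :=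
  ∑ τ : S → Bool, (∏ k, (W (σ (l k), σ (r k)) (τ (l k), τ (r k)) : ℂ)) * F τ

/-- A layer of noisy gates. -/
def noisyLayer [Fintype K] (U : Gate d) (l r : K → S) (w : K × Fin 4 → UGroup d) :
    Matrix (S → Fin d) (S → Fin d) ℂ :=
  pairMat l r fun k => noisyGate U fun j => w (k, j)

/-- Different gates carry independent noise, so a layer averages gate by gate. -/
theorem integral_prod_curry [Fintype K] (f : K → (Fin 4 → UGroup d) → ℂ) :
    ∫ w : K × Fin 4 → UGroup d, ∏ k, f k (fun j => w (k, j)) ∂(Measure.pi fun _ => haarU d) =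
      ∏ k, ∫ u, f k u ∂(Measure.pi fun _ => haarU d) := by
  have h := Measure.infinitePi_map_curry (ι := K) (κ := Fin 4) (fun _ _ => haarU d)
  simp only [Measure.infinitePi_eq_pi] at h
  have h2 : MeasurePreserving (MeasurableEquiv.curry K (Fin 4) (UGroup d))
      (Measure.pi fun _ => haarU d) (Measure.pi fun _ => Measure.pi fun _ => haarU d) :=
    ⟨(MeasurableEquiv.curry K (Fin 4) (UGroup d)).measurable, h⟩
  rw [← integral_fintype_prod_eq_prod (𝕜 := ℂ)]
  exact h2.integral_comp (MeasurableEquiv.curry K (Fin 4) (UGroup d)).measurableEmbedding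
    fun x => ∏ k, f k (x k)

theorem continuous_noisyLayer [Fintype K] (U : Gate d) (l r : K → S) :
    Continuous (noisyLayer U l r) := by
  refine continuous_pairMat l r fun k => ?_
  have h' := (continuous_noisyGate U).comp
    (continuous_pi fun j : Fin 4 => continuous_apply (A := fun _ : K × Fin 4 => UGroup d) (k, j))
  exact h'

theorem continuous_replicate {X : Type*} : Continuous (replicate (X := X)) := by
  refine continuous_matrix fun q q' => ?_
  simp only [replicate_apply]
  fun_prop

/-- The average of a purity over a layer of noisy gates. -/
theorem integral_purity_noisyLayer [Fintype K] [DecidableEq K] [Fintype S] [DecidableEq S]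
    (hd : 2 ≤ d) {U : Gate d} (hU : IsDualUnitary U) {l r : K → S} (h : IsPairing l r)
    (σ : S → Bool) (ψ : (S → Fin d) → ℂ) :
    ∫ w, purity σ ((noisyLayer U l r w).mulVec ψ) ∂(Measure.pi fun _ => haarU d) =
      layerWeight (gateWeight d (entanglingPower U)) l r (fun τ => purity τ ψ) σ := by
  have h1 : ∀ w, purity σ ((noisyLayer U l r w).mulVec ψ) = ∑ q',
      Matrix.vecMul (patternVec σ) (replicate (noisyLayer U l r w)) q' * fourCopies ψ q' := by
    intro w
    rw [purity_eq_sum, fourCopies_mulVec]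
    exact Matrix.dotProduct_mulVec _ _ _
  have hcont : ∀ q', Continuous fun w =>
      Matrix.vecMul (patternVec σ) (replicate (noisyLayer U l r w)) q' := by
    intro q'
    have hc : Continuous fun w => replicate (noisyLayer U l r w) :=
      continuous_replicate.comp (continuous_noisyLayer U l r)
    exact continuous_finsetSum _ fun q _ => continuous_const.mul (hc.matrix_elem q q')
  simp_rw [h1]
  rw [integral_finsetSum _ fun q' _ => (integrable_of_continuous _ (hcont q')).mul_const _]
  simp_rw [integral_mul_const, noisyLayer, patternVec_vecMul_pairMat h]
  have h2 : ∀ q' : Four (S → Fin d), ∫ w : K × Fin 4 → UGroup d, ∏ k,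
      Matrix.vecMul (pairVec (σ (l k), σ (r k))) (replicate (noisyGate U fun j => w (k, j)))
        (fourAt l r q' k) ∂(Measure.pi fun _ => haarU d) =
      ∑ τ : S → Bool, (∏ k, (gateWeight d (entanglingPower U) (σ (l k), σ (r k))
        (τ (l k), τ (r k)) : ℂ)) * patternVec τ q' := by
    intro q'
    rw [integral_prod_curry fun k u => Matrix.vecMul (pairVec (σ (l k), σ (r k)))
      (replicate (noisyGate U u)) (fourAt l r q' k)]
    simp_rw [integral_pairVec_vecMul_noisyGate hd hU, patternVec_eq_prod h,
      ← Finset.prod_mul_distrib]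
    exact (h.sum_prod fun k τ => (gateWeight d (entanglingPower U) (σ (l k), σ (r k)) τ : ℂ) *
      pairVec τ (fourAt l r q' k)).symm
  simp_rw [h2, layerWeight, purity_eq_sum, Finset.sum_mul, Finset.mul_sum]
  rw [Finset.sum_comm]
  exact Finset.sum_congr rfl fun τ _ => Finset.sum_congr rfl fun q _ => by ring

end Purity

/-! ### Average over the whole circuit -/

/-- Injectivity of the combined map says that the two groups of noise variables are disjoint; the
rest is Fubini. -/
theorem integral_comp_pair {ι κ₁ κ₂ X : Type*} [Fintype ι] [Fintype κ₁] [Fintype κ₂]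
    [MeasurableSpace X] (μ : Measure X) [IsProbabilityMeasure μ] {e₁ : κ₁ → ι} {e₂ : κ₂ → ι}
    (he : Function.Injective (Sum.elim e₁ e₂)) (f : (κ₁ → X) → (κ₂ → X) → ℂ)
    (hf : Integrable (Function.uncurry f)
      ((Measure.pi fun _ => μ).prod (Measure.pi fun _ => μ))) :
    ∫ u, f (u ∘ e₁) (u ∘ e₂) ∂(Measure.pi fun _ => μ) =
      ∫ v, ∫ w, f v w ∂(Measure.pi fun _ => μ) ∂(Measure.pi fun _ => μ) := by
  have h1 := (measurePreserving_sumPiEquivProdPi (X := fun _ : κ₁ ⊕ κ₂ => X) fun _ => μ).comp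
    (measurePreserving_comp_injective μ he)
  have h2 := integral_prod (Function.uncurry f) hf
  rw [← h1.map_eq, integral_map h1.measurable.aemeasurable] at h2
  · exact h2
  · rw [h1.map_eq]
    exact hf.aestronglyMeasurable

theorem continuous_purity {X S : Type*} [TopologicalSpace X] [Fintype S] [DecidableEq S] {d : ℕ}
    (σ : S → Bool) {ψ : X → (S → Fin d) → ℂ} (hψ : Continuous ψ) :
    Continuous fun x => purity σ (ψ x) := by
  have h : ∀ c, Continuous fun x => ψ x c := fun c => (continuous_apply c).comp hψ
  exact continuous_finsetSum _ fun x _ => continuous_finsetSum _ fun z _ =>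
    ((h _).mul (h _).star).mul ((h _).mul (h _).star)

/-- The averaged evolution of purities during one time step. -/
def ringStep (W : Bool × Bool → Bool × Bool → ℝ) (L : ℕ) (F : (Fin (2 * L) → Bool) → ℂ) :
    (Fin (2 * L) → Bool) → ℂ :=
  layerWeight W evenSite oddSite (layerWeight W oddSite nextEvenSite F)

theorem stepOp_eq {d L : ℕ} (U : Gate d) (u : Fin 2 × Fin L × Fin 4 → UGroup d) :
    stepOp U u = noisyLayer U evenSite oddSite (u ∘ Prod.mk 1) *
      noisyLayer U oddSite nextEvenSite (u ∘ Prod.mk 0) := rfl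

theorem integral_purity_stepOp {d L : ℕ} (hd : 2 ≤ d) {U : Gate d} (hU : IsDualUnitary U)
    (σ : Fin (2 * L) → Bool) (ψ : Config d L → ℂ) :
    ∫ u, purity σ ((stepOp U u).mulVec ψ) ∂(Measure.pi fun _ => haarU d) =
      ringStep (gateWeight d (entanglingPower U)) L (fun τ => purity τ ψ) σ := by
  have hinj : Function.Injective (Sum.elim (Prod.mk (0 : Fin 2) : Fin L × Fin 4 → _)
      (Prod.mk (1 : Fin 2))) := by
    rintro (⟨a, b⟩ | ⟨a, b⟩) (⟨a', b'⟩ | ⟨a', b'⟩) h <;> simp_all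
  have hcont : ∀ (τ : Fin (2 * L) → Bool) (φ : Config d L → ℂ), Continuous fun w =>
      purity τ ((noisyLayer U oddSite nextEvenSite w).mulVec φ) := fun τ φ =>
    continuous_purity τ ((continuous_noisyLayer U _ _).matrix_mulVec continuous_const)
  simp_rw [stepOp_eq]
  rw [integral_comp_pair (haarU d) hinj fun v w => purity σ
    ((noisyLayer U evenSite oddSite w * noisyLayer U oddSite nextEvenSite v).mulVec ψ)]
  · simp_rw [← Matrix.mulVec_mulVec, integral_purity_noisyLayer hd hU (isPairing_even_odd L)]
    simp only [ringStep, layerWeight]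
    rw [integral_finsetSum _ fun τ _ => (integrable_of_continuous _ (hcont τ ψ)).const_mul _]
    simp_rw [integral_const_mul,
      integral_purity_noisyLayer hd hU (isPairing_odd_nextEven L), layerWeight]
  · refine integrable_of_continuous _ (continuous_purity σ ?_)
    exact (((continuous_noisyLayer U _ _).comp continuous_snd).mul
      ((continuous_noisyLayer U _ _).comp continuous_fst)).matrix_mulVec continuous_const

/-- Heisenberg picture: the pattern is evolved backwards, so the last time step is the outermost
application of `ringStep`. -/
theorem integral_purity_evolve {d L : ℕ} (hd : 2 ≤ d) {U : Gate d} (hU : IsDualUnitary U)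
    (ψ₀ : Config d L → ℂ) (t : ℕ) (σ : Fin (2 * L) → Bool) :
    ∫ u, purity σ (evolve U ψ₀ t u) ∂(noiseMeasure d L t) =
      (ringStep (gateWeight d (entanglingPower U)) L)^[t] (fun τ => purity τ ψ₀) σ := by
  induction t generalizing σ with
  | zero => simp [evolve]
  | succ t ih =>
    have hinj : Function.Injective (Sum.elim
        (fun i : NoiseLabel L t => ((i.1.castSucc, i.2) : NoiseLabel L (t + 1)))
        (Prod.mk (Fin.last t))) := by
      rintro (⟨a, b⟩ | b) (⟨a', b'⟩ | b') h
      · simpa using h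
      · simp only [Sum.elim_inl, Sum.elim_inr, Prod.mk.injEq] at h
        exact absurd h.1 (Fin.castSucc_lt_last a).ne
      · simp only [Sum.elim_inl, Sum.elim_inr, Prod.mk.injEq] at h
        exact absurd h.1.symm (Fin.castSucc_lt_last a').ne
      · simpa using h
    have hcont : ∀ τ : Fin (2 * L) → Bool, Continuous fun v =>
      purity τ (evolve U ψ₀ t v) := fun τ => continuous_purity τ (continuous_evolve U ψ₀ t)
    -- Average over the last time step at fixed earlier noise; the result is linear in the earlier
    -- purities, to which the induction hypothesis applies.
    have key := integral_comp_pair (haarU d) hinj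
      (fun v w => purity σ ((stepOp U w).mulVec (evolve U ψ₀ t v))) (by
        refine integrable_of_continuous _ (continuous_purity σ ?_)
        have hs : Continuous fun w : Fin 2 × Fin L × Fin 4 → UGroup d => stepOp U w := by
          have h0 := (continuous_noisyLayer U (oddSite (L := L)) nextEvenSite).comp
            (continuous_pi fun i => continuous_apply
              (A := fun _ : Fin 2 × Fin L × Fin 4 => UGroup d) ((0 : Fin 2), i))
          have h1 := (continuous_noisyLayer U (evenSite (L := L)) oddSite).comp
            (continuous_pi fun i => continuous_apply
              (A := fun _ : Fin 2 × Fin L × Fin 4 => UGroup d) ((1 : Fin 2), i))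
          exact h1.mul h0
        exact (hs.comp continuous_snd).matrix_mulVec
          ((continuous_evolve U ψ₀ t).comp continuous_fst))
    have lhs : ∫ u, purity σ (evolve U ψ₀ (t + 1) u) ∂(noiseMeasure d L (t + 1)) = _ := key
    rw [lhs]
    simp_rw [integral_purity_stepOp hd hU]
    rw [Function.iterate_succ_apply']
    simp only [← funext ih]
    simp only [ringStep, layerWeight]
    rw [integral_finsetSum _ fun τ _ => Integrable.const_mul (integrable_finsetSum _ fun τ' _ =>
      (integrable_of_continuous _ (hcont τ')).const_mul _) _]
    refine Finset.sum_congr rfl fun τ _ => ?_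
    rw [integral_const_mul, integral_finsetSum _ fun τ' _ =>
      (integrable_of_continuous _ (hcont τ')).const_mul _]
    simp_rw [integral_const_mul]
    rfl

/-! ### Purities and reduced density matrices -/

theorem purity_eq_trace {d L : ℕ} (A : Finset (Fin (2 * L))) (ψ : Config d L → ℂ) :
    purity (fun s => decide (s ∈ A)) ψ = ((reducedDensity A ψ) ^ 2).trace := by
  have hb : ∀ a b a' b', blend (fun s => decide (s ∈ A)) (glue (d := d) A a b) (glue A a' b') =
      glue A a' b := by
    intro a b a' b'
    funext s
    by_cases hs : s ∈ A <;> simp [blend, glue, hs]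
  rw [purity, sum_config_eq A]
  simp_rw [sum_config_eq A (fun z => _ * (ψ z * _)), hb]
  rw [pow_two]
  simp only [Matrix.trace, Matrix.diag, Matrix.mul_apply, reducedDensity, Matrix.of_apply,
    Finset.sum_mul_sum]
  refine Finset.sum_congr rfl fun a _ => ?_
  rw [Finset.sum_comm]

/-- The only information on the initial purities that the decay estimate needs; it holds for every
pattern, connected or not. -/
theorem norm_purity_le_one {d L : ℕ} (σ : Fin (2 * L) → Bool) {ψ : Config d L → ℂ}
    (hψ : ∑ c, ψ c * star (ψ c) = 1) : ‖purity σ ψ‖ ≤ 1 := by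
  have hσ : σ = fun s => decide (s ∈ Finset.univ.filter fun s => σ s = true) := by
    funext s; simp
  rw [hσ, purity_eq_trace]
  set A := Finset.univ.filter fun s => σ s = true
  have hA := reducedDensity_isHermitian A ψ
  have hpos := eigenvalues_reducedDensity_nonneg A ψ
  have h1 := trace_pow_eq_sum_eigenvalues hA 1
  have h2 := trace_pow_eq_sum_eigenvalues hA 2
  rw [pow_one, trace_reducedDensity, hψ] at h1
  have h3 : ∑ i, hA.eigenvalues i = 1 := by
    have : ((∑ i, hA.eigenvalues i : ℝ) : ℂ) = 1 := by
      rw [h1]; push_cast; simp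
    exact_mod_cast this
  have h4 : ∑ i, hA.eigenvalues i ^ 2 ≤ 1 := by
    calc ∑ i, hA.eigenvalues i ^ 2 ≤ ∑ i, hA.eigenvalues i := by
          refine Finset.sum_le_sum fun i _ => ?_
          have : hA.eigenvalues i ≤ 1 := h3 ▸ Finset.single_le_sum (fun j _ => hpos j)
            (Finset.mem_univ i)
          nlinarith [hpos i]
      _ = 1 := h3
  have h5 : ((reducedDensity A ψ) ^ 2).trace = ((∑ i, hA.eigenvalues i ^ 2 : ℝ) : ℂ) := by
    rw [h2]
  rw [h5, Complex.norm_real, Real.norm_of_nonneg (Finset.sum_nonneg fun i _ => sq_nonneg _)]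
  exact h4

/-! ### Averaged gates acting on words -/

section Words

/-- Averaged gates acting on consecutive pairs of letters of a word. -/
def pairStep (W : Bool × Bool → Bool × Bool → ℝ) : (List Bool → ℂ) → List Bool → ℂ
  | F, x :: y :: w => ∑ τ, (W (x, y) τ : ℂ) * pairStep W (fun w' => F (τ.1 :: τ.2 :: w')) w
  | F, w => F w

variable {W : Bool × Bool → Bool × Bool → ℝ}

theorem pairStep_nil (F : List Bool → ℂ) : pairStep W F [] = F [] := by
  rw [pairStep]; intro x y w h; cases h

theorem pairStep_cons (F : List Bool → ℂ) (x y : Bool) (w : List Bool) :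
    pairStep W F (x :: y :: w) =
      ∑ τ, (W (x, y) τ : ℂ) * pairStep W (fun w' => F (τ.1 :: τ.2 :: w')) w := by
  rw [pairStep]

theorem even_length_cons_cons {x y : Bool} {w : List Bool} :
    Even (x :: y :: w).length ↔ Even w.length := by
  simp [Nat.even_add_one]

/-- Induction on words of even length. -/
theorem even_word_induction {P : ∀ w : List Bool, Even w.length → Prop} (nil : P [] (by simp))
    (cons : ∀ x y w (hw : Even w.length), P w hw → P (x :: y :: w) (even_length_cons_cons.mpr hw)) :
    ∀ w hw, P w hw
  | [], _ => nil
  | [x], h => by simp at h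
  | x :: y :: w, h => cons x y w (even_length_cons_cons.mp h)
      (even_word_induction nil cons w (even_length_cons_cons.mp h))

theorem pairStep_congr {F G : List Bool → ℂ} {w : List Bool} (hw : Even w.length)
    (h : ∀ w', w'.length = w.length → F w' = G w') : pairStep W F w = pairStep W G w := by
  induction w, hw using even_word_induction generalizing F G with
  | nil => simpa only [pairStep_nil] using h [] rfl
  | cons x y w hw ih =>
    simp only [pairStep_cons]
    refine Finset.sum_congr rfl fun τ _ => ?_
    rw [ih fun w' hw' => h (τ.1 :: τ.2 :: w') (by simp [hw'])]

theorem pairStep_sum {I : Type*} (s : Finset I) (c : I → ℂ) (F : I → List Bool → ℂ)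
    {w : List Bool} (hw : Even w.length) :
    pairStep W (fun w' => ∑ i ∈ s, c i * F i w') w = ∑ i ∈ s, c i * pairStep W (F i) w := by
  induction w, hw using even_word_induction generalizing F with
  | nil => simp only [pairStep_nil]
  | cons x y w hw ih =>
    simp only [pairStep_cons, ih, Finset.mul_sum]
    rw [Finset.sum_comm]
    exact Finset.sum_congr rfl fun i _ => Finset.sum_congr rfl fun τ _ => by ring

/-- Gates on disjoint words commute; this is what later separates the two boundaries. -/
theorem pairStep_comm (G : List Bool → List Bool → ℂ) {u v : List Bool} (hu : Even u.length)
    (hv : Even v.length) : pairStep W (fun u' => pairStep W (G u') v) u =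
      pairStep W (fun v' => pairStep W (fun u' => G u' v') u) v := by
  induction u, hu using even_word_induction generalizing G with
  | nil => simp only [pairStep_nil]
  | cons x y u hu ih =>
    simp only [pairStep_cons, ih]
    rw [pairStep_sum _ _ _ hv]

theorem pairStep_append (F : List Bool → ℂ) {u : List Bool} (hu : Even u.length) (v : List Bool) :
    pairStep W F (u ++ v) = pairStep W (fun u' => pairStep W (fun v' => F (u' ++ v')) v) u := by
  induction u, hu using even_word_induction generalizing F with
  | nil => simp only [pairStep_nil, List.nil_append]
  | cons x y u hu ih => simp only [List.cons_append, pairStep_cons, ih]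

/-- Some weights may be negative, so contraction in the supremum norm requires a bound on the
absolute row sums. -/
theorem norm_pairStep_le (hW : ∀ σ, ∑ τ, |W σ τ| ≤ 1) {C : ℝ} {w : List Bool}
    (hw : Even w.length) {F : List Bool → ℂ} (hF : ∀ w', w'.length = w.length → ‖F w'‖ ≤ C) :
    ‖pairStep W F w‖ ≤ C := by
  induction w, hw using even_word_induction generalizing F with
  | nil => simpa only [pairStep_nil] using hF [] rfl
  | cons x y w hw ih =>
    have h : ∀ τ : Bool × Bool, ‖pairStep W (fun w' => F (τ.1 :: τ.2 :: w')) w‖ ≤ C := fun τ =>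
      ih fun w' h' => hF _ (by simp [h'])
    have hC : 0 ≤ C := (norm_nonneg _).trans (h (true, true))
    rw [pairStep_cons]
    calc _ ≤ ∑ τ, |W (x, y) τ| * C := by
          refine norm_sum_le_of_le _ fun τ _ => ?_
          rw [norm_mul, Complex.norm_real, Real.norm_eq_abs]
          exact mul_le_mul_of_nonneg_left (h τ) (abs_nonneg _)
      _ = (∑ τ, |W (x, y) τ|) * C := by rw [Finset.sum_mul]
      _ ≤ C := mul_le_of_le_one_left hC (hW _)

theorem pairStep_map_not (hW : ∀ σ τ : Bool × Bool, W (!σ.1, !σ.2) (!τ.1, !τ.2) = W σ τ)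
    (F : List Bool → ℂ) {w : List Bool} (hw : Even w.length) :
    pairStep W F (w.map not) = pairStep W (fun w' => F (w'.map not)) w := by
  induction w, hw using even_word_induction generalizing F with
  | nil => simp only [pairStep_nil, List.map_nil]
  | cons x y w hw ih =>
    simp only [List.map_cons, pairStep_cons, ih]
    let e : Bool × Bool ≃ Bool × Bool := Equiv.boolNot.prodCongr Equiv.boolNot
    rw [← e.sum_comp]
    refine Finset.sum_congr rfl fun τ _ => ?_
    have h : W (!x, !y) (e τ) = W (x, y) τ := hW (x, y) τ
    rw [h]
    rfl

/-- Pairs of equal letters are left invariant. -/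
def FixesEqual (W : Bool × Bool → Bool × Bool → ℝ) : Prop :=
  ∀ s τ, W (s, s) τ = if τ = (s, s) then 1 else 0

theorem pairStep_same (hW : FixesEqual W) (F : List Bool → ℂ) (s : Bool) (w : List Bool) :
    pairStep W F (s :: s :: w) = pairStep W (fun w' => F (s :: s :: w')) w := by
  rw [pairStep_cons, Finset.sum_eq_single (s, s)]
  · simp [hW s]
  · intro τ _ hτ
    simp [hW s, hτ]
  · simp

theorem pairStep_replicate_append (hW : FixesEqual W) (F : List Bool → ℂ) (s : Bool) {i : ℕ}
    (hi : Even i) (w : List Bool) : pairStep W F (List.replicate i s ++ w) =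
      pairStep W (fun w' => F (List.replicate i s ++ w')) w := by
  obtain ⟨m, rfl⟩ := hi
  induction m generalizing F with
  | zero => simp
  | succ m ih =>
    have h : m + 1 + (m + 1) = m + m + 1 + 1 := by omega
    rw [h]
    simp only [List.replicate_succ, List.cons_append]
    rw [pairStep_same hW, ih]

theorem pairStep_replicate (hW : FixesEqual W) (F : List Bool → ℂ) (s : Bool) {i : ℕ}
    (hi : Even i) : pairStep W F (List.replicate i s) = F (List.replicate i s) := by
  simpa [pairStep_nil] using pairStep_replicate_append hW F s hi []

/-- One layer acting on the window around a boundary between `s` on the left and `!s` on the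
right. -/
def edgeStep (W : Bool × Bool → Bool × Bool → ℝ) (s : Bool) (F : List Bool → ℂ) (w : List Bool) :
    ℂ := pairStep W F (s :: w ++ [!s])

/-- Exchanging the two pairings turns one kind of boundary into the other, so the decay has to be
proved for one kind only. -/
theorem edgeStep_map_not (hW : ∀ σ τ : Bool × Bool, W (!σ.1, !σ.2) (!τ.1, !τ.2) = W σ τ)
    (s : Bool) (F : List Bool → ℂ) {w : List Bool} (hw : Even w.length) :
    edgeStep W (!s) F (w.map not) = edgeStep W s (fun w' => F (w'.map not)) w := by
  rw [edgeStep, edgeStep, ← pairStep_map_not hW]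
  · simp
  · simpa [Nat.even_add_one] using hw

theorem edgeStep_congr {s : Bool} {F G : List Bool → ℂ} {w : List Bool} (hw : Even w.length)
    (h : ∀ w', w'.length = w.length + 2 → F w' = G w') : edgeStep W s F w = edgeStep W s G w :=
  pairStep_congr (by simpa [Nat.even_add_one] using hw) fun w' hw' => h w' (by simp [hw'])

theorem iterate_edgeStep_map_not
    (hW : ∀ σ τ : Bool × Bool, W (!σ.1, !σ.2) (!τ.1, !τ.2) = W σ τ)
    (s : Bool) (F : List Bool → ℂ) (n : ℕ) {w : List Bool} (hw : Even w.length) :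
    (edgeStep W (!s))^[n] F (w.map not) = (edgeStep W s)^[n] (fun w' => F (w'.map not)) w := by
  induction n generalizing w with
  | zero => rfl
  | succ n ih =>
    rw [Function.iterate_succ_apply', Function.iterate_succ_apply', edgeStep_map_not hW s _ hw]
    exact edgeStep_congr hw fun w' hw' => ih (by simpa [hw', Nat.even_add] using hw)

end Words

/-! ### Decay of the contribution of one boundary -/

section Edge

/-- The weight of creating a pair of equal letters. -/
def alphaWeight (d : ℕ) (p : ℝ) : ℝ := d * p / ((d : ℝ) ^ 2 - 1)

/-- The weight of exchanging two different letters. -/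
def gammaWeight (d : ℕ) (p : ℝ) : ℝ := 1 - p - p / ((d : ℝ) ^ 2 - 1)

variable {d : ℕ} {p : ℝ}

theorem gateWeight_fixesEqual : FixesEqual (gateWeight d p) := fun s τ => by
  simp [gateWeight]

theorem gateWeight_not (σ τ : Bool × Bool) :
    gateWeight d p (!σ.1, !σ.2) (!τ.1, !τ.2) = gateWeight d p σ τ := by
  obtain ⟨a, b⟩ := σ
  obtain ⟨c, e⟩ := τ
  cases a <;> cases b <;> cases c <;> cases e <;> simp [gateWeight]

theorem alphaWeight_mul_add (hd : 2 ≤ d) : alphaWeight d p * d + gammaWeight d p = 1 := by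
  have h2 : (2 : ℝ) ≤ d := by exact_mod_cast hd
  have h1 : (d : ℝ) ^ 2 - 1 ≠ 0 := by nlinarith
  rw [alphaWeight, gammaWeight]
  field_simp
  ring

theorem neg_div_eq (hd : 2 ≤ d) : -p / ((d : ℝ) ^ 2 - 1) = -(alphaWeight d p / d) := by
  have h2 : (2 : ℝ) ≤ d := by exact_mod_cast hd
  have h1 : (d : ℝ) ^ 2 - 1 ≠ 0 := by nlinarith
  have h0 : (d : ℝ) ≠ 0 := by positivity
  rw [alphaWeight]
  field_simp

/-- The letter combination `◯ - □ / d`. -/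
def letterA (d : ℕ) (s : Bool) : ℝ := if s then -(1 / d) else 1

/-- The letter combination `□ - ◯ / d`. -/
def letterB (d : ℕ) (s : Bool) : ℝ := if s then 1 else -(1 / d)

/-- The letter combination `α ◯ + γ □`. -/
def letterV (d : ℕ) (p : ℝ) (s : Bool) : ℝ := if s then gammaWeight d p else alphaWeight d p

/-- The letter combination `α □ + γ ◯`. -/
def letterV' (d : ℕ) (p : ℝ) (s : Bool) : ℝ := if s then alphaWeight d p else gammaWeight d p

theorem gateWeight_false_true (hd : 2 ≤ d) (τ : Bool × Bool) : gateWeight d p (false, true) τ =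
    if τ.1 = τ.2 then alphaWeight d p
    else if τ = (false, true) then -(alphaWeight d p / d) else gammaWeight d p := by
  rw [← neg_div_eq hd]
  simp only [gateWeight, Bool.false_eq_true, if_false]
  rfl

/-- $◯□\to\frac1d□□+VA$. The subtraction of $\frac1d□□$ leaves a rank-one remainder because $\alpha
d+\gamma=1$. -/
theorem gateWeight_mixed (hd : 2 ≤ d) (τ : Bool × Bool) : gateWeight d p (false, true) τ =
    (if τ = (true, true) then 1 / (d : ℝ) else 0) + letterV d p τ.1 * letterA d τ.2 := by
  have h := alphaWeight_mul_add (p := p) hd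
  have h0 : (d : ℝ) ≠ 0 := by positivity
  have hg : gammaWeight d p = 1 - alphaWeight d p * d := by linarith
  rw [gateWeight_false_true hd]
  obtain ⟨c, e⟩ := τ
  cases c <;> cases e <;> simp [letterV, letterA, hg] <;> field_simp <;> ring

/-- $A□\to VA$: the $-1/d$ in $A$ cancels the $\frac1d□□$ of a mixed pair, so $A$ moves right
ballistically and leaves $V$ behind. -/
theorem sum_letterA_gateWeight (hd : 2 ≤ d) (τ : Bool × Bool) :
    ∑ y, letterA d y * gateWeight d p (y, true) τ = letterV d p τ.1 * letterA d τ.2 := by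
  rw [Fintype.sum_bool, gateWeight_mixed hd, gateWeight_fixesEqual]
  simp only [letterA, if_true, Bool.false_eq_true, if_false]
  split_ifs <;> ring

/-- $◯B\to BV'$, the mirror image: $B$ moves left and leaves $V'$ behind. -/
theorem sum_letterB_gateWeight (hd : 2 ≤ d) (τ : Bool × Bool) :
    ∑ x, letterB d x * gateWeight d p (false, x) τ = letterB d τ.1 * letterV' d p τ.2 := by
  have h := alphaWeight_mul_add (p := p) hd
  have h0 : (d : ℝ) ≠ 0 := by positivity
  have hg : gammaWeight d p = 1 - alphaWeight d p * d := by linarith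
  rw [Fintype.sum_bool, gateWeight_mixed hd, gateWeight_fixesEqual]
  obtain ⟨c, e⟩ := τ
  cases c <;> cases e <;> simp [-mul_eq_mul_left_iff, letterB, letterV, letterV', letterA, hg] <;>
    field_simp <;> ring

/-- $◯V\to\frac1d◯◯+\gamma BV'$: either the left end is swallowed by the ◯ domain or a left-moving
$B$ is emitted. -/
theorem sum_letterV_gateWeight (hd : 2 ≤ d) (τ : Bool × Bool) :
    ∑ x, letterV d p x * gateWeight d p (false, x) τ =
      (if τ = (false, false) then 1 / (d : ℝ) else 0) +
        gammaWeight d p * (letterB d τ.1 * letterV' d p τ.2) := by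
  have h := alphaWeight_mul_add (p := p) hd
  have h0 : (d : ℝ) ≠ 0 := by positivity
  have hg : gammaWeight d p = 1 - alphaWeight d p * d := by linarith
  rw [Fintype.sum_bool, gateWeight_mixed hd, gateWeight_fixesEqual]
  obtain ⟨c, e⟩ := τ
  cases c <;> cases e <;> simp [-mul_eq_mul_left_iff, letterB, letterV, letterV', letterA, hg] <;>
    field_simp <;> ring

end Edge

/-! ### Recursion and exponential bounds for the window opened at one boundary. -/

section EdgeDecay

variable {d : ℕ} {p : ℝ}

/-- A window with weighted outer letters between constant words. -/
def windowSum (f g : Bool → ℝ) (G : List Bool → ℂ) (i j : ℕ) (w : List Bool) : ℂ :=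
  ∑ x, ∑ y, (f x * g y : ℂ) *
    G (List.replicate i false ++ (x :: w ++ y :: List.replicate j true))

theorem norm_windowSum_le {f g : Bool → ℝ} {G : List Bool → ℂ} {C a b : ℝ} (hf : ∑ x, |f x| ≤ a)
    (hg : ∑ y, |g y| ≤ b) (hG : ∀ w, ‖G w‖ ≤ C) (i j : ℕ) (w : List Bool) :
    ‖windowSum f g G i j w‖ ≤ a * b * C := by
  have hC : 0 ≤ C := (norm_nonneg _).trans (hG [])
  have ha : 0 ≤ a := (Finset.sum_nonneg fun _ _ => abs_nonneg _).trans hf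
  calc _ ≤ ∑ x, ∑ y, |f x| * |g y| * C := by
        refine norm_sum_le_of_le _ fun x _ => norm_sum_le_of_le _ fun y _ => ?_
        rw [norm_mul, norm_mul, Complex.norm_real, Complex.norm_real, Real.norm_eq_abs,
          Real.norm_eq_abs]
        exact mul_le_mul_of_nonneg_left (hG _) (by positivity)
    _ = (∑ x, |f x|) * (∑ y, |g y|) * C := by
        rw [Finset.sum_mul_sum, Finset.sum_mul]
        exact Finset.sum_congr rfl fun x _ => by rw [Finset.sum_mul]
    _ ≤ a * b * C := by
        refine mul_le_mul_of_nonneg_right ?_ hC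
        exact mul_le_mul hf hg (Finset.sum_nonneg fun _ _ => abs_nonneg _) ha

/-- Only the two outermost gates of the window see the weighted letters `f` and `g`; gates inside
the constant words act trivially. -/
theorem windowSum_edgeStep (f g : Bool → ℝ) (G : List Bool → ℂ) {i j : ℕ} (hi : Even i)
    (hj : Even j) {w : List Bool} (hw : Even w.length) :
    windowSum f g (edgeStep (gateWeight d p) false G) i j w =
      pairStep (gateWeight d p) (fun w' => ∑ τ, ∑ ρ,
        ((∑ x, f x * gateWeight d p (false, x) τ : ℝ) : ℂ) *
        ((∑ y, g y * gateWeight d p (y, true) ρ : ℝ) : ℂ) *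
        G (List.replicate i false ++ (τ.1 :: τ.2 :: w' ++ ρ.1 :: ρ.2 :: List.replicate j true)))
        w := by
  have h1 : ∀ x y, edgeStep (gateWeight d p) false G
      (List.replicate i false ++ (x :: w ++ y :: List.replicate j true)) =
      ∑ τ, (gateWeight d p (false, x) τ : ℂ) * pairStep (gateWeight d p) (fun w' =>
        ∑ ρ, (gateWeight d p (y, true) ρ : ℂ) * G (List.replicate i false ++
          (τ.1 :: τ.2 :: w' ++ ρ.1 :: ρ.2 :: List.replicate j true))) w := by
    intro x y
    -- The letter added at each end is moved through the constant word, so that it is paired with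
    -- the weighted letter.
    have hl : false :: (List.replicate i false ++ (x :: w ++ y :: List.replicate j true)) ++ [!false] =
        List.replicate i false ++ (false :: x :: (w ++ (y :: true :: List.replicate j true))) := by
      have e1 : ∀ l : List Bool, false :: (List.replicate i false ++ l) =
          List.replicate i false ++ false :: l := fun l => by
        rw [← List.cons_append, ← List.replicate_succ, List.replicate_succ', List.append_assoc]
        rfl
      have e2 : List.replicate j true ++ [true] = true :: List.replicate j true := by
        rw [← List.replicate_succ', List.replicate_succ]
      simp only [Bool.not_false, List.append_assoc, List.cons_append, e2]
      exact e1 _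
    rw [edgeStep, hl, pairStep_replicate_append gateWeight_fixesEqual _ _ hi, pairStep_cons]
    refine Finset.sum_congr rfl fun τ _ => ?_
    rw [pairStep_append _ hw]
    simp only [pairStep_cons, pairStep_replicate gateWeight_fixesEqual _ _ hj, List.cons_append]
  have h2 : windowSum f g (edgeStep (gateWeight d p) false G) i j w =
      ∑ q : (Bool × Bool) × (Bool × Bool),
        ((f q.1.1 * g q.1.2 : ℂ) * (gateWeight d p (false, q.1.1) q.2 : ℂ)) *
        pairStep (gateWeight d p) (fun w' =>
        ∑ ρ, (gateWeight d p (q.1.2, true) ρ : ℂ) * G (List.replicate i false ++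
          (q.2.1 :: q.2.2 :: w' ++ ρ.1 :: ρ.2 :: List.replicate j true))) w := by
    simp only [windowSum, h1, Fintype.sum_prod_type (α₁ := Bool × Bool),
      Fintype.sum_prod_type (α₁ := Bool) (α₂ := Bool), Finset.mul_sum, mul_assoc]
  rw [h2, ← pairStep_sum _ _ _ hw]
  congr 1
  funext w'
  simp only [Fintype.sum_prod_type (α₁ := Bool × Bool)]
  rw [Finset.sum_comm]
  refine Finset.sum_congr rfl fun τ _ => ?_
  simp only [Finset.mul_sum]
  rw [Finset.sum_comm]
  refine Finset.sum_congr rfl fun ρ _ => ?_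
  push_cast
  rw [Finset.sum_mul_sum, Finset.sum_mul]
  simp only [Fintype.sum_prod_type (α₁ := Bool) (α₂ := Bool), Finset.sum_mul]
  exact Finset.sum_congr rfl fun x _ => Finset.sum_congr rfl fun y _ => by ring

theorem windowSum_letterB_edgeStep (hd : 2 ≤ d) (G : List Bool → ℂ) {i j : ℕ} (hi : Even i)
    (hj : Even j) {w : List Bool} (hw : Even w.length) :
    windowSum (letterB d) (letterA d) (edgeStep (gateWeight d p) false G) i j w =
      pairStep (gateWeight d p) (fun w' => ∑ s, ∑ s', (letterV' d p s * letterV d p s' : ℂ) *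
        windowSum (letterB d) (letterA d) G i j (s :: w' ++ [s'])) w := by
  rw [windowSum_edgeStep _ _ _ hi hj hw]
  congr 1
  funext w'
  simp only [sum_letterB_gateWeight hd, sum_letterA_gateWeight hd, windowSum, Finset.mul_sum,
    Fintype.sum_prod_type, List.cons_append, List.append_assoc, List.nil_append]
  rw [Finset.sum_comm]
  refine Finset.sum_congr rfl fun s _ => ?_
  rw [Finset.sum_comm]
  refine Finset.sum_congr rfl fun s' _ => Finset.sum_congr rfl fun x _ =>
    Finset.sum_congr rfl fun y _ => ?_
  push_cast
  ring

theorem windowSum_letterV_edgeStep (hd : 2 ≤ d) (G : List Bool → ℂ) {i j : ℕ} (hi : Even i)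
    (hj : Even j) :
    windowSum (letterV d p) (letterA d) (edgeStep (gateWeight d p) false G) i j [] =
      (1 / d : ℂ) * windowSum (letterV d p) (letterA d) G (i + 2) j [] +
      (gammaWeight d p : ℂ) * ∑ s, ∑ s', (letterV' d p s * letterV d p s' : ℂ) *
        windowSum (letterB d) (letterA d) G i j [s, s'] := by
  have hrep : ∀ l, List.replicate i false ++ false :: false :: l =
      List.replicate (i + 2) false ++ l := by
    intro l
    rw [List.replicate_add, List.append_assoc]
    rfl
  rw [windowSum_edgeStep _ _ _ hi hj (by simp), pairStep_nil]
  simp only [sum_letterV_gateWeight hd, sum_letterA_gateWeight hd, windowSum, Fintype.sum_prod_type,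
    List.cons_append, List.nil_append, Fintype.sum_bool, ← hrep]
  simp only [Prod.mk.injEq, Bool.true_eq_false, and_false, false_and, and_self,
    if_true, if_false]
  push_cast
  ring

/-- The unsplit boundary either moves left, extending the □ domain by two letters, or splits into
$VA$. -/
theorem edgeStep_replicate (hd : 2 ≤ d) (G : List Bool → ℂ) {j : ℕ} (hj : Even j) :
    edgeStep (gateWeight d p) false G (List.replicate j true) =
      (1 / d : ℂ) * G (List.replicate (j + 2) true) +
        windowSum (letterV d p) (letterA d) G 0 j [] := by
  have hl : false :: List.replicate j true ++ [!false] = false :: true :: List.replicate j true := by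
    rw [Bool.not_false, List.cons_append, ← List.replicate_succ', List.replicate_succ]
  rw [edgeStep, hl, pairStep_cons]
  simp only [pairStep_replicate gateWeight_fixesEqual _ _ hj, gateWeight_mixed hd, windowSum,
    Fintype.sum_prod_type, Fintype.sum_bool, List.replicate_succ, List.replicate_zero,
    List.cons_append, List.nil_append]
  simp only [Prod.mk.injEq, Bool.false_eq_true, and_false, false_and, and_self,
    if_true, if_false]
  push_cast
  ring

variable {F : List Bool → ℂ} {C : ℝ}

theorem norm_double_sum_le {f g : Bool → ℝ} {h : Bool → Bool → ℂ} {a b D : ℝ}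
    (hf : ∑ x, |f x| ≤ a) (hg : ∑ y, |g y| ≤ b) (hD : ∀ x y, ‖h x y‖ ≤ D) :
    ‖∑ x, ∑ y, (f x * g y : ℂ) * h x y‖ ≤ a * b * D := by
  have := norm_windowSum_le (G := fun w => h (w.headD true) (w.getD 1 true)) hf hg
    (fun w => hD _ _) 0 0 []
  simpa [windowSum] using this

/-- Each layer leaves $V'$ and $V$ inside the window between $B$ and $A$, whose absolute weights
contribute $(|\alpha|+|\gamma|)^2\le1/d$; the gates strictly inside contract. -/
theorem norm_windowSum_letterB_iterate_le (hd : 2 ≤ d)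
    (hW : ∀ σ, ∑ τ, |gateWeight d p σ τ| ≤ 1)
    (hc : (|alphaWeight d p| + |gammaWeight d p|) ^ 2 ≤ 1 / d) (hF : ∀ w, ‖F w‖ ≤ C) (n : ℕ)
    {i j : ℕ} (hi : Even i) (hj : Even j) {w : List Bool} (hw : Even w.length) :
    ‖windowSum (letterB d) (letterA d) ((edgeStep (gateWeight d p) false)^[n] F) i j w‖ ≤
      4 * C * (1 / d) ^ n := by
  have hC : 0 ≤ C := (norm_nonneg _).trans (hF [])
  have hd1 : (1 / (d : ℝ)) ≤ 1 := by
    have : (1 : ℝ) ≤ d := by exact_mod_cast (by omega : 1 ≤ d)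
    exact (div_le_one (by positivity)).mpr this
  have hd0 : 0 ≤ 1 / (d : ℝ) := by positivity
  induction n generalizing w with
  | zero =>
    have h1 : ∑ x, |letterB d x| ≤ 2 := by
      rw [Fintype.sum_bool]
      simp only [letterB, if_true, Bool.false_eq_true, if_false, abs_one, abs_neg,
        abs_of_nonneg hd0]
      linarith
    have h2 : ∑ x, |letterA d x| ≤ 2 := by
      rw [Fintype.sum_bool]
      simp only [letterA, if_true, Bool.false_eq_true, if_false, abs_one, abs_neg,
        abs_of_nonneg hd0]
      linarith
    refine (norm_windowSum_le h1 h2 hF i j w).trans_eq ?_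
    ring
  | succ n ih =>
    rw [Function.iterate_succ_apply', windowSum_letterB_edgeStep hd _ hi hj hw]
    refine norm_pairStep_le hW hw fun w' hw' => ?_
    have hv : ∑ s, |letterV' d p s| ≤ |alphaWeight d p| + |gammaWeight d p| := by
      simp [letterV']
    have hv' : ∑ s, |letterV d p s| ≤ |alphaWeight d p| + |gammaWeight d p| := by
      simp [letterV, add_comm]
    refine (norm_double_sum_le hv hv' fun s s' => ih (w := s :: w' ++ [s']) ?_).trans ?_
    · simpa [Nat.even_add_one, hw'] using hw
    · rw [← pow_two, pow_succ _ n]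
      have := mul_le_mul_of_nonneg_right hc (show 0 ≤ 4 * C * (1 / (d : ℝ)) ^ n by positivity)
      linarith

/-- A pair $VA$ moves right at cost $1/d$ until it opens into a window between $B$ and $A$. Summing
over the opening time produces the factor linear in `n`. -/
theorem norm_windowSum_letterV_iterate_le (hd : 2 ≤ d)
    (hW : ∀ σ, ∑ τ, |gateWeight d p σ τ| ≤ 1)
    (hc : (|alphaWeight d p| + |gammaWeight d p|) ^ 2 ≤ 1 / d) (hF : ∀ w, ‖F w‖ ≤ C) (n : ℕ)
    {i j : ℕ} (hi : Even i) (hj : Even j) :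
    ‖windowSum (letterV d p) (letterA d) ((edgeStep (gateWeight d p) false)^[n] F) i j []‖ ≤
      (4 * n + 2) * C * (1 / d) ^ n := by
  have hC : 0 ≤ C := (norm_nonneg _).trans (hF [])
  have hd1 : (1 / (d : ℝ)) ≤ 1 := by
    have : (1 : ℝ) ≤ d := by exact_mod_cast (by omega : 1 ≤ d)
    exact (div_le_one (by positivity)).mpr this
  have hd0 : 0 ≤ 1 / (d : ℝ) := by positivity
  have hc1 : |alphaWeight d p| + |gammaWeight d p| ≤ 1 := by
    have h0 : 0 ≤ |alphaWeight d p| + |gammaWeight d p| := by positivity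
    nlinarith
  have hv : ∑ s, |letterV' d p s| ≤ |alphaWeight d p| + |gammaWeight d p| := by
    simp [letterV']
  have hv' : ∑ s, |letterV d p s| ≤ |alphaWeight d p| + |gammaWeight d p| := by
    simp [letterV, add_comm]
  induction n generalizing i with
  | zero =>
    have h2 : ∑ x, |letterA d x| ≤ 2 := by
      rw [Fintype.sum_bool]
      simp only [letterA, if_true, Bool.false_eq_true, if_false, abs_one, abs_neg,
        abs_of_nonneg hd0]
      linarith
    refine (norm_windowSum_le (hv'.trans hc1) h2 hF i j []).trans_eq ?_
    norm_num
  | succ n ih =>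
    rw [Function.iterate_succ_apply', windowSum_letterV_edgeStep hd _ hi hj]
    have h1 := ih (i := i + 2) (hi.add (by decide))
    have h2 := norm_double_sum_le hv hv' fun s s' =>
      norm_windowSum_letterB_iterate_le hd hW hc hF n hi hj (w := [s, s']) (by simp)
    have hg : |gammaWeight d p| ≤ 1 := by
      have := abs_nonneg (alphaWeight d p)
      linarith
    refine (norm_add_le _ _).trans ?_
    rw [norm_mul, norm_mul, Complex.norm_real, Real.norm_eq_abs]
    have e1 : ‖(1 / d : ℂ)‖ = 1 / (d : ℝ) := by simp
    rw [e1]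
    rw [← pow_two] at h2
    have hB : 0 ≤ 4 * C * (1 / (d : ℝ)) ^ n := by positivity
    have h3 := h2.trans (mul_le_mul_of_nonneg_right hc hB)
    have h4 := mul_le_mul hg h3 (norm_nonneg _) zero_le_one
    have h5 := mul_le_mul_of_nonneg_left h1 hd0
    refine (add_le_add h5 h4).trans_eq ?_
    push_cast
    ring

/-- Exponential decay of the contribution of one boundary. -/
theorem norm_iterate_edgeStep_le (hd : 2 ≤ d)
    (hW : ∀ σ, ∑ τ, |gateWeight d p σ τ| ≤ 1)
    (hc : (|alphaWeight d p| + |gammaWeight d p|) ^ 2 ≤ 1 / d) (hF : ∀ w, ‖F w‖ ≤ C) (n : ℕ) :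
    ‖(edgeStep (gateWeight d p) false)^[n] F []‖ ≤ (1 + 2 * d * n ^ 2) * C * (1 / d) ^ n := by
  have hd0 : 0 ≤ 1 / (d : ℝ) := by positivity
  have hdd : (d : ℝ) * (1 / d) = 1 := mul_one_div_cancel (by positivity)
  -- The recursion extends the word of □ letters, so the estimate is made uniform in its length. The
  -- increments $d(4n+2)$ add up to $2dn^2$.
  suffices h : ∀ j, Even j → ‖(edgeStep (gateWeight d p) false)^[n] F (List.replicate j true)‖ ≤
      (1 + 2 * d * n ^ 2) * C * (1 / d) ^ n from h 0 (by simp)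
  induction n with
  | zero => intro j _; simpa using hF _
  | succ n ih =>
    intro j hj
    rw [Function.iterate_succ_apply', edgeStep_replicate hd _ hj]
    have h1 := mul_le_mul_of_nonneg_left (ih (j + 2) (hj.add (by decide))) hd0
    have h2 := norm_windowSum_letterV_iterate_le hd hW hc hF n (i := 0) (by simp) hj
    refine (norm_add_le _ _).trans ?_
    have e1 : ‖(1 / d : ℂ)‖ = 1 / (d : ℝ) := by simp
    rw [norm_mul, e1]
    refine (add_le_add h1 h2).trans_eq ?_
    push_cast
    rw [pow_succ]
    linear_combination (-(4 * (n : ℝ) + 2) * C * (1 / (d : ℝ)) ^ n) * hdd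

end EdgeDecay

/-! ### Consequences of the condition on the entangling power -/

section Arithmetic

variable {d : ℕ} {p : ℝ}

theorem four_le_and_lambdaOf_lt {χ : ℝ} (hd : 2 ≤ d) (hχ : 1 ≤ χ)
    (h : lambdaOf d p * χ * (((d : ℝ) + 1) / ((d : ℝ) - 1) +
      Real.sqrt (((d : ℝ) + 1) / ((d : ℝ) - 1))) < 1 / (d : ℝ)) :
    4 ≤ d ∧ lambdaOf d p * (2 * d ^ 2) < d - 1 := by
  have h2 : (2 : ℝ) ≤ d := by exact_mod_cast hd
  have hd1 : 0 < (d : ℝ) - 1 := by linarith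
  have hdd : 0 < (d : ℝ) ^ 2 - 1 := by nlinarith
  -- The minimum of $\lambda$, attained at $p=1-1/d^2$; completing the square shows it.
  have hl : 1 / (d : ℝ) ^ 2 ≤ lambdaOf d p := by
    have e : lambdaOf d p - 1 / (d : ℝ) ^ 2 =
        (p * d ^ 2 - (d ^ 2 - 1)) ^ 2 / (d ^ 2 * (d ^ 2 - 1)) := by
      rw [lambdaOf]
      field_simp
      ring
    have : 0 ≤ lambdaOf d p - 1 / (d : ℝ) ^ 2 := e ▸ by positivity
    linarith
  have hl0 : 0 < lambdaOf d p := lt_of_lt_of_le (by positivity) hl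
  have hr : 1 ≤ ((d : ℝ) + 1) / ((d : ℝ) - 1) := by
    rw [le_div_iff₀ hd1]; linarith
  have hs : 1 ≤ Real.sqrt (((d : ℝ) + 1) / ((d : ℝ) - 1)) := Real.one_le_sqrt.mpr hr
  -- Only $\chi\ge1$ and the square root being at least one are retained.
  have h3 : lambdaOf d p * (((d : ℝ) + 1) / ((d : ℝ) - 1) + 1) < 1 / d := by
    refine lt_of_le_of_lt ?_ h
    refine mul_le_mul ?_ (by linarith) (by linarith) (by positivity)
    nlinarith
  have h4 : lambdaOf d p * (2 * d ^ 2) < d - 1 := by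
    have e : ((d : ℝ) + 1) / ((d : ℝ) - 1) + 1 = 2 * d / (d - 1) := by field_simp; ring
    rw [e, lt_div_iff₀ (by linarith)] at h3
    have h5 : lambdaOf d p * (2 * d / (d - 1)) * d * (d - 1) = lambdaOf d p * (2 * d ^ 2) := by
      field_simp
    rw [← h5]
    nlinarith
  refine ⟨?_, h4⟩
  have h6 : 1 / (d : ℝ) ^ 2 * (2 * d ^ 2) = 2 := by field_simp
  -- Since $\lambda\ge1/d^2$, the condition is void for $d\le3$.
  have h7 : (2 : ℝ) < d - 1 := by
    refine lt_of_le_of_lt (h6.symm.trans_le ?_) h4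
    exact mul_le_mul_of_nonneg_right hl (by positivity)
  have h8 : (3 : ℝ) < d := by linarith
  exact_mod_cast h8

theorem sq_weights_le (hd : 4 ≤ d) (h : lambdaOf d p * (2 * d ^ 2) < d - 1) :
    (|alphaWeight d p| + |gammaWeight d p|) ^ 2 ≤ 1 / d := by
  have h4 : (4 : ℝ) ≤ d := by exact_mod_cast hd
  have hd1 : 0 < (d : ℝ) - 1 := by linarith
  have hdd : 0 < (d : ℝ) ^ 2 - 1 := by nlinarith
  have h1 : (|alphaWeight d p| + |gammaWeight d p|) ^ 2 ≤
      2 * (alphaWeight d p ^ 2 + gammaWeight d p ^ 2) := by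
    have := sq_nonneg (|alphaWeight d p| - |gammaWeight d p|)
    have e1 := sq_abs (alphaWeight d p)
    have e2 := sq_abs (gammaWeight d p)
    nlinarith
  -- This identity bounds $\alpha^2+\gamma^2$ by $d\lambda/(d-1)$, which combines with
  -- $(|\alpha|+|\gamma|)^2\le2(\alpha^2+\gamma^2)$.
  have h2 : (d : ℝ) * lambdaOf d p - (d - 1) * (alphaWeight d p ^ 2 + gammaWeight d p ^ 2) =
      (gammaWeight d p + alphaWeight d p) ^ 2 := by
    rw [lambdaOf, alphaWeight, gammaWeight]
    field_simp
    ring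
  have h3 : (d - 1) * (alphaWeight d p ^ 2 + gammaWeight d p ^ 2) ≤ (d : ℝ) * lambdaOf d p := by
    nlinarith [sq_nonneg (gammaWeight d p + alphaWeight d p)]
  rw [le_div_iff₀ (by positivity)]
  have h5 : (2 * (alphaWeight d p ^ 2 + gammaWeight d p ^ 2) * d) * (d - 1) ≤ 1 * (d - 1) := by
    nlinarith
  have h6 := le_of_mul_le_mul_right h5 hd1
  nlinarith

theorem sum_abs_gateWeight_le (hd : 4 ≤ d) (h : lambdaOf d p * (2 * d ^ 2) < d - 1)
    (σ : Bool × Bool) : ∑ τ, |gateWeight d p σ τ| ≤ 1 := by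
  have h4 : (4 : ℝ) ≤ d := by exact_mod_cast hd
  have hd1 : 0 < (d : ℝ) - 1 := by linarith
  have hdd : 0 < (d : ℝ) ^ 2 - 1 := by nlinarith
  have hl1 : (1 - p) ^ 2 ≤ lambdaOf d p := by
    rw [lambdaOf]
    have : 0 ≤ p ^ 2 / ((d : ℝ) ^ 2 - 1) := by positivity
    linarith
  have hl2 : p ^ 2 ≤ lambdaOf d p * (d ^ 2 - 1) := by
    rw [lambdaOf, add_mul, div_mul_cancel₀ _ hdd.ne']
    have : 0 ≤ (1 - p) ^ 2 * ((d : ℝ) ^ 2 - 1) := by positivity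
    linarith
  have hp : 0 ≤ p := by
    by_contra hp
    push Not at hp
    have : 1 ≤ lambdaOf d p := by nlinarith
    nlinarith
  have hα : 0 ≤ alphaWeight d p := by
    rw [alphaWeight]; positivity
  have hq : 0 ≤ p / ((d : ℝ) ^ 2 - 1) := by positivity
  -- The row sum of a mixed pair. For $\gamma\ge0$ it reduces to $2\alpha\le p$, for $\gamma\le0$ to
  -- $p(d+1)\le2(d-1)$.
  have key : 2 * alphaWeight d p + p / ((d : ℝ) ^ 2 - 1) + |gammaWeight d p| ≤ 1 := by
    rcases le_total 0 (gammaWeight d p) with hγ | hγ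
    · rw [abs_of_nonneg hγ, gammaWeight]
      have : 2 * alphaWeight d p ≤ p := by
        rw [alphaWeight, ← mul_div_assoc, div_le_iff₀ hdd]
        have := mul_nonneg hp (show (0 : ℝ) ≤ d ^ 2 - 1 - 2 * d by nlinarith)
        linarith
      linarith
    · rw [abs_of_nonpos hγ]
      have hp2 : p * (d + 1) ≤ 2 * (d - 1) := by
        by_contra hcon
        push Not at hcon
        -- For $d\ge5$ the bound on $(1-p)^2$ suffices. For $d=4$ it is too weak, and
        -- $p^2\le15\lambda<45/32<(6/5)^2$ decides.
        rcases Nat.lt_or_ge d 5 with h5 | h5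
        · have hd4 : d = 4 := by omega
          subst hd4
          norm_num at *
          nlinarith
        · have h5' : (5 : ℝ) ≤ d := by exact_mod_cast h5
          have a1 : (d - 3 : ℝ) ≤ (p - 1) * (d + 1) := by linarith
          have a2 : (d - 3 : ℝ) ^ 2 ≤ ((p - 1) * (d + 1)) ^ 2 :=
            pow_le_pow_left₀ (by linarith) a1 2
          have a3 : (1 - p) ^ 2 * (2 * d ^ 2) ≤ d - 1 :=
            (mul_le_mul_of_nonneg_right hl1 (by positivity)).trans h.le
          have a4 : (d - 3 : ℝ) ^ 2 * (2 * d ^ 2) ≤ (d - 1) * (d + 1) ^ 2 := by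
            have := mul_le_mul_of_nonneg_right a3 (sq_nonneg ((d : ℝ) + 1))
            have := mul_le_mul_of_nonneg_right a2 (show (0 : ℝ) ≤ 2 * d ^ 2 by positivity)
            nlinarith
          -- Expanding around $d=5$ makes the sign of the polynomial visible from its coefficients.
          obtain ⟨e, he⟩ : ∃ e : ℝ, (d : ℝ) = 5 + e := ⟨d - 5, by ring⟩
          have he0 : 0 ≤ e := by linarith
          rw [he] at a4
          have : 0 ≤ e ^ 2 ∧ 0 ≤ e ^ 3 ∧ 0 ≤ e ^ 4 := ⟨by positivity, by positivity, by positivity⟩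
          nlinarith
      have e : 2 * alphaWeight d p + p / ((d : ℝ) ^ 2 - 1) + -gammaWeight d p - 1 =
          (p * (d + 1) - 2 * (d - 1)) / (d - 1) := by
        rw [alphaWeight, gammaWeight]
        have : (d : ℝ) ^ 2 - 1 = (d - 1) * (d + 1) := by ring
        rw [this]
        field_simp
        ring
      have : (p * (d + 1) - 2 * (d - 1)) / (d - 1 : ℝ) ≤ 0 :=
        div_nonpos_of_nonpos_of_nonneg (by linarith) hd1.le
      linarith
  have habs : |-p / ((d : ℝ) ^ 2 - 1)| = p / ((d : ℝ) ^ 2 - 1) := by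
    rw [neg_div, abs_neg, abs_of_nonneg hq]
  rw [← abs_of_nonneg hα] at key
  have hα' : (d : ℝ) * p / ((d : ℝ) ^ 2 - 1) = alphaWeight d p := rfl
  have hγ' : 1 - p - p / ((d : ℝ) ^ 2 - 1) = gammaWeight d p := rfl
  obtain ⟨a, b⟩ := σ
  cases a <;> cases b <;> simp only [Fintype.sum_prod_type, Fintype.sum_bool, gateWeight,
    Prod.mk.injEq, Bool.false_eq_true, Bool.true_eq_false, and_false, false_and, and_self, if_true,
    if_false, habs, abs_one, abs_zero, hα', hγ'] <;> linarith

end Arithmetic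

/-! ### Patterns on the ring as words -/

section Ring

variable {W : Bool × Bool → Bool × Bool → ℝ}

/-- The word made of a sequence of pairs of letters. -/
def pairWord {n : ℕ} (s : Fin n → Bool × Bool) : List Bool :=
  (List.ofFn s).flatMap fun x => [x.1, x.2]

theorem pairWord_cons {n : ℕ} (x : Bool × Bool) (s : Fin n → Bool × Bool) :
    pairWord (Fin.cons x s : Fin (n + 1) → Bool × Bool) = x.1 :: x.2 :: pairWord s := by
  simp [pairWord, List.ofFn_succ]

theorem pairStep_pairWord {n : ℕ} (F : List Bool → ℂ) (s : Fin n → Bool × Bool) :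
    pairStep W F (pairWord s) =
      ∑ τ : Fin n → Bool × Bool, (∏ k, (W (s k) (τ k) : ℂ)) * F (pairWord τ) := by
  induction n generalizing F with
  | zero => simp [pairWord, pairStep_nil]
  | succ n ih =>
    obtain ⟨x, s, rfl⟩ : ∃ x s', s = Fin.cons x s' := ⟨s 0, Fin.tail s, (Fin.cons_self_tail s).symm⟩
    rw [pairWord_cons, pairStep_cons]
    refine Eq.trans ?_ (Equiv.sum_comp (Fin.consEquiv fun _ : Fin (n + 1) => Bool × Bool)
      fun τ => (∏ k, (W ((Fin.cons x s : Fin (n + 1) → Bool × Bool) k) (τ k) : ℂ)) *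
        F (pairWord τ))
    rw [Fintype.sum_prod_type (α₁ := Bool × Bool)]
    refine Finset.sum_congr rfl fun τ _ => ?_
    rw [ih, Finset.mul_sum]
    refine Finset.sum_congr rfl fun τ' _ => ?_
    have hc : pairWord ((Fin.consEquiv fun _ : Fin (n + 1) => Bool × Bool) (τ, τ')) =
        τ.1 :: τ.2 :: pairWord τ' := pairWord_cons τ τ'
    rw [hc]
    simp only [Fin.consEquiv_apply, Fin.prod_univ_succ, Fin.cons_zero, Fin.cons_succ]
    ring

/-- The pattern on `2L` sites described by a word. -/
def toPattern (L : ℕ) (w : List Bool) : Fin (2 * L) → Bool := fun s => w.getD s.val false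

theorem getD_pairWord {n : ℕ} (s : Fin n → Bool × Bool) (k : Fin n) :
    (pairWord s).getD (2 * k.val) false = (s k).1 ∧
      (pairWord s).getD (2 * k.val + 1) false = (s k).2 := by
  induction n with
  | zero => exact k.elim0
  | succ n ih =>
    obtain ⟨x, s, rfl⟩ : ∃ x s', s = Fin.cons x s' := ⟨s 0, Fin.tail s, (Fin.cons_self_tail s).symm⟩
    rw [pairWord_cons]
    refine Fin.cases ?_ (fun k => ?_) k
    · simp
    · simpa [Nat.mul_add] using ih s k

theorem exists_pairWord_eq {L : ℕ} {w : List Bool} (hw : w.length = 2 * L) :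
    ∃ s : Fin L → Bool × Bool, pairWord s = w := by
  induction L generalizing w with
  | zero => exact ⟨Fin.elim0, by simp [List.length_eq_zero_iff.mp hw, pairWord]⟩
  | succ L ih =>
    match w, hw with
    | x :: y :: w, hw =>
      obtain ⟨s, rfl⟩ := ih (w := w) (by simpa [Nat.mul_add] using hw)
      exact ⟨Fin.cons (x, y) s, pairWord_cons _ _⟩

/-- A layer aligned with the pairs of letters of a word. -/
theorem layerWeight_toPattern {L : ℕ} (F : (Fin (2 * L) → Bool) → ℂ) {w : List Bool}
    (hw : w.length = 2 * L) : layerWeight W evenSite oddSite F (toPattern L w) =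
      pairStep W (fun w' => F (toPattern L w')) w := by
  obtain ⟨s, rfl⟩ := exists_pairWord_eq hw
  have h1 : ∀ (s : Fin L → Bool × Bool) (k : Fin L),
      (toPattern L (pairWord s) (evenSite k), toPattern L (pairWord s) (oddSite k)) = s k :=
    fun s k => Prod.ext (getD_pairWord s k).1 (getD_pairWord s k).2
  have h2 : ∀ s : Fin L → Bool × Bool, (pairEquiv (isPairing_even_odd L)).symm s =
      toPattern L (pairWord s) := by
    intro s
    rw [Equiv.symm_apply_eq]
    funext k
    exact (h1 s k).symm
  rw [pairStep_pairWord, layerWeight, ← (pairEquiv (isPairing_even_odd L)).symm.sum_comp]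
  simp only [h2, h1]

theorem layerWeight_relabel {K S : Type*} [Fintype K] [Fintype S] [DecidableEq S] (e : S ≃ S)
    (l r : K → S) (F : (S → Bool) → ℂ) (σ : S → Bool) :
    layerWeight W (e ∘ l) (e ∘ r) F σ = layerWeight W l r (fun τ => F (τ ∘ e.symm)) (σ ∘ e) := by
  rw [layerWeight, layerWeight, ← (e.symm.arrowCongr (Equiv.refl Bool)).symm.sum_comp]
  refine Finset.sum_congr rfl fun τ _ => ?_
  simp [Function.comp_def, Equiv.arrowCongr]

theorem layerWeight_reindex {K S : Type*} [Fintype K] [Fintype S] [DecidableEq S] (f : K ≃ K)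
    (l r : K → S) (F : (S → Bool) → ℂ) :
    layerWeight W (l ∘ f) (r ∘ f) F = layerWeight W l r F := by
  funext σ
  refine Finset.sum_congr rfl fun τ _ => ?_
  congr 1
  exact f.prod_comp fun k => (W (σ (l k), σ (r k)) (τ (l k), τ (r k)) : ℂ)

/-- The cyclic shift by `c`. -/
def cyclicShift (n c : ℕ) : Fin n ≃ Fin n :=
  Equiv.ofBijective (fun s => ⟨(s.val + c) % n, Nat.mod_lt _ s.pos⟩)
    (Finite.injective_iff_bijective.mp fun a b h => by
      have h1 : a.val + c ≡ b.val + c [MOD n] := Fin.ext_iff.mp h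
      have h2 := Nat.ModEq.add_right_cancel' c h1
      exact Fin.ext (Nat.ModEq.eq_of_lt_of_lt h2 a.2 b.2))

theorem cyclicShift_val {n c : ℕ} (s : Fin n) : (cyclicShift n c s).val = (s.val + c) % n := rfl

/-- Rotating by one site aligns the shifted layer with pairs of letters and brings the two ends of
the word together as the final pair. -/
theorem toPattern_comp_cyclicShift {L : ℕ} (x : Bool) {m : List Bool}
    (hm : m.length + 2 = 2 * L) :
    toPattern L (x :: m ++ [x]) ∘ cyclicShift (2 * L) 1 = toPattern L (m ++ [x, x]) := by
  funext s
  have hs := s.2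
  simp only [Function.comp, toPattern, cyclicShift_val]
  by_cases h : s.val + 1 < 2 * L
  · rw [Nat.mod_eq_of_lt h]
    by_cases h' : s.val < m.length
    · simp [List.getD_eq_getElem?_getD, List.getElem?_append_left h']
    · have h'' : s.val = m.length := by omega
      simp [List.getD_eq_getElem?_getD, h'']
  · have h'' : s.val = m.length + 1 := by omega
    rw [h'', hm, Nat.mod_self]
    simp [List.getD_eq_getElem?_getD]

/-- A layer shifted by one site with respect to the pairs of letters of a word. -/
theorem layerWeight_toPattern_shift (hW : FixesEqual W) {L : ℕ} (F : (Fin (2 * L) → Bool) → ℂ)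
    (x : Bool) {m : List Bool} (hm : m.length + 2 = 2 * L) :
    layerWeight W oddSite nextEvenSite F (toPattern L (x :: m ++ [x])) =
      pairStep W (fun m' => F (toPattern L (x :: m' ++ [x]))) m := by
  have hodd : (oddSite : Fin L → Fin (2 * L)) = cyclicShift (2 * L) 1 ∘ evenSite := by
    funext k
    have := k.2
    exact Fin.ext (Nat.mod_eq_of_lt (by rw [oddSite_val]; omega)).symm
  have hnext : (nextEvenSite : Fin L → Fin (2 * L)) = cyclicShift (2 * L) 1 ∘ oddSite := by
    funext k
    exact Fin.ext rfl
  have hme : Even m.length := ⟨L - 1, by omega⟩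
  rw [hnext, hodd, layerWeight_relabel, ← hodd, toPattern_comp_cyclicShift x hm,
    layerWeight_toPattern _ (by simpa using hm), pairStep_append _ hme]
  refine pairStep_congr hme fun m' hm' => ?_
  -- The final pair is the wrap-around gate; it sees two equal letters and does nothing.
  rw [pairStep_same hW, pairStep_nil, ← toPattern_comp_cyclicShift x (by omega)]
  congr 1
  funext s
  simp

/-- The word with a window `u` around the left boundary and a window `v` around the right boundary
of a block. -/
def blockWord (i : ℕ) (u : List Bool) (j : ℕ) (v : List Bool) (k : ℕ) : List Bool :=
  List.replicate i false ++ (u ++ (List.replicate j true ++ (v ++ List.replicate k false)))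

theorem length_blockWord (i : ℕ) (u : List Bool) (j : ℕ) (v : List Bool) (k : ℕ) :
    (blockWord i u j v k).length = i + u.length + j + v.length + k := by
  simp [blockWord]
  ring

/-- One layer acting on the windows around both boundaries. -/
def twoEdgeStep (W : Bool × Bool → Bool × Bool → ℝ) (G : List Bool → List Bool → ℂ)
    (u v : List Bool) : ℂ :=
  edgeStep W false (fun u' => edgeStep W true (G u') v) u

theorem twoEdgeStep_congr {G G' : List Bool → List Bool → ℂ} {u v : List Bool}
    (hu : Even u.length) (hv : Even v.length)
    (h : ∀ u' v', u'.length = u.length + 2 → v'.length = v.length + 2 → G u' v' = G' u' v') :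
    twoEdgeStep W G u v = twoEdgeStep W G' u v :=
  edgeStep_congr hu fun u' hu' => edgeStep_congr hv fun v' hv' => h u' v' hu' hv'

/-- Each layer enlarges both windows by one letter on either side, so it takes one letter from each
outer domain and two from the block. -/
theorem pairStep_blockWord (hW : FixesEqual W) (F : List Bool → ℂ) {i j k : ℕ} {u v : List Bool}
    (hi : Even i) (hj : Even j) (hk : Even k) (hu : Even u.length) (hv : Even v.length) :
    pairStep W F (blockWord (i + 1) u (j + 2) v (k + 1)) =
      twoEdgeStep W (fun u' v' => F (blockWord i u' j v' k)) u v := by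
  have hl : blockWord (i + 1) u (j + 2) v (k + 1) = List.replicate i false ++
      ((false :: u ++ [!false]) ++ (List.replicate j true ++
        ((true :: v ++ [!true]) ++ List.replicate k false))) := by
    have e1 : List.replicate (j + 2) true = true :: (List.replicate j true ++ [true]) := by
      rw [← List.replicate_succ', ← List.replicate_succ]
    simp [blockWord, e1, List.replicate_succ' (n := i), List.replicate_succ (n := k)]
  have h1 : ∀ (s : Bool) (w : List Bool), Even w.length → Even (s :: w ++ [!s]).length := by
    intro s w hw
    simpa [Nat.even_add_one] using hw
  rw [hl, pairStep_replicate_append hW _ _ hi, pairStep_append _ (h1 _ _ hu)]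
  simp only [pairStep_replicate_append hW _ _ hj, pairStep_append _ (h1 _ _ hv),
    pairStep_replicate hW _ _ hk]
  rfl

theorem layerWeight_evenSite_blockWord (hW : FixesEqual W) {L : ℕ} (F : (Fin (2 * L) → Bool) → ℂ)
    {i j k : ℕ} {u v : List Bool} (hi : Even i) (hj : Even j) (hu : Even u.length)
    (hv : Even v.length) (hL : i + u.length + j + v.length + k + 4 = 2 * L) :
    layerWeight W evenSite oddSite F (toPattern L (blockWord (i + 1) u (j + 2) v (k + 1))) =
      twoEdgeStep W (fun u' v' => F (toPattern L (blockWord i u' j v' k))) u v := by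
  have hk : Even k := by
    obtain ⟨a, rfl⟩ := hi
    obtain ⟨b, rfl⟩ := hj
    obtain ⟨c, hc⟩ := hu
    obtain ⟨e, he⟩ := hv
    exact ⟨L - 2 - a - b - c - e, by omega⟩
  rw [layerWeight_toPattern _ (by rw [length_blockWord]; omega),
    pairStep_blockWord hW _ hi hj hk hu hv]

theorem blockWord_succ (i : ℕ) (u : List Bool) (j : ℕ) (v : List Bool) (k : ℕ) :
    blockWord (i + 1) u j v (k + 1) = false :: blockWord i u j v k ++ [false] := by
  simp [blockWord, List.replicate_succ (n := i), List.replicate_succ' (n := k)]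

/-- Positive `k`, like odd `i`, keeps an untouched ◯ at its end of the word; these two letters form
the inert wrap-around gate. -/
theorem layerWeight_oddSite_blockWord (hW : FixesEqual W) {L : ℕ} (F : (Fin (2 * L) → Bool) → ℂ)
    {i j k : ℕ} {u v : List Bool} (hi : Odd i) (hj : Even j) (hu : Even u.length)
    (hv : Even v.length) (hL : i + u.length + j + v.length + k + 4 = 2 * L) (hk0 : 0 < k) :
    layerWeight W oddSite nextEvenSite F (toPattern L (blockWord (i + 1) u (j + 2) v (k + 1))) =
      twoEdgeStep W (fun u' v' => F (toPattern L (blockWord i u' j v' k))) u v := by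
  obtain ⟨a, rfl⟩ := hi
  obtain ⟨k, rfl⟩ : ∃ k', k = k' + 1 := ⟨k - 1, by omega⟩
  have hk : Even k := by
    obtain ⟨b, rfl⟩ := hj
    obtain ⟨c, hc⟩ := hu
    obtain ⟨e, he⟩ := hv
    exact ⟨L - 3 - a - b - c - e, by omega⟩
  rw [blockWord_succ, layerWeight_toPattern_shift hW _ _ (by rw [length_blockWord]; omega),
    pairStep_blockWord hW _ (even_two_mul a) hj hk hu hv]
  simp only [blockWord_succ]

/-- An even layer whose gates do not straddle the boundaries acts trivially. -/
theorem layerWeight_evenSite_blockWord_nil (hW : FixesEqual W) {L : ℕ}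
    (F : (Fin (2 * L) → Bool) → ℂ) {i j k : ℕ} (hi : Even i) (hj : Even j)
    (hL : i + j + k = 2 * L) :
    layerWeight W evenSite oddSite F (toPattern L (blockWord i [] j [] k)) =
      F (toPattern L (blockWord i [] j [] k)) := by
  have hk : Even k := by
    obtain ⟨a, rfl⟩ := hi
    obtain ⟨b, rfl⟩ := hj
    exact ⟨L - a - b, by omega⟩
  rw [layerWeight_toPattern _ (by rw [length_blockWord]; simpa using hL)]
  simp only [blockWord, List.nil_append]
  rw [pairStep_replicate_append hW _ _ hi, pairStep_replicate_append hW _ _ hj,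
    pairStep_replicate hW _ _ hk]

end Ring

/-! ### Factorisation over the two boundaries and iteration on the ring. -/

section Ring

variable {W : Bool × Bool → Bool × Bool → ℝ}

theorem edgeStep_comm (s s' : Bool) (H : List Bool → List Bool → ℂ) {u v : List Bool}
    (hu : Even u.length) (hv : Even v.length) :
    edgeStep W s (fun u' => edgeStep W s' (H u') v) u =
      edgeStep W s' (fun v' => edgeStep W s (fun u' => H u' v') u) v :=
  pairStep_comm H (by simpa [Nat.even_add_one] using hu) (by simpa [Nat.even_add_one] using hv)

theorem edgeStep_iterate_comm (s s' : Bool) (H : List Bool → List Bool → ℂ) (n : ℕ)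
    {u v : List Bool} (hu : Even u.length) (hv : Even v.length) :
    edgeStep W s' (fun v' => (edgeStep W s)^[n] (fun u' => H u' v') u) v =
      (edgeStep W s)^[n] (fun u' => edgeStep W s' (H u') v) u := by
  induction n generalizing u with
  | zero => rfl
  | succ n ih =>
    simp only [Function.iterate_succ_apply']
    rw [← edgeStep_comm s s' (fun u' v' => (edgeStep W s)^[n] (fun u'' => H u'' v') u') hu hv]
    exact edgeStep_congr hu fun u' hu' => ih (by simpa [hu', Nat.even_add] using hu)

/-- The operations at the two boundaries act on disjoint windows and commute, so all steps of one
can be carried out before those of the other. -/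
theorem iterate_twoEdgeStep (G : List Bool → List Bool → ℂ) (n : ℕ) {u v : List Bool}
    (hu : Even u.length) (hv : Even v.length) : (twoEdgeStep W)^[n] G u v =
      (edgeStep W false)^[n] (fun u' => (edgeStep W true)^[n] (G u') v) u := by
  induction n generalizing u v with
  | zero => rfl
  | succ n ih =>
    rw [Function.iterate_succ_apply', Function.iterate_succ_apply']
    refine edgeStep_congr hu fun u' hu' => ?_
    have hu'' : Even u'.length := by simpa [hu', Nat.even_add] using hu
    simp only [Function.iterate_succ_apply']
    rw [← edgeStep_iterate_comm false true _ n hu'' hv]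
    exact edgeStep_congr hv fun v' hv' => ih hu'' (by simpa [hv', Nat.even_add] using hv)

/-- The bound for the right boundary is uniform in the left window and becomes the constant `C` of
the bound for the left boundary; hence the square. -/
theorem norm_iterate_twoEdgeStep_le {d : ℕ} {p : ℝ} (hd : 2 ≤ d)
    (hW : ∀ σ, ∑ τ, |gateWeight d p σ τ| ≤ 1)
    (hc : (|alphaWeight d p| + |gammaWeight d p|) ^ 2 ≤ 1 / d) {G : List Bool → List Bool → ℂ}
    (hG : ∀ u v, ‖G u v‖ ≤ 1) (n : ℕ) : ‖(twoEdgeStep (gateWeight d p))^[n] G [] []‖ ≤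
      ((1 + 2 * d * n ^ 2) * (1 / d) ^ n) ^ 2 := by
  rw [iterate_twoEdgeStep G n (by simp) (by simp)]
  have h1 : ∀ u, ‖(edgeStep (gateWeight d p) true)^[n] (G u) []‖ ≤
      (1 + 2 * d * n ^ 2) * 1 * (1 / d) ^ n := by
    intro u
    have := iterate_edgeStep_map_not (W := gateWeight d p) gateWeight_not false (G u) n
      (w := []) (by simp)
    rw [Bool.not_false, List.map_nil] at this
    rw [this]
    exact norm_iterate_edgeStep_le hd hW hc (fun w => hG _ _) n
  refine (norm_iterate_edgeStep_le hd hW hc h1 n).trans_eq ?_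
  ring

theorem iterate_ringStep_blockWord (hW : FixesEqual W) {L : ℕ} (F : (Fin (2 * L) → Bool) → ℂ)
    (t : ℕ) {i j k : ℕ} {u v : List Bool} (hi : Odd i) (hj : Even j) (hk : 0 < k)
    (hu : Even u.length) (hv : Even v.length)
    (hL : i + u.length + j + v.length + k + 8 * t = 2 * L) :
    (ringStep W L)^[t] F (toPattern L (blockWord (i + 2 * t) u (j + 4 * t) v (k + 2 * t))) =
      (twoEdgeStep W)^[2 * t] (fun u' v' => F (toPattern L (blockWord i u' j v' k))) u v := by
  induction t generalizing u v with
  | zero => rfl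
  | succ t ih =>
    have e1 : blockWord (i + 2 * (t + 1)) u (j + 4 * (t + 1)) v (k + 2 * (t + 1)) =
        blockWord ((i + 2 * t + 1) + 1) u ((j + 4 * t + 2) + 2) v ((k + 2 * t + 1) + 1) := by
      congr 1
    have hi1 : Even (i + 2 * t + 1) := by
      obtain ⟨a, rfl⟩ := hi
      exact ⟨a + t + 1, by ring⟩
    have hi2 : Odd (i + 2 * t) := hi.add_even (even_two_mul t)
    have hj1 : Even (j + 4 * t) := hj.add ⟨2 * t, by ring⟩
    rw [Function.iterate_succ_apply', ringStep, e1,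
      layerWeight_evenSite_blockWord hW _ hi1 (hj1.add (by decide)) hu hv (by omega)]
    have e2 : 2 * (t + 1) = 2 * t + 1 + 1 := by ring
    rw [e2, Function.iterate_succ_apply']
    refine twoEdgeStep_congr hu hv fun u' v' hu' hv' => ?_
    have hu1 : Even u'.length := by simpa [hu', Nat.even_add] using hu
    have hv1 : Even v'.length := by simpa [hv', Nat.even_add] using hv
    rw [layerWeight_oddSite_blockWord hW _ hi2 hj1 hu1 hv1 (by omega) (by omega),
      Function.iterate_succ_apply']
    refine twoEdgeStep_congr hu1 hv1 fun u'' v'' hu'' hv'' => ?_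
    exact ih (by simpa [hu'', Nat.even_add] using hu1) (by simpa [hv'', Nat.even_add] using hv1)
      (by omega)

/-- For this parity the last layer of the circuit has no gate across the boundaries, so `t + 1` time
steps amount to only `2 * t + 1` effective layers. -/
theorem iterate_ringStep_blockWord_succ (hW : FixesEqual W) {L : ℕ}
    (F : (Fin (2 * L) → Bool) → ℂ) (t : ℕ) {i j k : ℕ} (hi : Odd i) (hj : Even j) (hk : 0 < k)
    (hL : i + j + k + 8 * t + 4 = 2 * L) :
    (ringStep W L)^[t + 1] F
        (toPattern L (blockWord (i + 2 * t + 1) [] (j + 4 * t + 2) [] (k + 2 * t + 1))) =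
      (twoEdgeStep W)^[2 * t + 1] (fun u' v' => F (toPattern L (blockWord i u' j v' k))) [] [] := by
  have hj1 : Even (j + 4 * t) := hj.add ⟨2 * t, by ring⟩
  have hi2 : Odd (i + 2 * t) := hi.add_even (even_two_mul t)
  rw [Function.iterate_succ_apply', ringStep, layerWeight_evenSite_blockWord_nil hW _ hi2.add_one
    (hj1.add (by decide)) (by omega), layerWeight_oddSite_blockWord hW _ hi2 hj1 (by simp) (by simp)
    (by simp only [List.length_nil]; omega) (by omega), Function.iterate_succ_apply']
  refine twoEdgeStep_congr (by simp) (by simp) fun u' v' hu' hv' => ?_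
  rw [List.length_nil] at hu' hv'
  exact iterate_ringStep_blockWord hW F t hi hj hk (by simp [hu']) (by simp [hv']) (by omega)

/-- The averaged circuit is invariant under translation by whole cells, although the initial data
`F` need not be. -/
theorem ringStep_cyclicShift {L c : ℕ} (F : (Fin (2 * L) → Bool) → ℂ) (σ : Fin (2 * L) → Bool) :
    ringStep W L F σ = ringStep W L (fun τ => F (τ ∘ (cyclicShift (2 * L) (2 * c)).symm))
      (σ ∘ cyclicShift (2 * L) (2 * c)) := by
  have h1 : evenSite ∘ cyclicShift L c = cyclicShift (2 * L) (2 * c) ∘ evenSite := by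
    funext k
    apply Fin.ext
    simp only [Function.comp, evenSite_val, cyclicShift_val, ← Nat.mul_mod_mul_left]
    congr 1
    ring
  have h2 : oddSite ∘ cyclicShift L c = cyclicShift (2 * L) (2 * c) ∘ oddSite := by
    funext k
    apply Fin.ext
    have hk := k.2
    simp only [Function.comp, oddSite_val, cyclicShift_val]
    rw [show 2 * k.val + 1 + 2 * c = 2 * (k.val + c) + 1 by ring]
    have h3 := Nat.mod_lt (k.val + c) (by omega : 0 < L)
    have h4 := Nat.div_add_mod (k.val + c) L
    set q := (k.val + c) / L
    set r := (k.val + c) % L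
    rw [← h4, show 2 * (L * q + r) + 1 = 2 * r + 1 + 2 * L * q by ring, Nat.add_mul_mod_self_left,
      Nat.mod_eq_of_lt (by omega)]
  have h3 : nextEvenSite ∘ cyclicShift L c = cyclicShift (2 * L) (2 * c) ∘ nextEvenSite := by
    have hnext : (nextEvenSite : Fin L → Fin (2 * L)) = cyclicShift (2 * L) 1 ∘ oddSite := by
      funext k
      exact Fin.ext rfl
    rw [hnext, Function.comp_assoc, h2]
    funext k
    apply Fin.ext
    simp only [Function.comp, cyclicShift_val, Nat.mod_add_mod]
    congr 1
    ring
  rw [ringStep, ← layerWeight_reindex (cyclicShift L c) evenSite oddSite, h1, h2,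
    layerWeight_relabel, ringStep]
  congr 1
  funext τ
  rw [← layerWeight_reindex (cyclicShift L c) oddSite nextEvenSite, h2, h3, layerWeight_relabel]
  congr 1
  funext s
  simp

theorem iterate_ringStep_cyclicShift {L c : ℕ} (F : (Fin (2 * L) → Bool) → ℂ) (t : ℕ)
    (σ : Fin (2 * L) → Bool) : (ringStep W L)^[t] F σ =
      (ringStep W L)^[t] (fun τ => F (τ ∘ (cyclicShift (2 * L) (2 * c)).symm))
      (σ ∘ cyclicShift (2 * L) (2 * c)) := by
  induction t generalizing σ with
  | zero =>
    simp only [Function.iterate_zero, id]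
    congr 1
    funext s
    simp
  | succ t ih =>
    rw [Function.iterate_succ_apply', Function.iterate_succ_apply', ringStep_cyclicShift (c := c)]
    congr 1
    funext τ
    have hτ : (τ ∘ (cyclicShift (2 * L) (2 * c)).symm) ∘ cyclicShift (2 * L) (2 * c) = τ := by
      funext s
      simp
    rw [ih, hτ]

theorem block_comp_cyclicShift {L x₁ LA m : ℕ} (h : x₁ + 2 * m + 2 * LA ≤ 2 * L) :
    (fun s => decide (s ∈ block L x₁ LA)) ∘ cyclicShift (2 * L) (2 * (L - m)) =
      toPattern L (blockWord (x₁ + 2 * m) [] (2 * LA) [] (2 * L - (x₁ + 2 * m + 2 * LA))) := by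
  funext s
  have hs := s.2
  have hlen : (blockWord (x₁ + 2 * m) [] (2 * LA) [] (2 * L - (x₁ + 2 * m + 2 * LA))).length =
      2 * L := by
    rw [length_blockWord]
    simp only [List.length_nil]
    omega
  have h1 : (s.val + 2 * (L - m)) % (2 * L) =
      if 2 * m ≤ s.val then s.val - 2 * m else s.val + 2 * L - 2 * m := by
    split_ifs with hm
    · rw [show s.val + 2 * (L - m) = s.val - 2 * m + 2 * L by omega, Nat.add_mod_right,
        Nat.mod_eq_of_lt (by omega)]
    · rw [Nat.mod_eq_of_lt (by omega)]
      omega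
  have h2 : (cyclicShift (2 * L) (2 * (L - m)) s ∈ block L x₁ LA) ↔
      x₁ + 2 * m ≤ s.val ∧ s.val < x₁ + 2 * m + 2 * LA := by
    rw [mem_block, cyclicShift_val, h1]
    split_ifs <;> omega
  simp only [Function.comp, h2, toPattern, blockWord, List.nil_append, List.getD_eq_getElem?_getD,
    List.getElem?_append, List.getElem?_replicate, List.length_replicate]
  split_ifs <;> simp <;> omega

end Ring

/-- The averaged purity of a long block after `t` time steps. -/
theorem norm_integral_purity_block_le {d L x₁ LA t : ℕ} (hd : 2 ≤ d) {U : Gate d}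
    (hU : IsDualUnitary U)
    (hW : ∀ σ, ∑ τ, |gateWeight d (entanglingPower U) σ τ| ≤ 1)
    (hc : (|alphaWeight d (entanglingPower U)| + |gammaWeight d (entanglingPower U)|) ^ 2 ≤ 1 / d)
    {ψ₀ : Config d L → ℂ} (hψ : ∑ c, ψ₀ c * star (ψ₀ c) = 1) (hLA : 2 * t + 2 ≤ LA)
    (hL : x₁ + 2 * LA + 6 * t + 8 ≤ 2 * L) :
    ‖∫ u, purity (fun s => decide (s ∈ block L x₁ LA)) (evolve U ψ₀ (t + 1) u)
        ∂(noiseMeasure d L (t + 1))‖ ≤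
      ((1 + 2 * d * (2 * t + 2) ^ 2) * (1 / d) ^ (2 * t + 1)) ^ 2 := by
  rw [integral_purity_evolve hd hU]
  set p := entanglingPower U
  have hd1 : (1 / (d : ℝ)) ≤ 1 := by
    have : (1 : ℝ) ≤ d := by exact_mod_cast (by omega : 1 ≤ d)
    exact (div_le_one (by positivity)).mpr this
  have hd0 : 0 ≤ 1 / (d : ℝ) := by positivity
  -- The block is moved right by `t + 1` cells, so that the left light cone does not reach the end
  -- of the word.
  rw [iterate_ringStep_cyclicShift (c := L - (t + 1)),
    block_comp_cyclicShift (m := t + 1) (by omega)]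
  obtain ⟨F, hF1, hFdef⟩ : ∃ F : (Fin (2 * L) → Bool) → ℂ, (∀ τ, ‖F τ‖ ≤ 1) ∧
      (fun τ => (fun τ => purity τ ψ₀) (τ ∘ (cyclicShift (2 * L) (2 * (L - (t + 1)))).symm)) = F :=
    ⟨_, fun τ => norm_purity_le_one _ hψ, rfl⟩
  rw [hFdef]
  -- The parity of the first site decides whether `2 * t + 1` or `2 * t + 2` layers are effective;
  -- the weaker bound is used for both.
  rcases Nat.even_or_odd x₁ with hx | hx
  · have e : blockWord (x₁ + 2 * (t + 1)) [] (2 * LA) [] (2 * L - (x₁ + 2 * (t + 1) + 2 * LA)) =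
        blockWord (x₁ + 1 + 2 * t + 1) [] (2 * LA - 4 * t - 2 + 4 * t + 2) []
          (2 * L - (x₁ + 2 * (t + 1) + 2 * LA) - 2 * t - 1 + 2 * t + 1) := by
      congr 1 <;> omega
    rw [e, iterate_ringStep_blockWord_succ gateWeight_fixesEqual F t hx.add_one
      ⟨LA - 2 * t - 1, by omega⟩ (by omega) (by omega)]
    refine (norm_iterate_twoEdgeStep_le hd hW hc (fun u v => hF1 _) _).trans ?_
    gcongr
    push_cast
    linarith
  · have e : blockWord (x₁ + 2 * (t + 1)) [] (2 * LA) [] (2 * L - (x₁ + 2 * (t + 1) + 2 * LA)) =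
        blockWord (x₁ + 2 * (t + 1)) [] (2 * LA - 4 * (t + 1) + 4 * (t + 1)) []
          (2 * L - (x₁ + 2 * (t + 1) + 2 * LA) - 2 * (t + 1) + 2 * (t + 1)) := by
      congr 1 <;> omega
    rw [e, iterate_ringStep_blockWord gateWeight_fixesEqual F (t + 1) hx
      ⟨LA - 2 * t - 2, by omega⟩ (by omega) (by simp) (by simp)
      (by simp only [List.length_nil]; omega)]
    refine (norm_iterate_twoEdgeStep_le hd hW hc (fun u v => hF1 _) _).trans ?_
    have h1 : (1 / (d : ℝ)) ^ (2 * (t + 1)) ≤ (1 / d) ^ (2 * t + 1) :=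
      pow_le_pow_of_le_one hd0 hd1 (by omega)
    have h2 : (((2 * (t + 1) : ℕ) : ℝ)) = 2 * t + 2 := by push_cast; ring
    rw [h2]
    gcongr

/-! ### Growth of the Schmidt rank -/

section SchmidtRank

theorem rank_add_le {m n : Type*} [Fintype m] [Fintype n] (A B : Matrix m n ℂ) :
    (A + B).rank ≤ A.rank + B.rank := by
  simp only [Matrix.rank]
  have h : LinearMap.range (A + B).mulVecLin ≤
      LinearMap.range A.mulVecLin ⊔ LinearMap.range B.mulVecLin := by
    rintro _ ⟨v, rfl⟩
    rw [Matrix.mulVecLin_add]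
    exact Submodule.add_mem_sup ⟨v, rfl⟩ ⟨v, rfl⟩
  exact (Submodule.finrank_mono h).trans (Submodule.finrank_add_le_finrank_add_finrank _ _)

theorem rank_sum_le {m n I : Type*} [Fintype m] [Fintype n] (s : Finset I)
    (A : I → Matrix m n ℂ) : (∑ i ∈ s, A i).rank ≤ ∑ i ∈ s, (A i).rank :=
  Finset.le_sum_of_subadditive _ Matrix.rank_zero.le rank_add_le _ _

variable {d L : ℕ} (A : Finset (Fin (2 * L)))

/-- The Schmidt rank of a state with respect to the bipartition `A`, `Aᶜ`. -/
def schmidtRank (ψ : Config d L → ℂ) : ℕ := (amplitudeMatrix A ψ).rank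

theorem schmidtRank_sum_le {I : Type*} (s : Finset I) (ψ : I → Config d L → ℂ) :
    schmidtRank A (∑ i ∈ s, ψ i) ≤ ∑ i ∈ s, schmidtRank A (ψ i) := by
  have h : amplitudeMatrix A (∑ i ∈ s, ψ i) = ∑ i ∈ s, amplitudeMatrix A (ψ i) := by
    ext a b
    simp [amplitudeMatrix, Matrix.sum_apply]
  rw [schmidtRank, h]
  exact rank_sum_le _ _

theorem entanglementEntropy_le_log_schmidtRank {ψ : Config d L → ℂ}
    (hψ : ∑ c, ψ c * star (ψ c) = 1) {N : ℝ} (hN : 0 < N) (h : (schmidtRank A ψ : ℝ) ≤ N) :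
    entanglementEntropy A ψ ≤ Real.log N := by
  have h1 : (reducedDensity A ψ).rank ≤ schmidtRank A ψ := by
    rw [reducedDensity_eq_mul]
    exact Matrix.rank_mul_le_left _ _
  have h2 : ((reducedDensity A ψ).rank : ℝ) ≤ N := le_trans (Nat.cast_le.mpr h1) h
  exact sum_negMulLog_le_log (reducedDensity_isHermitian A ψ)
    (eigenvalues_reducedDensity_nonneg A ψ) ((trace_reducedDensity A ψ).trans hψ) hN h2

/-- Operators whose matrix elements factorise over the bipartition. -/
def Factorizes (M : Config d L → Config d L → ℂ) : Prop :=
  ∃ (P : ({s // s ∈ A} → Fin d) → ({s // s ∈ A} → Fin d) → ℂ)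
    (Q : ({s // s ∉ A} → Fin d) → ({s // s ∉ A} → Fin d) → ℂ),
    ∀ a b a' b', M (glue A a b) (glue A a' b') = P a a' * Q b b'

variable {A}

theorem Factorizes.prod {K : Type*} (s : Finset K) {M : K → Config d L → Config d L → ℂ}
    (h : ∀ k ∈ s, Factorizes A (M k)) : Factorizes A fun c c' => ∏ k ∈ s, M k c c' := by
  classical
  choose! P Q hPQ using h
  refine ⟨fun a a' => ∏ k ∈ s, P k a a', fun b b' => ∏ k ∈ s, Q k b b', fun a b a' b' => ?_⟩
  rw [← Finset.prod_mul_distrib]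
  exact Finset.prod_congr rfl fun k hk => hPQ k hk a b a' b'

theorem Factorizes.schmidtRank_le {M : Matrix (Config d L) (Config d L) ℂ} (h : Factorizes A M)
    (ψ : Config d L → ℂ) : schmidtRank A (M.mulVec ψ) ≤ schmidtRank A ψ := by
  obtain ⟨P, Q, hPQ⟩ := h
  have hM : amplitudeMatrix A (M.mulVec ψ) =
      Matrix.of P * amplitudeMatrix A ψ * (Matrix.of Q).transpose := by
    ext a b
    simp only [amplitudeMatrix, Matrix.of_apply, Matrix.mulVec, dotProduct, Matrix.mul_apply,
      Matrix.transpose_apply, Finset.sum_mul]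
    rw [sum_config_eq A, Finset.sum_comm]
    refine Finset.sum_congr rfl fun b' _ => Finset.sum_congr rfl fun a' _ => ?_
    rw [hPQ]
    ring
  rw [schmidtRank, hM]
  exact (Matrix.rank_mul_le_left _ _).trans (Matrix.rank_mul_le_right _ _)

theorem factorizes_left (s : Fin (2 * L)) (X : Matrix (Fin d) (Fin d) ℂ) :
    Factorizes A fun c c' => X (c s) (c' s) := by
  by_cases hs : s ∈ A
  · exact ⟨fun a a' => X (a ⟨s, hs⟩) (a' ⟨s, hs⟩), fun _ _ => 1, fun a b a' b' => by
      simp [glue, hs]⟩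
  · exact ⟨fun _ _ => 1, fun b b' => X (b ⟨s, hs⟩) (b' ⟨s, hs⟩), fun a b a' b' => by
      simp [glue, hs]⟩

theorem factorizes_gate {s s' : Fin (2 * L)} (h : s ∈ A ↔ s' ∈ A) (Y : Gate d) :
    Factorizes A fun c c' => Y (c s, c s') (c' s, c' s') := by
  by_cases hs : s ∈ A
  · have hs' := h.mp hs
    exact ⟨fun a a' => Y (a ⟨s, hs⟩, a ⟨s', hs'⟩) (a' ⟨s, hs⟩, a' ⟨s', hs'⟩), fun _ _ => 1,
      fun a b a' b' => by simp [glue, hs, hs']⟩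
  · have hs' : s' ∉ A := fun h' => hs (h.mpr h')
    exact ⟨fun _ _ => 1, fun b b' => Y (b ⟨s, hs⟩, b ⟨s', hs'⟩) (b' ⟨s, hs⟩, b' ⟨s', hs'⟩),
      fun a b a' b' => by simp [glue, hs, hs']⟩

theorem factorizes_kronecker (s s' : Fin (2 * L)) (X Y : Matrix (Fin d) (Fin d) ℂ) :
    Factorizes A fun c c' => (X ⊗ₖ Y) (c s, c s') (c' s, c' s') := by
  obtain ⟨P, Q, h⟩ := factorizes_left (A := A) s X
  obtain ⟨P', Q', h'⟩ := factorizes_left (A := A) s' Y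
  refine ⟨fun a a' => P a a' * P' a a', fun b b' => Q b b' * Q' b b', fun a b a' b' => ?_⟩
  have h1 : X (glue A a b s) (glue A a' b' s) = _ := h a b a' b'
  have h2 : Y (glue A a b s') (glue A a' b' s') = _ := h' a b a' b'
  change X (glue A a b s) (glue A a' b' s) * Y (glue A a b s') (glue A a' b' s') =
    P a a' * P' a a' * (Q b b' * Q' b b')
  rw [h1, h2]
  ring

theorem gate_eq_sum_kronecker (Y : Gate d) : Y = ∑ e : Fin d × Fin d, (1 : ℂ) •
    (Matrix.single e.1 e.2 (1 : ℂ) ⊗ₖ Matrix.of fun b b' => Y (e.1, b) (e.2, b')) := by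
  ext ⟨a, b⟩ ⟨a', b'⟩
  rw [Matrix.sum_apply, Finset.sum_eq_single (a, a')]
  · simp [Matrix.kroneckerMap_apply]
  · rintro ⟨i, j⟩ _ hne
    have : ¬ (i = a ∧ j = a') := fun h => hne (Prod.ext h.1 h.2)
    simp [Matrix.kroneckerMap_apply, this]
  · simp

/-- Each gate straddling the boundary multiplies the Schmidt rank by at most `d²`. -/
theorem schmidtRank_pairMat_le {K : Type*} [Fintype K] [DecidableEq K] {l r : K → Fin (2 * L)}
    (T : Finset K) (G : K → Gate d) (ψ : Config d L → ℂ)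
    (hT : ∀ k, k ∉ T → (l k ∈ A ↔ r k ∈ A) ∨ ∃ X Y, G k = X ⊗ₖ Y) :
    schmidtRank A ((pairMat l r G).mulVec ψ) ≤ (d ^ 2) ^ T.card * schmidtRank A ψ := by
  induction T using Finset.induction_on generalizing G with
  | empty =>
    rw [Finset.card_empty, pow_zero, one_mul]
    refine Factorizes.schmidtRank_le (M := pairMat l r G) ?_ ψ
    refine Factorizes.prod Finset.univ fun k _ => ?_
    rcases hT k (Finset.notMem_empty k) with h | ⟨X, Y, h⟩
    · exact factorizes_gate h _
    · rw [h]
      exact factorizes_kronecker _ _ X Y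
  | insert k T hk ih =>
    have h1 := pairMat_update_sum l r G k Finset.univ (fun _ : Fin d × Fin d => 1)
      fun e => Matrix.single e.1 e.2 (1 : ℂ) ⊗ₖ Matrix.of fun b b' => G k (e.1, b) (e.2, b')
    rw [← gate_eq_sum_kronecker, Function.update_eq_self] at h1
    simp only [one_smul] at h1
    rw [h1, Matrix.sum_mulVec]
    refine (schmidtRank_sum_le A _ _).trans ?_
    have h2 : ∀ e : Fin d × Fin d, schmidtRank A ((pairMat l r (Function.update G k
        (Matrix.single e.1 e.2 (1 : ℂ) ⊗ₖ Matrix.of fun b b' => G k (e.1, b) (e.2, b')))).mulVec ψ)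
        ≤ (d ^ 2) ^ T.card * schmidtRank A ψ := by
      intro e
      refine ih _ fun k' hk' => ?_
      by_cases hkk : k' = k
      · subst hkk
        exact Or.inr ⟨_, _, Function.update_self ..⟩
      · rw [Function.update_of_ne hkk]
        exact hT k' (by simp [hkk, hk'])
    refine (Finset.sum_le_sum fun e _ => h2 e).trans_eq ?_
    rw [Finset.sum_const, Finset.card_insert_of_notMem hk, Finset.card_univ, Fintype.card_prod,
      Fintype.card_fin, smul_eq_mul]
    ring

theorem card_le_two_of_val {K : Type*} {T : Finset K} {r : K → Fin (2 * L)}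
    (hr : Function.Injective r) {a b : ℕ} (h : ∀ k ∈ T, (r k).val = a ∨ (r k).val = b) :
    T.card ≤ 2 := by
  have h1 : T.card ≤ ({a, b} : Finset ℕ).card := by
    refine Finset.card_le_card_of_injOn (fun k => (r k).val) (fun k hk => ?_) fun k _ k' _ h' =>
      hr (Fin.ext h')
    simpa using h k hk
  exact h1.trans Finset.card_le_two

/-- Since the block has even length, its two ends are cut by gates of the same layer: at most two
gates per time step, each worth $d^2$. -/
theorem schmidtRank_stepOp_le {x₁ LA : ℕ} (hd : 1 ≤ d) (hLA : x₁ + 2 * LA < 2 * L) (U : Gate d)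
    (u : Fin 2 × Fin L × Fin 4 → UGroup d) (ψ : Config d L → ℂ) :
    schmidtRank (block L x₁ LA) ((stepOp U u).mulVec ψ) ≤
      d ^ 4 * schmidtRank (block L x₁ LA) ψ := by
  set A := block L x₁ LA
  let T₂ : Finset (Fin L) := Finset.univ.filter fun k => ¬ (evenSite k ∈ A ↔ oddSite k ∈ A)
  let T₁ : Finset (Fin L) := Finset.univ.filter fun k => ¬ (oddSite k ∈ A ↔ nextEvenSite k ∈ A)
  -- A gate across a boundary is identified by its right site, the first site of the block or the
  -- first one after it.
  have hT₂ : ∀ k ∈ T₂, (oddSite k).val = x₁ ∨ (oddSite k).val = x₁ + 2 * LA := by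
    intro k hk
    have := (Finset.mem_filter.mp hk).2
    rw [mem_block, mem_block, evenSite_val, oddSite_val] at this
    rw [oddSite_val]
    omega
  have hT₁ : ∀ k ∈ T₁, (nextEvenSite k).val = x₁ ∨ (nextEvenSite k).val = x₁ + 2 * LA := by
    intro k hk
    have := (Finset.mem_filter.mp hk).2
    have hk' := k.2
    rw [mem_block, mem_block, nextEvenSite_val, oddSite_val] at this
    rw [nextEvenSite_val]
    split_ifs at * <;> omega
  have hcard : T₂.card + T₁.card ≤ 2 := by
    rcases Nat.even_or_odd x₁ with ⟨a, ha⟩ | ⟨a, ha⟩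
    · have : T₂ = ∅ := by
        refine Finset.eq_empty_of_forall_notMem fun k hk => ?_
        have := hT₂ k hk
        rw [oddSite_val] at this
        omega
      rw [this, Finset.card_empty, zero_add]
      exact card_le_two_of_val (isPairing_odd_nextEven L).right_injective hT₁
    · have : T₁ = ∅ := by
        refine Finset.eq_empty_of_forall_notMem fun k hk => ?_
        have := hT₁ k hk
        rw [nextEvenSite_val] at this
        split_ifs at this <;> omega
      rw [this, Finset.card_empty, add_zero]
      exact card_le_two_of_val (isPairing_even_odd L).right_injective hT₂
  have h1 := schmidtRank_pairMat_le (A := A) T₁ (fun k => noisyGate U fun j => u (0, k, j)) ψ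
    (l := oddSite) (r := nextEvenSite) fun k hk => Or.inl (by simpa [T₁] using hk)
  have h2 := schmidtRank_pairMat_le (A := A) T₂ (fun k => noisyGate U fun j => u (1, k, j))
    ((pairMat oddSite nextEvenSite fun k => noisyGate U fun j => u (0, k, j)).mulVec ψ)
    (l := evenSite) (r := oddSite) fun k hk => Or.inl (by simpa [T₂] using hk)
  rw [Matrix.mulVec_mulVec] at h2
  refine (h2.trans (Nat.mul_le_mul_left _ h1)).trans ?_
  rw [← mul_assoc, ← pow_add, ← pow_mul]
  exact Nat.mul_le_mul_right _ (Nat.pow_le_pow_right hd (by omega))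

theorem schmidtRank_evolve_le {x₁ LA : ℕ} (hd : 1 ≤ d) (hLA : x₁ + 2 * LA < 2 * L) (U : Gate d)
    (ψ₀ : Config d L → ℂ) (t : ℕ) (u : NoiseLabel L t → UGroup d) :
    schmidtRank (block L x₁ LA) (evolve U ψ₀ t u) ≤
      d ^ (4 * t) * schmidtRank (block L x₁ LA) ψ₀ := by
  induction t with
  | zero => simp [evolve]
  | succ t ih =>
    rw [evolve]
    refine (schmidtRank_stepOp_le hd hLA U _ _).trans ((Nat.mul_le_mul_left _ (ih _)).trans_eq ?_)
    rw [← mul_assoc, ← pow_add]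
    congr 2
    ring

/-! ### Schmidt rank of the initial state -/

/-- Multiplication by `f` increases the Schmidt rank at most by the factor `n`. -/
def MulRankLE (A : Finset (Fin (2 * L))) (n : ℕ) (f : Config d L → ℂ) : Prop :=
  ∀ φ : Config d L → ℂ, schmidtRank A (f * φ) ≤ n * schmidtRank A φ

theorem MulRankLE.mul {n m : ℕ} {f g : Config d L → ℂ} (hf : MulRankLE A n f)
    (hg : MulRankLE A m g) : MulRankLE A (n * m) (f * g) := fun φ => by
  rw [mul_assoc, mul_assoc]
  exact (hf _).trans (Nat.mul_le_mul_left _ (hg φ))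

theorem MulRankLE.sum {I : Type*} (s : Finset I) {n : ℕ} {f : I → Config d L → ℂ}
    (hf : ∀ i ∈ s, MulRankLE A n (f i)) : MulRankLE A (s.card * n) (∑ i ∈ s, f i) := fun φ => by
  rw [Finset.sum_mul]
  refine (schmidtRank_sum_le A _ _).trans ((Finset.sum_le_sum fun i hi => hf i hi φ).trans_eq ?_)
  rw [Finset.sum_const, smul_eq_mul, mul_assoc]

theorem mulRankLE_one_of_left {f : Config d L → ℂ} 
    (h : ∃ g : ({s // s ∈ A} → Fin d) → ℂ, ∀ a b, f (glue A a b) = g a) :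
    MulRankLE A 1 f := fun φ => by
  obtain ⟨g, hg⟩ := h
  have : amplitudeMatrix A (f * φ) = Matrix.diagonal g * amplitudeMatrix A φ := by
    ext a b
    simp [amplitudeMatrix, hg]
  rw [one_mul, schmidtRank, this]
  exact Matrix.rank_mul_le_right _ _

theorem mulRankLE_one_of_right {f : Config d L → ℂ} 
    (h : ∃ g : ({s // s ∉ A} → Fin d) → ℂ, ∀ a b, f (glue A a b) = g b) :
    MulRankLE A 1 f := fun φ => by
  obtain ⟨g, hg⟩ := h
  have : amplitudeMatrix A (f * φ) = amplitudeMatrix A φ * Matrix.diagonal g := by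
    ext a b
    simp [amplitudeMatrix, hg, mul_comm]
  rw [one_mul, schmidtRank, this]
  exact Matrix.rank_mul_le_left _ _

theorem schmidtRank_one_le : schmidtRank A (1 : Config d L → ℂ) ≤ 1 := by
  have : amplitudeMatrix A (1 : Config d L → ℂ) = Matrix.vecMulVec 1 1 := by
    ext a b
    simp [amplitudeMatrix, Matrix.vecMulVec_apply]
  rw [schmidtRank, this]
  exact Matrix.rank_vecMulVec_le _ _

/-- Entrywise version of `MulRankLE` for matrix-valued functions. -/
def MatRankLE {χ : ℕ} (A : Finset (Fin (2 * L))) (n : ℕ)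
    (P : Config d L → Matrix (Fin χ) (Fin χ) ℂ) : Prop :=
  ∀ i j, MulRankLE A n fun c => P c i j

theorem MatRankLE.mul {χ n m : ℕ} {P Q : Config d L → Matrix (Fin χ) (Fin χ) ℂ}
    (hP : MatRankLE A n P) (hQ : MatRankLE A m Q) :
    MatRankLE A (χ * (n * m)) fun c => P c * Q c := fun i j => by
  have h := MulRankLE.sum Finset.univ (f := fun k c => P c i k * Q c k j)
    fun k _ => (hP i k).mul (hQ k j)
  rw [Finset.card_univ, Fintype.card_fin] at h
  convert h using 1
  funext c
  rw [Finset.sum_apply]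
  exact Matrix.mul_apply

theorem mulRankLE_site (s : Fin (2 * L)) (f : Fin d → ℂ) : MulRankLE A 1 fun c => f (c s) := by
  by_cases hs : s ∈ A
  · exact mulRankLE_one_of_left ⟨fun a => f (a ⟨s, hs⟩), fun a b => by simp [glue, hs]⟩
  · exact mulRankLE_one_of_right ⟨fun b => f (b ⟨s, hs⟩), fun a b => by simp [glue, hs]⟩

/-- Conditioning on the value of the first site splits the cell into `d` products of one-site
functions, wherever the cut runs. -/
theorem matRankLE_cell {χ : ℕ} (Z : MPSTensor d χ) (s s' : Fin (2 * L)) :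
    MatRankLE A d fun c => Z (c s) (c s') := fun i j => by
  have h := MulRankLE.sum (A := A) Finset.univ
    (f := fun x c => (if c s = x then 1 else 0) * Z x (c s') i j)
    fun x _ => (mulRankLE_site s fun y => if y = x then 1 else 0).mul
      (mulRankLE_site s' fun y => Z x y i j)
  rw [Finset.card_univ, Fintype.card_fin, mul_one, mul_one] at h
  convert h using 1
  funext c
  rw [Finset.sum_apply]
  simp

/-- The matrix of the cell `k`. -/
def cellMatrix {χ : ℕ} (Z : MPSTensor d χ) (k : ℕ) (c : Config d L) :
    Matrix (Fin χ) (Fin χ) ℂ :=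
  if h : k < L then Z (c (evenSite ⟨k, h⟩)) (c (oddSite ⟨k, h⟩)) else 1

theorem matRankLE_prod {χ : ℕ} (Z : MPSTensor d χ) (l : List ℕ)
    (h : (∀ k ∈ l, ∀ s : Fin (2 * L), s.val / 2 = k → s ∈ A) ∨
      ∀ k ∈ l, ∀ s : Fin (2 * L), s.val / 2 = k → s ∉ A) :
    MatRankLE A 1 fun c => (l.map fun k => cellMatrix Z k c).prod := by
  have hcell : ∀ (c c' : Config d L) (k : ℕ), (∀ s : Fin (2 * L), s.val / 2 = k → c s = c' s) →
      cellMatrix Z k c = cellMatrix Z k c' := by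
    intro c c' k hk
    unfold cellMatrix
    split_ifs with hkL
    · rw [hk _ (by rw [evenSite_val]; exact Nat.mul_div_cancel_left k two_pos),
        hk _ (by rw [oddSite_val]; exact (by omega : (2 * k + 1) / 2 = k))]
    · rfl
  have hl : ∀ c c' : Config d L, (∀ k ∈ l, ∀ s : Fin (2 * L), s.val / 2 = k → c s = c' s) →
      (l.map fun k => cellMatrix Z k c).prod = (l.map fun k => cellMatrix Z k c').prod := by
    intro c c' hc
    congr 1
    exact List.map_congr_left fun k hk => hcell c c' k (hc k hk)
  intro i j
  rcases isEmpty_or_nonempty (Config d L) with he | ⟨⟨c₀⟩⟩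
  · exact mulRankLE_one_of_left ⟨fun _ => 0, fun a b => he.elim (glue A a b)⟩
  · rcases h with h | h
    · refine mulRankLE_one_of_left ⟨fun a => ((l.map fun k =>
        cellMatrix Z k (glue A a fun s => c₀ s)).prod) i j, fun a b => ?_⟩
      exact congrFun (congrFun (hl (glue A a b) (glue A a fun s => c₀ s) fun k hk s hs => by
        simp [glue, h k hk s hs]) i) j
    · refine mulRankLE_one_of_right ⟨fun b => ((l.map fun k =>
        cellMatrix Z k (glue A (fun s => c₀ s) b)).prod) i j, fun a b => ?_⟩
      exact congrFun (congrFun (hl (glue A a b) (glue A (fun s => c₀ s) b) fun k hk s hs => by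
        simp [glue, h k hk s hs]) i) j

theorem matRankLE_cellMatrix {χ : ℕ} (Z : MPSTensor d χ) {k : ℕ} (hk : k < L) :
    MatRankLE A d fun c => cellMatrix Z k c := by
  simp only [cellMatrix, dif_pos hk]
  exact matRankLE_cell Z _ _

/-- The product of cells is split into five factors. The four multiplications and the trace cost
$\chi$ each, the two cells that may be cut cost $d$ each. -/
theorem schmidtRank_mpsState_le {χ x₁ LA : ℕ} (Z : MPSTensor d χ) (hLA0 : 0 < LA)
    (hLA : x₁ + 2 * LA < 2 * L) :
    schmidtRank (block L x₁ LA) (mpsState Z L) ≤ χ ^ 5 * d ^ 2 := by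
  set A := block L x₁ LA with hA
  set k₁ := x₁ / 2 with hk₁
  set k₂ := (x₁ + 2 * LA) / 2 with hk₂
  -- Cells before, at, between, at and after the two block ends; whatever the parity of `x₁`, the
  -- three stretches lie entirely on one side of the cut.
  have hsplit : List.range L = List.range' 0 k₁ ++ ([k₁] ++ (List.range' (k₁ + 1) (LA - 1) ++
      ([k₂] ++ List.range' (k₂ + 1) (L - k₂ - 1)))) := by
    have e1 : [k₂] ++ List.range' (k₂ + 1) (L - k₂ - 1) = List.range' k₂ (L - k₂) := by
      rw [show L - k₂ = (L - k₂ - 1) + 1 by omega]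
      rfl
    have e2 : List.range' (k₁ + 1) (LA - 1) ++ List.range' k₂ (L - k₂) =
        List.range' (k₁ + 1) (L - k₁ - 1) := by
      have := List.range'_append_1 (s := k₁ + 1) (m := LA - 1) (n := L - k₂)
      rw [show k₁ + 1 + (LA - 1) = k₂ by omega, show LA - 1 + (L - k₂) = L - k₁ - 1 by omega] at this
      exact this
    have e3 : [k₁] ++ List.range' (k₁ + 1) (L - k₁ - 1) = List.range' k₁ (L - k₁) := by
      rw [show L - k₁ = (L - k₁ - 1) + 1 by omega]
      rfl
    have e4 := List.range'_append_1 (s := 0) (m := k₁) (n := L - k₁)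
    rw [zero_add, show k₁ + (L - k₁) = L by omega] at e4
    rw [e1, e2, e3, e4, List.range_eq_range']
  have hprod : ∀ c : Config d L,
      (List.ofFn fun k : Fin L => Z (c (evenSite k)) (c (oddSite k))).prod =
      ((List.range' 0 k₁).map fun k => cellMatrix Z k c).prod * (cellMatrix Z k₁ c *
      (((List.range' (k₁ + 1) (LA - 1)).map fun k => cellMatrix Z k c).prod * (cellMatrix Z k₂ c *
      ((List.range' (k₂ + 1) (L - k₂ - 1)).map fun k => cellMatrix Z k c).prod))) := by
    intro c
    have : (List.ofFn fun k : Fin L => Z (c (evenSite k)) (c (oddSite k))) =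
        (List.range L).map fun k => cellMatrix Z k c := by
      rw [List.ofFn_eq_map, ← List.map_coe_finRange_eq_range, List.map_map]
      refine List.map_congr_left fun k _ => ?_
      simp [cellMatrix]
    rw [this, hsplit]
    simp only [List.map_append, List.prod_append, List.map_cons, List.map_nil, List.prod_cons,
      List.prod_nil, mul_one]
  have hmem : ∀ s : Fin (2 * L), s ∈ A ↔ x₁ ≤ s.val ∧ s.val < x₁ + 2 * LA := fun s => mem_block
  have g1 := matRankLE_prod (A := A) Z (List.range' 0 k₁) (Or.inr fun k hk s hs => by
    rw [List.mem_range'_1] at hk; rw [hmem]; omega)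
  have g2 := matRankLE_prod (A := A) Z (List.range' (k₁ + 1) (LA - 1)) (Or.inl fun k hk s hs => by
    rw [List.mem_range'_1] at hk; rw [hmem]; omega)
  have g3 := matRankLE_prod (A := A) Z (List.range' (k₂ + 1) (L - k₂ - 1))
    (Or.inr fun k hk s hs => by rw [List.mem_range'_1] at hk; rw [hmem]; omega)
  have h1 := matRankLE_cellMatrix (A := A) Z (show k₁ < L by omega)
  have h2 := matRankLE_cellMatrix (A := A) Z (show k₂ < L by omega)
  have hall := g1.mul (h1.mul (g2.mul (h2.mul g3)))
  have htr := MulRankLE.sum Finset.univ fun i (_ : i ∈ (Finset.univ : Finset (Fin χ))) => hall i i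
  have hconst : MulRankLE A 1 fun _ : Config d L => (((Real.sqrt ((d : ℝ) ^ L))⁻¹ : ℝ) : ℂ) :=
    mulRankLE_one_of_left ⟨fun _ => _, fun a b => rfl⟩
  have hfin := (hconst.mul htr) 1
  rw [mul_one] at hfin
  rw [Finset.card_univ, Fintype.card_fin] at hfin
  have hψ : mpsState Z L = (fun _ : Config d L => (((Real.sqrt ((d : ℝ) ^ L))⁻¹ : ℝ) : ℂ)) *
      ∑ i : Fin χ, fun c =>
      (((List.range' 0 k₁).map fun k => cellMatrix Z k c).prod * (cellMatrix Z k₁ c *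
      (((List.range' (k₁ + 1) (LA - 1)).map fun k => cellMatrix Z k c).prod * (cellMatrix Z k₂ c *
      ((List.range' (k₂ + 1) (L - k₂ - 1)).map fun k => cellMatrix Z k c).prod)))) i i := by
    funext c
    rw [Pi.mul_apply, Finset.sum_apply, mpsState, hprod c]
    rfl
  rw [hψ]
  refine hfin.trans ((Nat.mul_le_mul_left _ schmidtRank_one_le).trans_eq ?_)
  ring

end SchmidtRank

/-! ### The entanglement velocity -/

section Velocity

variable {d χ : ℕ} {U : Gate d} {Z : MPSTensor d χ}

theorem IsRGFixedPoint.one_le (hZ : IsRGFixedPoint Z) : 1 ≤ χ := by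
  obtain ⟨w, _, h1, _⟩ := hZ
  rcases Nat.eq_zero_or_pos χ with h0 | h0
  · subst h0
    simp at h1
  · exact h0

theorem averagedEntropy_le (hd : 2 ≤ d) (hU : IsDualUnitary U) (hZ : IsRGFixedPoint Z)
    {x₁ L LA t : ℕ} (hLA : 0 < LA) (hL : x₁ + 2 * LA < 2 * L) :
    averagedEntropy U Z x₁ L LA t ≤ Real.log (χ ^ 5 * d ^ 2) + 4 * t * Real.log d := by
  have hχ := hZ.one_le
  have hχ' : (0 : ℝ) < χ := by exact_mod_cast hχ
  have hd' : (0 : ℝ) < d := by exact_mod_cast (by omega : 0 < d)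
  have h1 : ∀ u, entropyAt U Z x₁ L LA t u ≤ Real.log (χ ^ 5 * d ^ 2) + 4 * t * Real.log d := by
    intro u
    have h2 := (schmidtRank_evolve_le (by omega) hL U (mpsState Z L) t u).trans
      (Nat.mul_le_mul_left _ (schmidtRank_mpsState_le Z hLA hL))
    have h3 : (schmidtRank (block L x₁ LA) (evolve U (mpsState Z L) t u) : ℝ) ≤
        χ ^ 5 * d ^ 2 * d ^ (4 * t) := by
      rw [mul_comm]
      exact_mod_cast h2
    refine (entanglementEntropy_le_log_schmidtRank _ ?_ (by positivity) h3).trans_eq ?_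
    · rw [sum_evolve_mul_star hU.1, sum_mpsState_mul_star hZ (by omega)]
    · rw [Real.log_mul (by positivity) (by positivity), Real.log_pow]
      push_cast
      ring
  calc averagedEntropy U Z x₁ L LA t ≤
      ∫ _, (Real.log (χ ^ 5 * d ^ 2) + 4 * t * Real.log d) ∂(noiseMeasure d L t) :=
        integral_mono (integrable_entropyAt U Z x₁ L LA t) (integrable_const _) h1
    _ = _ := by simp

theorem le_averagedEntropy (hU : IsDualUnitary U) (hZ : IsRGFixedPoint Z) {x₁ L LA t : ℕ}
    (hL : 0 < L) {K : ℝ} (hK : 0 < K)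
    (hpur : ‖∫ u, purity (fun s => decide (s ∈ block L x₁ LA)) (evolve U (mpsState Z L) t u)
        ∂(noiseMeasure d L t)‖ ≤ K) :
    -Real.log K ≤ averagedEntropy U Z x₁ L LA t := by
  set P : (NoiseLabel L t → UGroup d) → ℂ := fun u =>
    purity (fun s => decide (s ∈ block L x₁ LA)) (evolve U (mpsState Z L) t u) with hP
  have hcont : Continuous P := continuous_purity _ (continuous_evolve U _ t)
  have hint : Integrable P (noiseMeasure d L t) := integrable_of_continuous _ hcont
  have hre : Integrable (fun u => (P u).re) (noiseMeasure d L t) := hint.re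
  have h1 : ∀ u, -Real.log K + 1 - (P u).re / K ≤ entropyAt U Z x₁ L LA t u := by
    intro u
    have hψ : ∑ c, evolve U (mpsState Z L) t u c * star (evolve U (mpsState Z L) t u c) = 1 := by
      rw [sum_evolve_mul_star hU.1, sum_mpsState_mul_star hZ hL]
    have := le_sum_negMulLog (reducedDensity_isHermitian (block L x₁ LA) (evolve U (mpsState Z L) t u))
      (eigenvalues_reducedDensity_nonneg _ _) ((trace_reducedDensity _ _).trans hψ) hK
    rw [hP]
    beta_reduce
    rw [purity_eq_trace]
    exact this
  have h2 : ∫ u, (P u).re ∂(noiseMeasure d L t) ≤ K := by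
    have h3 : ∫ u, (P u).re ∂(noiseMeasure d L t) = (∫ u, P u ∂(noiseMeasure d L t)).re :=
      integral_re hint
    rw [h3]
    exact (Complex.re_le_norm _).trans hpur
  calc -Real.log K ≤ -Real.log K + 1 - (∫ u, (P u).re ∂(noiseMeasure d L t)) / K := by
        have : (∫ u, (P u).re ∂(noiseMeasure d L t)) / K ≤ 1 := (div_le_one hK).mpr h2
        linarith
    _ = ∫ u, (-Real.log K + 1 - (P u).re / K) ∂(noiseMeasure d L t) := by
        rw [integral_sub (integrable_const _) (hre.div_const _), integral_div]
        simp
    _ ≤ averagedEntropy U Z x₁ L LA t :=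
        integral_mono ((integrable_const _).sub (hre.div_const _))
          (integrable_entropyAt U Z x₁ L LA t) h1

theorem tendsto_log_add_div {a b c : ℝ} (hc : c ≠ 0) :
    Tendsto (fun n : ℕ => (a + b * Real.log n) / (c * n)) atTop (𝓝 0) := by
  have h1 : Tendsto (fun n : ℕ => Real.log n / (n : ℝ)) atTop (𝓝 0) := by
    have := (Real.isLittleO_log_id_atTop.tendsto_div_nhds_zero).comp tendsto_natCast_atTop_atTop
    exact this
  have h2 : Tendsto (fun n : ℕ => a / (n : ℝ)) atTop (𝓝 0) := tendsto_const_div_atTop_nhds_zero_nat a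
  have h3 := (h2.add (h1.const_mul b)).div_const c
  rw [mul_zero, add_zero, zero_div] at h3
  refine h3.congr fun n => ?_
  field_simp

/-- Both bounds differ from $4t\log d$ by $O(\log t)$, so the limit in $t$ exists and the limsup
equals it. -/
theorem hasAveragedEntanglementVelocity_one (hd : 2 ≤ d) (hU : IsDualUnitary U)
    (hcond : lambdaOf d (entanglingPower U) * (χ : ℝ) *
        (((d : ℝ) + 1) / ((d : ℝ) - 1) + Real.sqrt (((d : ℝ) + 1) / ((d : ℝ) - 1))) < 1 / (d : ℝ))
    (hZ : IsRGFixedPoint Z) (x₁ : ℕ) : HasAveragedEntanglementVelocity U Z x₁ 1 := by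
  have hχ : (1 : ℝ) ≤ χ := by exact_mod_cast hZ.one_le
  obtain ⟨hd4, hl⟩ := four_le_and_lambdaOf_lt hd hχ hcond
  have hW := sum_abs_gateWeight_le hd4 hl
  have hc := sq_weights_le hd4 hl
  have hd' : (4 : ℝ) ≤ d := by exact_mod_cast hd4
  have hd0 : (0 : ℝ) < d := by linarith
  have hlog : 0 < Real.log d := Real.log_pos (by linarith)
  obtain ⟨F, F₀, hF, hF₀⟩ := exists_averagedEntropy_limit hU.1 hZ x₁
  have hval : ∀ t LA L : ℕ, x₁ + 2 * t + 3 ≤ LA → x₁ + LA + 2 * t + 4 ≤ L →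
      F₀ t = averagedEntropy U Z x₁ L LA t := fun t LA L h1 h2 => by rw [hF t LA L h2, hF₀ t LA h1]
  have hupper : ∀ t, F₀ t ≤ Real.log (χ ^ 5 * d ^ 2) + 4 * t * Real.log d := by
    intro t
    rw [hval t (x₁ + 2 * t + 3) (x₁ + (x₁ + 2 * t + 3) + 2 * t + 4) le_rfl le_rfl]
    exact averagedEntropy_le hd hU hZ (by omega) (by omega)
  have hlower : ∀ n : ℕ, 1 ≤ n → 4 * n * Real.log d - 2 * Real.log d -
      -- The purity bound is the square of $(1+8dn^2)\,d^{-(2n-1)}$, and $1+8dn^2\le9dn^2$ for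
      -- $n\ge1$.
      2 * (Real.log (9 * d) + 2 * Real.log n) ≤ F₀ n := by
    intro n hn
    obtain ⟨t, rfl⟩ : ∃ t, n = t + 1 := ⟨n - 1, by omega⟩
    obtain ⟨LA, hLA⟩ : ∃ LA, LA = x₁ + 2 * (t + 1) + 3 := ⟨_, rfl⟩
    obtain ⟨L, hL⟩ : ∃ L, L = x₁ + LA + 6 * t + 8 := ⟨_, rfl⟩
    rw [hval (t + 1) LA L hLA.ge (by omega)]
    have hpur := norm_integral_purity_block_le (t := t) (x₁ := x₁) (LA := LA) (L := L) hd hU hW hc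
      (sum_mpsState_mul_star hZ (by omega)) (by omega) (by omega)
    have hle := le_averagedEntropy hU hZ (by omega) (by positivity) hpur
    refine le_trans ?_ hle
    have hn' : (1 : ℝ) ≤ (t : ℝ) + 1 := by
      have : (0 : ℝ) ≤ t := Nat.cast_nonneg t
      linarith
    have h1 : Real.log (1 + 2 * d * (2 * t + 2) ^ 2) ≤ Real.log (9 * d) + 2 * Real.log (t + 1) := by
      have e : Real.log (9 * d) + 2 * Real.log ((t : ℝ) + 1) = Real.log (9 * d * (t + 1) ^ 2) := by
        rw [Real.log_mul (x := 9 * d) (by positivity) (by positivity), Real.log_pow]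
        push_cast
        ring
      rw [e]
      refine Real.log_le_log (by positivity) ?_
      nlinarith [mul_nonneg hd0.le (sub_nonneg.mpr (one_le_pow₀ hn' (n := 2)))]
    have h2 : Real.log (((1 + 2 * d * (2 * t + 2) ^ 2) * (1 / d) ^ (2 * t + 1)) ^ 2) =
        2 * (Real.log (1 + 2 * d * (2 * t + 2) ^ 2) - (2 * t + 1) * Real.log d) := by
      rw [Real.log_pow, Real.log_mul (by positivity) (by positivity), Real.log_pow, one_div,
        Real.log_inv]
      push_cast
      ring
    rw [h2]
    push_cast
    linarith
  -- At `t = 0` the quotient is zero by the convention for division, which is irrelevant for the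
  -- limsup.
  refine ⟨fun L LA t => integrable_entropyAt U Z x₁ L LA t, fun t LA => F t LA / (4 * t * Real.log d),
    fun t => F₀ t / (4 * t * Real.log d), fun t LA => ?_, fun t => ?_, ?_⟩
  · refine tendsto_const_nhds.congr' ?_
    filter_upwards [eventually_ge_atTop (x₁ + LA + 2 * t + 4)] with L hL
    rw [hF t LA L hL]
  · refine tendsto_const_nhds.congr' ?_
    filter_upwards [eventually_ge_atTop (x₁ + 2 * t + 3)] with LA hLA
    rw [hF₀ t LA hLA]
  · have hlim : Tendsto (fun t : ℕ => F₀ t / (4 * t * Real.log d)) atTop (𝓝 1) := by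
      have hup : Tendsto (fun n : ℕ => 1 + (Real.log (χ ^ 5 * d ^ 2) + 0 * Real.log n) /
          (4 * Real.log d * n)) atTop (𝓝 1) := by
        simpa using tendsto_const_nhds.add
          (tendsto_log_add_div (a := Real.log (χ ^ 5 * d ^ 2)) (b := 0)
            (c := 4 * Real.log d) (by positivity))
      have hlo : Tendsto (fun n : ℕ => 1 - (2 * Real.log d + 2 * Real.log (9 * d) + 4 * Real.log n) /
          (4 * Real.log d * n)) atTop (𝓝 1) := by
        simpa using tendsto_const_nhds.sub
          (tendsto_log_add_div (a := 2 * Real.log d + 2 * Real.log (9 * d)) (b := 4)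
            (c := 4 * Real.log d) (by positivity))
      refine tendsto_of_tendsto_of_tendsto_of_le_of_le' hlo hup ?_ ?_
      · filter_upwards [eventually_ge_atTop 1] with n hn
        have hn' : (0 : ℝ) < n := by exact_mod_cast hn
        rw [le_div_iff₀ (by positivity), sub_mul, one_mul, mul_right_comm 4 (n : ℝ),
          div_mul_cancel₀ _ (by positivity)]
        have := hlower n hn
        linarith
      · filter_upwards [eventually_ge_atTop 1] with n hn
        have hn' : (0 : ℝ) < n := by exact_mod_cast hn
        rw [div_le_iff₀ (by positivity), add_mul, one_mul, mul_right_comm 4 (n : ℝ),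
          div_mul_cancel₀ _ (by positivity)]
        have := hupper n
        linarith
    exact ⟨hlim.isBoundedUnder_le, hlim.isBoundedUnder_ge, hlim.limsup_eq⟩

end Velocity

end DualUnitary

end

theorem mainTheorem4 (d χ : ℕ) (hd : 2 ≤ d)
    (U : DualUnitary.Gate d) (hU : DualUnitary.IsDualUnitary U)
    (hcond : DualUnitary.lambdaOf d (DualUnitary.entanglingPower U) * (χ : ℝ) *
        (((d : ℝ) + 1) / ((d : ℝ) - 1) + Real.sqrt (((d : ℝ) + 1) / ((d : ℝ) - 1))) <
      1 / (d : ℝ))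
    (Z : DualUnitary.MPSTensor d χ) (hZ : DualUnitary.IsRGFixedPoint Z) (x₁ : ℕ) :
    DualUnitary.HasAveragedEntanglementVelocity U Z x₁ 1 :=
  DualUnitary.hasAveragedEntanglementVelocity_one hd hU hcond hZ x₁
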